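/- Let $G$ be a locally compact Hausdorff topological group and $R$ a ring. A $G$-pair $(X,A)$ is a topological space $X$ with a continuous left $G$-action together with a $G$-invariant subspace $A$. Let $(\mathfrak H^G_*,\partial_*)$ be a generalized equivariant homology theory: functors $\mathfrak H^G_n$ ($n\in\mathbb Z$) from $G$-pairs and continuous equivariant maps to left $R$-modules, with natural $R$-linear maps $\partial_n:\mathfrak H^G_n(X,A)\to\mathfrak H^G_{n-1}(A)=\mathfrak H^G_{n-1}(A,\emptyset)$, satisfying exactness of the long sequence of a pair, $G$-homotopy invariance, and excision ($\mathfrak H^G_*(X\setminus U,A\setminus U)\cong\mathfrak H^G_*(X,A)$ for invariant $U$ with $\bar U\subseteq\mathrm{Int}(A)$). The boundary map of a triple $(X,B,A)$ is $\mathfrak H_n^G(X,B)\to\mathfrak H^G_{n-1}(B)\to\mathfrak H^G_{n-1}(B,A)$. **Simplicial $G$-complexes.** An abstract simplicial $G$-complex on a $G$-set $V$ is an abstract simplicial complex on $V$ that contains all singletons, is preserved by $G$, and is such that any $g$ with $gs=s$ for a simplex $s$ fixes every vertex of $s$. Write $G_s$ for the stabilizer of $s$, and identify $s$ with the convex hull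 of its vertices in $\mathbb RV$. The realization $X$ is the quotient of $\coprod_s G/G_s\times s$ that identifies $(aG_s,x)$ with $(bG_t,y)$ whenever there are $g\in G$ and a simplex $r$ with $x\in r\subseteq s$, $y=gx\in gr\subseteq t$ and $a^{-1}bg\in G_r$; it has the topology coherent with the induced maps $\chi_s:G/G_s\times s\to X$. (As a $G$-set it is the usual realization, and $\chi_s(aG_s,x)=ax$.) Let $A\subseteq X$ be the realization of a $G$-subcomplex. Let $C_p(X,A)$ be the $G$-set of $p$-simplices of $X$ not in $A$, let $X_p$ be the union of $A$ and all simplices of dimension at most $p$ (so $X_p=A$ for $p<0$), and let ${\cal A}_qC^G_p(X,A)=\mathfrak H^G_{p+q}(X_p,X_{p-1})$, with boundary ${\cal A}_q\partial_p$ the boundary map of the triple $(X_p,X_{p-1},X_{p-2})$. **Coefficients.** For $H\le K\le G$ let $\kappa(K,H):G/H\to G/K$, $aH\mapsto aK$; for $s$ in a $G$-set $S$ and $g\in G$ let $G_s^g=gG_sg^{-1}=G_{gs}$ and $\mu_g:G/G_s^g\to G/G_s$, $aG_s^g\mapsto agG_s$. Let $\mathfrak H_q^G(S)$ be the quotient of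 $\bigoplus_{t\in S}\mathfrak H_q^G(G/G_t)$ by the submodule generated by all $x\otimes gs-\mathfrak H_q^G(\mu_g)(x)\otimes s$, where $y\otimes t$ denotes $y$ in the summand of index $t$; denote the class of $y\otimes t$ by $[y\otimes t]$. **Simplices.** For an ordered $p$-simplex $s$ with vertices $v_0<\dots<v_p$, let $s_k$ be the face without $v_k$, with the induced order, and $\hat s_k$ the union of the other $(p-1)$-dimensional faces. For $H\le G$ (acting on the first factor of $G/H\times s$) let $[s:s_k]$ be the composite $$\mathfrak H^G_n(G/H\times s,G/H\times\partial s)\xrightarrow{\partial}\mathfrak H^G_{n-1}(G/H\times\partial s,G/H\times\hat s_k)\xleftarrow{}\mathfrak H^G_{n-1}(G/H\times s_k,G/H\times\partial s_k)$$ (the second map inverted), and let $\zeta(H,s)_n:\mathfrak H^G_n(G/H\times s,G/H\times\partial s)\to\mathfrak H^G_{n-p}(G/H)$ be induced by the projection if $p=0$ and equal to $(-1)^p\zeta(H,s_p)_{n-1}\circ[s:s_p]$ if $p>0$. **Orderings and representatives.** Choose for every simplex in $C_p(X,A)$, $p\ge0$, a preferred vertex ordering (not necessarily compatible with faces or with the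 action), and for every $p$ a set ${\cal R}_p$ of representatives of the $G$-orbits of $C_p(X,A)$. Let $\mathrm{sign}(g,s)$ be the sign of the permutation that puts the vertices of $gs$, in the order induced by the preferred order of $s$, into the preferred order of $gs$. For $s\in C_p(X,A)$ with $p\ge 1$ and $s_k\notin A$, write $s_k=hr$ with $h\in G$, $r\in{\cal R}_{p-1}$, and let $\varepsilon(s,k)$ be the sign of the permutation relating the order on $s_k$ induced by the preferred order of $s$ to the order transported by $h$ from the preferred order of $r$. **Theorem.** Assume that $\mathfrak H^G_*$ satisfies the arbitrary disjoint union property (for every family of $G$-pairs the canonical map $\bigoplus_i\mathfrak H^G_*(X_i,A_i)\to\mathfrak H^G_*(\coprod_iX_i,\coprod_iA_i)$ is an isomorphism), or that every $C_p(X,A)$ has only finitely many $G$-orbits. Then: 1. The maps that are inverted in the definition of $[s:s_k]$ are isomorphisms, and so are all $[s:s_k]$ ($p\ge1$) and $\zeta(H,s)_n$. 2. For all $p\ge0$ and $q\in\mathbb Z$ there is an isomorphism of $R$-modules $$\alpha_{p,q}:\mathfrak H_q^G\bigl(C_p(X,A)\bigr)\to{\cal A}_qC_p^G(X,A)=\mathfrak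 H_{p+q}^G(X_p,X_{p-1})$$ such that $$\alpha_{p,q}([x\otimes gs])=\mathrm{sign}(g,s)\,\mathfrak H^G_{p+q}(\chi_{gs})\circ\zeta(G_s^g,gs)_{p+q}^{-1}(x)$$ for all $s\in{\cal R}_p$, $g\in G$ and $x\in\mathfrak H_q^G(G/G_s^g)$, where $gs$ has its preferred order in $\zeta(G_s^g,gs)$. (For $p<0$ both modules vanish.) 3. For $p\ge1$ one has ${\cal A}_q\partial_p\circ\alpha_{p,q}=\alpha_{p-1,q}\circ\partial_p$, where $\partial_p:\mathfrak H_q^G(C_p(X,A))\to\mathfrak H_q^G(C_{p-1}(X,A))$ is an $R$-linear map such that $$\partial_p[x\otimes gs]=\sum_{k=0}^p(-1)^k\,\varepsilon(s,k)\,\bigl[\mathfrak H_q^G(\kappa(G_{s_k}^g,G_s^g))(x)\otimes gs_k\bigr]$$ for all $s\in{\cal R}_p$, $g\in G$ and $x\in\mathfrak H_q^G(G/G_s^g)$; here $s_k$ is the $k$-th face of $s$ in the preferred order, and the terms with $s_k$ in $A$ are $0$. 4. If $\mathrm{sign}(g,s)=1$ for all $g$ and $s$, then the formula for $\alpha_{p,q}$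 holds for all $s\in C_p(X,A)$. If, in addition, for every $s$ and every face $s_k$ not in $A$ the order on $s_k$ induced from $s$ agrees up to an even permutation with the preferred order of $s_k$, then for all $s\in C_p(X,A)$, $p\ge1$, $$\partial_p[x\otimes gs]=\sum_{k=0}^p(-1)^k\,\bigl[\mathfrak H_q^G(\kappa(G_{s_k}^g,G_s^g))(x)\otimes gs_k\bigr].$$ -/

import Mathlib

open CategoryTheory
open scoped Pointwise DirectSum

universe u v w

noncomputable section

namespace EquivHom

/-! ### Pairs of `G`-spaces -/

section GPairs

variable {G : Type u} [Group G] [TopologicalSpace G]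

instance subMulActionContinuousSMul {Y : Type u} [TopologicalSpace Y] [MulAction G Y]
    [ContinuousSMul G Y] (B : SubMulAction G Y) : ContinuousSMul G B where
  continuous_smul := by
    refine Continuous.subtype_mk (f := fun z : G × B => z.1 • (z.2 : Y)) ?_ _
    fun_prop

instance sigmaContinuousSMul {ι : Type u} {Y : ι → Type u} [∀ i, TopologicalSpace (Y i)]
    [∀ i, MulAction G (Y i)] [∀ i, ContinuousSMul G (Y i)] : ContinuousSMul G (Σ i, Y i) where
  continuous_smul := by
    let e : (Σ i, Y i × G) ≃ₜ (Σ i, Y i) × G := Homeomorph.sigmaProdDistrib.symm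
    have h1 : Continuous fun z : Σ i, Y i × G =>
        (⟨z.1, z.2.2 • z.2.1⟩ : Σ i, Y i) := by
      refine continuous_sigma fun i => ?_
      have h0 : Continuous fun a : Y i × G => a.2 • a.1 := by fun_prop
      exact continuous_sigmaMk.comp h0
    have h2 : Continuous fun z : (Σ i, Y i) × G => z.2 • z.1 := by
      rw [← e.comp_continuous_iff']
      exact h1
    exact h2.comp continuous_swap

/-- A `G`-pair `(X, A)`: a topological space with a continuous left `G`-action, and a
`G`-invariant subspace `A ⊆ X`. -/
structure GPair (G : Type u) [Group G] [TopologicalSpace G] where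
  X : Type u
  [top : TopologicalSpace X]
  [act : MulAction G X]
  [cont : ContinuousSMul G X]
  A : SubMulAction G X

attribute [instance] GPair.top GPair.act GPair.cont

namespace GPair

/-- Equivariant (continuous) maps of `G`-pairs. -/
@[ext]
structure Hom (P Q : GPair G) where
  toFun : P.X → Q.X
  continuous_toFun : Continuous toFun
  map_smul : ∀ (g : G) (x : P.X), toFun (g • x) = g • toFun x
  map_mem : ∀ x ∈ P.A, toFun x ∈ Q.A

instance : Category (GPair G) where
  Hom := Hom
  id P := ⟨id, continuous_id, fun _ _ => rfl, fun _ hx => hx⟩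
  comp f g := ⟨g.toFun ∘ f.toFun, g.continuous_toFun.comp f.continuous_toFun,
    fun a x => by simp [f.map_smul, g.map_smul], fun x hx => g.map_mem _ (f.map_mem x hx)⟩

/-- The `G`-pair `(X, ∅)`. -/
def abs (G : Type u) [Group G] [TopologicalSpace G] (Y : Type u) [TopologicalSpace Y]
    [MulAction G Y] [ContinuousSMul G Y] : GPair G where
  X := Y
  A := ⊥

theorem not_mem_abs {Y : Type u} [TopologicalSpace Y] [MulAction G Y] [ContinuousSMul G Y]
    (x : (abs G Y).X) : x ∉ (abs G Y).A := fun h => h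

/-- The `G`-pair `(B, B ∩ A)` for invariant subspaces `A`, `B` of a `G`-space `Y`. -/
def of {Y : Type u} [TopologicalSpace Y] [MulAction G Y] [ContinuousSMul G Y]
    (B A : SubMulAction G Y) : GPair G where
  X := B
  A := { carrier := {y | (y : Y) ∈ A}
         smul_mem' := fun g _ hy => A.smul_mem g hy }

/-- The functor `(X, A) ↦ (A, ∅)`. -/
def subFunctor (G : Type u) [Group G] [TopologicalSpace G] : GPair G ⥤ GPair G where
  obj P := abs G P.A
  map {P Q} f :=
    { toFun := fun x => (⟨f.toFun x.1, f.map_mem _ x.2⟩ : Q.A)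
      continuous_toFun := Continuous.subtype_mk
        (f.continuous_toFun.comp continuous_subtype_val) _
      map_smul := fun g x => Subtype.ext (f.map_smul g x.1)
      map_mem := fun x hx => (not_mem_abs x hx).elim }

/-- The inclusion `(A, ∅) → (X, ∅)`. -/
def subIncl (P : GPair G) : (subFunctor G).obj P ⟶ abs G P.X where
  toFun := Subtype.val
  continuous_toFun := continuous_subtype_val
  map_smul _ _ := rfl
  map_mem x hx := (not_mem_abs x hx).elim

/-- The inclusion `(X, ∅) → (X, A)`. -/
def toPair (P : GPair G) : abs G P.X ⟶ P where
  toFun := id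
  continuous_toFun := continuous_id
  map_smul _ _ := rfl
  map_mem x hx := (not_mem_abs x hx).elim

/-- The inclusion `(X \ U, A \ U) → (X, A)`. -/
def excisionIncl (P : GPair G) (U : SubMulAction G P.X) : GPair.of Uᶜ P.A ⟶ P where
  toFun := Subtype.val
  continuous_toFun := continuous_subtype_val
  map_smul _ _ := rfl
  map_mem _ hx := hx

/-- The disjoint union of a family of `G`-pairs. -/
def sigma {ι : Type u} (P : ι → GPair G) : GPair G where
  X := Σ i, (P i).X
  A := { carrier := {x | x.2 ∈ (P x.1).A}
         smul_mem' := fun g x hx => (P x.1).A.smul_mem g hx }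

/-- The inclusion of a summand in a disjoint union. -/
def sigmaIncl {ι : Type u} (P : ι → GPair G) (i : ι) : P i ⟶ sigma P where
  toFun x := (⟨i, x⟩ : Σ j, (P j).X)
  continuous_toFun := continuous_sigmaMk (σ := fun j => (P j).X)
  map_smul _ _ := rfl
  map_mem _ hx := hx

/-- The inclusion `(B, B ∩ A) → (B', B' ∩ A')` of pairs of invariant subspaces of `Y`. -/
def incl {Y : Type u} [TopologicalSpace Y] [MulAction G Y] [ContinuousSMul G Y]
    {B A B' A' : SubMulAction G Y} (hB : B ≤ B') (hA : A ≤ A') : of B A ⟶ of B' A' where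
  toFun x := (⟨x.1, hB x.2⟩ : B')
  continuous_toFun := Continuous.subtype_mk continuous_subtype_val _
  map_smul _ _ := rfl
  map_mem _ hx := hA hx

/-- The inclusion of the subspace of the pair `(B, A)` into the pair `(A, C)`. -/
def subToPair {Y : Type u} [TopologicalSpace Y] [MulAction G Y] [ContinuousSMul G Y]
    (B A C : SubMulAction G Y) : (subFunctor G).obj (of B A) ⟶ of A C where
  toFun x := (⟨x.1.1, x.2⟩ : A)
  continuous_toFun := by
    have h0 : Continuous fun x : (of B A).A => (x.1 : of B A |>.X) := continuous_subtype_val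
    have h1 : Continuous fun y : B => (y : Y) := continuous_subtype_val
    exact Continuous.subtype_mk (h1.comp h0) _
  map_smul _ _ := rfl
  map_mem x hx := (not_mem_abs x hx).elim

end GPair

end GPairs

/-! ### Generalized equivariant homology theories -/

/-- A generalized equivariant homology theory on the category of `G`-pairs with values in graded
left `R`-modules: functors `𝔥ₙ`, natural boundary maps `∂ₙ : 𝔥ₙ(X, A) ⟶ 𝔥ₙ₋₁(A)` (indexed by
pairs `n`, `m` with `m + 1 = n`), and the exactness, homotopy and excision axioms. -/
structure HomologyTheory (G : Type u) [Group G] [TopologicalSpace G] (R : Type v) [Ring R] where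
  H : ℤ → GPair G ⥤ ModuleCat.{w} R
  bd : ∀ n m : ℤ, m + 1 = n → (H n ⟶ GPair.subFunctor G ⋙ H m)
  exact_space : ∀ (n : ℤ) (P : GPair G),
    Function.Exact ((H n).map P.subIncl).hom ((H n).map P.toPair).hom
  exact_pair : ∀ (n m : ℤ) (hnm : m + 1 = n) (P : GPair G),
    Function.Exact ((H n).map P.toPair).hom ((bd n m hnm).app P).hom
  exact_sub : ∀ (n m : ℤ) (hnm : m + 1 = n) (P : GPair G),
    Function.Exact ((bd n m hnm).app P).hom ((H m).map P.subIncl).hom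
  homotopy : ∀ (P Q : GPair G) (f g : P ⟶ Q) (F : P.X × unitInterval → Q.X), Continuous F →
    (∀ (a : G) (x : P.X) (t : unitInterval), F (a • x, t) = a • F (x, t)) →
    (∀ x ∈ P.A, ∀ t : unitInterval, F (x, t) ∈ Q.A) →
    (∀ x, F (x, 0) = f.toFun x) → (∀ x, F (x, 1) = g.toFun x) →
    ∀ n : ℤ, (H n).map f = (H n).map g
  excision : ∀ (P : GPair G) (U : SubMulAction G P.X),
    closure (U : Set P.X) ⊆ interior (P.A : Set P.X) →
    ∀ n : ℤ, IsIso ((H n).map (P.excisionIncl U))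

/-- The inverse of a bijective linear map (and `0` if the map is not bijective). -/
def linInv {R : Type v} [Ring R] {M N : Type w} [AddCommGroup M] [AddCommGroup N] [Module R M]
    [Module R N] (f : M →ₗ[R] N) : N →ₗ[R] M := by
  classical
  exact if hf : Function.Bijective f then (LinearEquiv.ofBijective f hf).symm.toLinearMap else 0

namespace HomologyTheory

variable {G : Type u} [Group G] [TopologicalSpace G] {R : Type v} [Ring R]

open Classical in
/-- The arbitrary disjoint union property. -/
def HasDisjointUnions (h : HomologyTheory.{u, v, w} G R) : Prop :=
  ∀ (n : ℤ) (ι : Type u) (P : ι → GPair G),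
    Function.Bijective (DirectSum.toModule R ι ((h.H n).obj (GPair.sigma P))
      (fun i => ((h.H n).map (GPair.sigmaIncl P i)).hom))

/-- The boundary map `𝔥ₙ(B, A) → 𝔥ₙ₋₁(A, C)` of a triple of invariant subspaces `C ⊆ A ⊆ B` of a
`G`-space, that is the composition `𝔥ₙ(B, A) → 𝔥ₙ₋₁(A) → 𝔥ₙ₋₁(A, C)`. -/
def tripleBd (h : HomologyTheory.{u, v, w} G R) {Y : Type u} [TopologicalSpace Y] [MulAction G Y]
    [ContinuousSMul G Y] (B A C : SubMulAction G Y) (n m : ℤ) (hnm : m + 1 = n) :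
    (h.H n).obj (GPair.of B A) →ₗ[R] (h.H m).obj (GPair.of A C) :=
  ((h.H m).map (GPair.subToPair B A C)).hom ∘ₗ ((h.bd n m hnm).app (GPair.of B A)).hom

end HomologyTheory

/-! ### Canonical orbits and coefficient systems -/

/-- The category of canonical `G`-orbits: its objects are the coset spaces `G ⧸ H` and its
morphisms the equivariant maps. -/
structure OrbitCat (G : Type u) [Group G] where
  subgroup : Subgroup G

section Orbits

variable {G : Type u} [Group G]

instance : Category (OrbitCat G) where
  Hom H K := (G ⧸ H.subgroup) →[G] (G ⧸ K.subgroup)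
  id H := MulActionHom.id G
  comp f g := MulActionHom.comp g f

/-- The equivariant map `G ⧸ H → G ⧸ K`, `aH ↦ agK`, defined when `g⁻¹Hg ≤ K`. -/
def cosetMap (H K : Subgroup G) (g : G) (hg : ∀ x ∈ H, g⁻¹ * x * g ∈ K) :
    (⟨H⟩ : OrbitCat G) ⟶ ⟨K⟩ where
  toFun := Quotient.lift (fun a : G => ((a * g : G) : G ⧸ K)) (by
    intro a b hab
    have hab' : a⁻¹ * b ∈ H := QuotientGroup.leftRel_apply.mp hab
    refine QuotientGroup.eq.mpr ?_
    have := hg _ hab'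
    simpa [mul_assoc] using this)
  map_smul' m x := by
    induction x using Quotient.inductionOn with
    | h a => exact congrArg (fun z : G => (z : G ⧸ K)) (mul_assoc m a g)

/-- `μ(g, G_s) : G ⧸ G_{gs} → G ⧸ G_s`, `a G_{gs} ↦ a g G_s`. Recall that the stabilizer `G_{gs}`
is the conjugate subgroup `g G_s g⁻¹`. -/
def mu {S : Type u} [MulAction G S] (g : G) (s : S) :
    (⟨MulAction.stabilizer G (g • s)⟩ : OrbitCat G) ⟶ ⟨MulAction.stabilizer G s⟩ :=
  cosetMap _ _ g (by
    intro x hx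
    rw [MulAction.mem_stabilizer_iff] at hx ⊢
    rw [mul_smul, mul_smul, hx, inv_smul_smul])

/-- `κ(K, H) : G ⧸ H → G ⧸ K`, `aH ↦ aK`, for `H ≤ K`. -/
def kappa {H K : Subgroup G} (hHK : H ≤ K) : (⟨H⟩ : OrbitCat G) ⟶ ⟨K⟩ :=
  cosetMap _ _ 1 (fun x hx => by simpa using hHK hx)

variable {R : Type v} [Ring R]

open Classical in
/-- The submodule `J` of `⨁_{t ∈ S} M(G ⧸ G_t)` generated by all elements
`x ⊗ gs - M(μ(g, G_s))(x) ⊗ s`; here `y ⊗ t` is the element `y` of the summand of index `t`. -/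
def orbitRel (M : OrbitCat G ⥤ ModuleCat.{w} R) (S : Type u) [MulAction G S] :
    Submodule R (⨁ t : S, M.obj ⟨MulAction.stabilizer G t⟩) :=
  Submodule.span R {z | ∃ (g : G) (s : S) (x : M.obj ⟨MulAction.stabilizer G (g • s)⟩),
    z = DirectSum.lof R S (fun t => M.obj ⟨MulAction.stabilizer G t⟩) (g • s) x -
      DirectSum.lof R S (fun t => M.obj ⟨MulAction.stabilizer G t⟩) s ((M.map (mu g s)).hom x)}

/-- The extension `M(S)` of the coefficient system `M` to a `G`-set `S`. The relations only
involve summands of one orbit, so that this is the direct sum over the orbits of `S` of the orbit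
modules. -/
abbrev GSetModule (M : OrbitCat G ⥤ ModuleCat.{w} R) (S : Type u) [MulAction G S] : Type _ :=
  (⨁ t : S, M.obj ⟨MulAction.stabilizer G t⟩) ⧸ orbitRel M S

open Classical in
/-- The class `[x ⊗ t] ∈ M(S)` of `t ∈ S` and `x ∈ M(G ⧸ G_t)`. -/
def gen (M : OrbitCat G ⥤ ModuleCat.{w} R) {S : Type u} [MulAction G S] (t : S)
    (x : M.obj ⟨MulAction.stabilizer G t⟩) : GSetModule M S :=
  (orbitRel M S).mkQ (DirectSum.lof R S (fun t => M.obj ⟨MulAction.stabilizer G t⟩) t x)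

variable [TopologicalSpace G] [IsTopologicalGroup G]

theorem continuous_orbitMap {H K : Subgroup G} (f : (G ⧸ H) →[G] (G ⧸ K)) : Continuous f := by
  refine (QuotientGroup.isQuotientMap_mk (N := H)).continuous_iff.mpr ?_
  have h : (f ∘ fun a : G => (a : G ⧸ H)) = fun a : G => a • f ((1 : G) : G ⧸ H) := by
    funext a
    rw [← map_smul]
    exact congrArg f (congrArg (fun z : G => (z : G ⧸ H)) (mul_one a).symm)
  change Continuous (f ∘ fun a : G => (a : G ⧸ H))
  rw [h]
  fun_prop

/-- The canonical orbits as `G`-spaces. -/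
def orbitSpace (G : Type u) [Group G] [TopologicalSpace G] [IsTopologicalGroup G] :
    OrbitCat G ⥤ GPair G where
  obj H := GPair.abs G (G ⧸ H.subgroup)
  map {H K} f :=
    { toFun := MulActionHom.toFun (X := G ⧸ H.subgroup) (Y := G ⧸ K.subgroup) f
      continuous_toFun := continuous_orbitMap (H := H.subgroup) (K := K.subgroup) f
      map_smul := MulActionHom.map_smul' (X := G ⧸ H.subgroup) (Y := G ⧸ K.subgroup) f
      map_mem := fun x hx => (GPair.not_mem_abs x hx).elim }

/-- The coefficient system `G ⧸ H ↦ 𝔥_q(G ⧸ H)` of a homology theory. -/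
abbrev HomologyTheory.coeff (h : HomologyTheory.{u, v, w} G R) (q : ℤ) :
    OrbitCat G ⥤ ModuleCat.{w} R :=
  orbitSpace G ⋙ h.H q

end Orbits

/-! ### Equivariant simplices -/

section Simplices

variable {V : Type u}

/-- The closed simplex `s = |s|`, the convex hull of the finite set `s` of basis vectors, in
barycentric coordinates. -/
def closedSimplex (s : Finset V) : Set (V → ℝ) :=
  {x | (∀ v, 0 ≤ x v) ∧ (∀ v, v ∉ s → x v = 0) ∧ ∑ v ∈ s, x v = 1}

/-- The boundary `∂s`: the union of the proper faces. -/
def simplexBd (s : Finset V) : Set (V → ℝ) :=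
  {x | x ∈ closedSimplex s ∧ ∃ v ∈ s, x v = 0}

/-- The union of the faces of codimension one other than the face opposite to `a`. -/
def simplexHat (s : Finset V) (a : V) : Set (V → ℝ) :=
  {x | x ∈ closedSimplex s ∧ ∃ v ∈ s, v ≠ a ∧ x v = 0}

theorem closedSimplex_mono {s t : Finset V} (hst : s ⊆ t) :
    closedSimplex s ⊆ closedSimplex t := by
  rintro x ⟨h0, h1, h2⟩
  refine ⟨h0, fun v hv => h1 v fun h => hv (hst h), ?_⟩
  rw [← h2]
  exact (Finset.sum_subset hst fun v _ hv => h1 v hv).symm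

/-- The vertex set of an ordered simplex. -/
abbrev verts {n : ℕ} (v : Fin n ↪ V) : Finset V := Finset.univ.map v

/-- The `k`-th face of an ordered simplex: the vertex with number `k` is omitted, and the other
vertices keep their order. -/
def face {n : ℕ} (v : Fin (n + 1) ↪ V) (k : Fin (n + 1)) : Fin n ↪ V :=
  k.succAboveEmb.trans v

theorem verts_face_subset {n : ℕ} (v : Fin (n + 1) ↪ V) (k : Fin (n + 1)) :
    verts (face v k) ⊆ verts v := by
  intro a ha
  simp only [verts, Finset.mem_map, Finset.mem_univ, true_and] at ha ⊢
  obtain ⟨i, rfl⟩ := ha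
  exact ⟨_, rfl⟩

theorem not_mem_verts_face {n : ℕ} (v : Fin (n + 1) ↪ V) (k : Fin (n + 1)) :
    v k ∉ verts (face v k) := by
  simp only [verts, Finset.mem_map, Finset.mem_univ, true_and, not_exists]
  intro i hi
  exact Fin.succAbove_ne k i (v.injective hi)

theorem closedSimplex_face_subset {n : ℕ} (v : Fin (n + 1) ↪ V) (k : Fin (n + 1)) :
    closedSimplex (verts (face v k)) ⊆ simplexBd (verts v) := fun _ hx =>
  ⟨closedSimplex_mono (verts_face_subset v k) hx, v k,
    Finset.mem_map_of_mem v (Finset.mem_univ k), hx.2.1 _ (not_mem_verts_face v k)⟩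

theorem simplexBd_face_subset {n : ℕ} (v : Fin (n + 1) ↪ V) (k : Fin (n + 1)) :
    simplexBd (verts (face v k)) ⊆ simplexHat (verts v) (v k) := by
  rintro x ⟨hx, a, ha, hxa⟩
  refine ⟨closedSimplex_mono (verts_face_subset v k) hx, a, verts_face_subset v k ha, ?_, hxa⟩
  rintro rfl
  exact not_mem_verts_face v k ha

variable {G : Type u} [Group G]

/-- The `G`-space `(G ⧸ H) × (V → ℝ)`, with the action on the first factor only; it contains the
equivariant simplices `G ⧸ H × s` as subspaces. -/
def CellSpace (H : Subgroup G) (V : Type u) : Type u := (G ⧸ H) × (V → ℝ)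

instance (H : Subgroup G) : MulAction G (CellSpace H V) where
  smul g y := (g • y.1, y.2)
  one_smul y := Prod.ext (one_smul G y.1) rfl
  mul_smul a b y := Prod.ext (mul_smul a b y.1) rfl

/-- The invariant subspace `G ⧸ H × B`. -/
def cellSub (H : Subgroup G) (B : Set (V → ℝ)) : SubMulAction G (CellSpace H V) where
  carrier := {y | y.2 ∈ B}
  smul_mem' _ _ hy := hy

theorem cellSub_mono (H : Subgroup G) {B C : Set (V → ℝ)} (hBC : B ⊆ C) :
    cellSub H B ≤ cellSub H C := fun _ hy => hBC hy

variable [TopologicalSpace G]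

instance (H : Subgroup G) : TopologicalSpace (CellSpace H V) :=
  inferInstanceAs (TopologicalSpace ((G ⧸ H) × (V → ℝ)))

variable [IsTopologicalGroup G]

instance (H : Subgroup G) : ContinuousSMul G (CellSpace H V) where
  continuous_smul := by
    have h : Continuous fun z : G × ((G ⧸ H) × (V → ℝ)) => (z.1 • z.2.1, z.2.2) := by fun_prop
    exact h

/-- The `G`-pair `(G ⧸ H × B, G ⧸ H × A)` for `A ⊆ B ⊆ ℝ^V`. -/
abbrev cellPair (H : Subgroup G) (B A : Set (V → ℝ)) : GPair G :=
  GPair.of (cellSub H B) (cellSub H A)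

/-- The equivariant simplex `(G ⧸ H × s, G ⧸ H × ∂s)`. -/
abbrev simplexPair (H : Subgroup G) {n : ℕ} (v : Fin n ↪ V) : GPair G :=
  cellPair H (closedSimplex (verts v)) (simplexBd (verts v))

/-- The projection `G ⧸ H × s → G ⧸ H` for a simplex of dimension zero. -/
def cellProj (H : Subgroup G) (v : Fin 1 ↪ V) : simplexPair H v ⟶ (orbitSpace G).obj ⟨H⟩ where
  toFun y := Prod.fst (α := G ⧸ H) (β := V → ℝ) y.1
  continuous_toFun := by
    have h : Continuous fun y : (G ⧸ H) × (V → ℝ) => y.1 := continuous_fst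
    exact h.comp continuous_subtype_val
  map_smul _ _ := rfl
  map_mem y hy := by
    obtain ⟨⟨_, _, hsum⟩, a, ha, hya⟩ :
      y.1.2 ∈ simplexBd (verts v) := hy
    exfalso
    simp only [verts, Finset.mem_map, Finset.mem_univ, true_and] at ha
    obtain ⟨i, rfl⟩ := ha
    rw [Subsingleton.elim i 0] at hya
    simp [verts] at hsum
    rw [hya] at hsum
    exact zero_ne_one hsum

/-- The inclusion `(G ⧸ H × s_k, G ⧸ H × ∂s_k) → (G ⧸ H × ∂s, G ⧸ H × ŝ_k)`. -/
def faceIncl (H : Subgroup G) {n : ℕ} (v : Fin (n + 1) ↪ V) (k : Fin (n + 1)) :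
    simplexPair H (face v k) ⟶
      cellPair H (simplexBd (verts v)) (simplexHat (verts v) (v k)) :=
  GPair.incl (cellSub_mono H (closedSimplex_face_subset v k))
    (cellSub_mono H (simplexBd_face_subset v k))

variable {R : Type v} [Ring R]

namespace HomologyTheory

variable (h : HomologyTheory.{u, v, w} G R)

/-- The incidence map `[s : s_k]`, the composition
`𝔥ₙ(G ⧸ H × s, G ⧸ H × ∂s) → 𝔥ₙ₋₁(G ⧸ H × ∂s, G ⧸ H × ŝ_k) ← 𝔥ₙ₋₁(G ⧸ H × s_k, G ⧸ H × ∂s_k)`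
of the boundary map of the triple and the inverse of the map induced by the inclusion. -/
def incidence (H : Subgroup G) {p : ℕ} (v : Fin (p + 1) ↪ V) (k : Fin (p + 1)) (n m : ℤ)
    (hnm : m + 1 = n) :
    (h.H n).obj (simplexPair H v) →ₗ[R] (h.H m).obj (simplexPair H (face v k)) :=
  linInv ((h.H m).map (faceIncl H v k)).hom ∘ₗ
    h.tripleBd (cellSub H (closedSimplex (verts v))) (cellSub H (simplexBd (verts v)))
      (cellSub H (simplexHat (verts v) (v k))) n m hnm

/-- The map `ζ(H, s) : 𝔥ₙ(G ⧸ H × s, G ⧸ H × ∂s) → 𝔥ₙ₋ₚ(G ⧸ H)` of an ordered `p`-simplex `s`: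
induced by the projection if `p = 0`, and `(-1)^p ζ(H, s_p) ∘ [s : s_p]` if `p > 0`. -/
def zeta (H : Subgroup G) : ∀ {p : ℕ} (v : Fin (p + 1) ↪ V) (n m : ℤ), m + p = n →
    ((h.H n).obj (simplexPair H v) →ₗ[R] (h.coeff m).obj ⟨H⟩)
  | 0, v, n, m, hnm =>
      ((h.H m).map (cellProj H v)).hom ∘ₗ
        (eqToHom (by rw [← hnm]; simp) : (h.H n).obj (simplexPair H v) ⟶
          (h.H m).obj (simplexPair H v)).hom
  | p + 1, v, n, m, hnm =>
      (-1 : ℤ) ^ (p + 1) •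
        (zeta H (face v (Fin.last (p + 1))) (m + p) m rfl ∘ₗ
          h.incidence H v (Fin.last (p + 1)) n (m + p) (by rw [← hnm]; push_cast; ring))

end HomologyTheory

end Simplices

/-! ### Simplicial `G`-complexes -/

section Complexes

/-- An abstract simplicial `G`-complex on the `G`-set `V` of vertices. -/
structure GComplex (G V : Type u) [Group G] [MulAction G V] [DecidableEq V] extends
    AbstractSimplicialComplex V where
  smul_mem_faces : ∀ (g : G), ∀ s ∈ faces, g • s ∈ faces
  smul_vertex : ∀ s ∈ faces, ∀ g : G, g • s = s → ∀ x ∈ s, g • x = x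

namespace GComplex

variable {G V : Type u} [Group G] [MulAction G V] [DecidableEq V]

/-- A `G`-subcomplex; it is an abstract simplicial `G`-complex on the `G`-set of its own
vertices. -/
structure Sub (K : GComplex G V) extends PreAbstractSimplicialComplex V where
  faces_subset : faces ⊆ K.faces
  smul_mem_faces : ∀ (g : G), ∀ s ∈ faces, g • s ∈ faces

variable (K : GComplex G V)

theorem closedSimplex_smul {s : Finset V} {x : V → ℝ} (hx : x ∈ closedSimplex s) (g : G) :
    (fun v => x (g⁻¹ • v)) ∈ closedSimplex (g • s) := by
  obtain ⟨h0, h1, h2⟩ := hx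
  refine ⟨fun v => h0 _, fun v hv => h1 _ fun h => hv ?_, ?_⟩
  · exact Finset.mem_smul_finset.mpr ⟨_, h, smul_inv_smul g v⟩
  · rw [← h2]
    change ∑ v ∈ s.image (fun v => g • v), x (g⁻¹ • v) = _
    rw [Finset.sum_image fun a _ b _ hab => MulAction.injective g hab]
    simp

/-- The realization, as a set: the union of the closed simplices. -/
def Realization : Type u := {x : V → ℝ // ∃ s ∈ K.faces, x ∈ closedSimplex s}

/-- The linear extension of the action on the vertices. -/
instance : MulAction G K.Realization where
  smul g x := ⟨fun v => x.1 (g⁻¹ • v), by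
    obtain ⟨s, hs, hx⟩ := x.2
    exact ⟨g • s, K.smul_mem_faces g s hs, closedSimplex_smul hx g⟩⟩
  one_smul x := Subtype.ext (funext fun v => by
    change x.1 ((1 : G)⁻¹ • v) = x.1 v
    simp)
  mul_smul a b x := Subtype.ext (funext fun v => by
    change x.1 ((a * b)⁻¹ • v) = x.1 (b⁻¹ • a⁻¹ • v)
    rw [mul_inv_rev, mul_smul])

variable {K}

/-- A subgroup stabilizing a simplex fixes its points. -/
theorem apply_inv_smul {s : Finset V} (hs : s ∈ K.faces) {g : G} (hg : g • s = s) {x : V → ℝ}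
    (hx : x ∈ closedSimplex s) (v : V) : x (g⁻¹ • v) = x v := by
  by_cases hv : v ∈ s
  · have h1 : g⁻¹ • v = v := by
      rw [inv_smul_eq_iff]
      exact (K.smul_vertex s hs g hg v hv).symm
    rw [h1]
  · have h1 : g⁻¹ • v ∉ s := by
      intro h
      apply hv
      rw [← hg]
      exact Finset.mem_smul_finset.mpr ⟨_, h, smul_inv_smul g v⟩
    rw [hx.2.1 _ h1, hx.2.1 _ hv]

/-- The characteristic map `χ_s : G ⧸ H × s → X`, `(aH, x) ↦ ax`, of a simplex `s`. Here `H` is any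
subgroup of the stabilizer `G_s`; the case of interest is `H = G_s`. -/
def chi {s : Finset V} (hs : s ∈ K.faces) (H : Subgroup G) (hH : H ≤ MulAction.stabilizer G s)
    (y : (G ⧸ H) × closedSimplex s) : K.Realization :=
  ⟨Quotient.lift (fun (a : G) (v : V) => y.2.1 (a⁻¹ • v)) (by
      intro a b hab
      have hab' : a⁻¹ * b ∈ H := QuotientGroup.leftRel_apply.mp hab
      funext v
      have h1 := apply_inv_smul hs (MulAction.mem_stabilizer_iff.mp (hH hab')) y.2.2 (a⁻¹ • v)
      rw [← h1, smul_smul]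
      simp [mul_assoc]) y.1, by
    obtain ⟨y, x, hx⟩ := y
    induction y using Quotient.inductionOn with
    | h a => exact ⟨a • s, K.smul_mem_faces a s hs, closedSimplex_smul hx a⟩⟩

@[simp]
theorem chi_mk_val {s : Finset V} (hs : s ∈ K.faces) (H : Subgroup G)
    (hH : H ≤ MulAction.stabilizer G s) (a : G) (x : closedSimplex s) (v : V) :
    (chi hs H hH ((a : G ⧸ H), x)).1 v = x.1 (a⁻¹ • v) := rfl

theorem chi_smul {s : Finset V} (hs : s ∈ K.faces) (H : Subgroup G)
    (hH : H ≤ MulAction.stabilizer G s) (g : G) (y : (G ⧸ H) × closedSimplex s) :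
    chi hs H hH (g • y.1, y.2) = g • chi hs H hH y := by
  obtain ⟨y, x⟩ := y
  induction y using Quotient.inductionOn with
  | h a =>
    refine Subtype.ext (funext fun v => ?_)
    change x.1 ((g * a)⁻¹ • v) = x.1 (a⁻¹ • g⁻¹ • v)
    rw [mul_inv_rev, mul_smul]

/-- Every point of the realization lies in the image of some characteristic map. -/
theorem exists_chi_eq (z : K.Realization) : ∃ (s : Finset V) (hs : s ∈ K.faces)
    (y : (G ⧸ MulAction.stabilizer G s) × closedSimplex s), chi hs _ le_rfl y = z := by
  obtain ⟨z, s, hs, hz⟩ := z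
  refine ⟨s, hs, (((1 : G) : G ⧸ MulAction.stabilizer G s), ⟨z, hz⟩), ?_⟩
  refine Subtype.ext (funext fun v => ?_)
  rw [chi_mk_val, inv_one, one_smul]

/-- The points `(aG_s, x)` of `G ⧸ G_s × s` and `(bG_t, y)` of `G ⧸ G_t × t` have the same image in
the realization if and only if there are `g ∈ G` and a simplex `r` with `x ∈ r ⊆ s`,
`y = gx ∈ gr ⊆ t` and `a⁻¹bg ∈ G_r`; so the realization is the quotient of the disjoint union of
the equivariant simplices `G ⧸ G_s × s` by this relation. -/
theorem chi_eq_chi_iff {s t : Finset V} (hs : s ∈ K.faces) (ht : t ∈ K.faces) (a b : G)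
    (x : closedSimplex s) (y : closedSimplex t) :
    chi hs _ le_rfl ((a : G ⧸ MulAction.stabilizer G s), x) =
        chi ht _ le_rfl ((b : G ⧸ MulAction.stabilizer G t), y) ↔
      ∃ (g : G) (r : Finset V), r ∈ K.faces ∧ x.1 ∈ closedSimplex r ∧ r ⊆ s ∧
        y.1 ∈ closedSimplex (g • r) ∧ g • r ⊆ t ∧ (∀ v, y.1 v = x.1 (g⁻¹ • v)) ∧
        a⁻¹ * b * g ∈ MulAction.stabilizer G r := by
  constructor
  · intro h
    have h1 : ∀ v, x.1 (a⁻¹ • v) = y.1 (b⁻¹ • v) := fun v =>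
      congrFun (congrArg Subtype.val h) v
    have h2 : ∀ v, y.1 v = x.1 ((b⁻¹ * a)⁻¹ • v) := fun v => by
      have := h1 (b • v)
      rw [inv_smul_smul] at this
      rw [← this, mul_inv_rev, inv_inv, mul_smul]
    let r : Finset V := s.filter fun v => x.1 v ≠ 0
    have hrs : r ⊆ s := Finset.filter_subset _ _
    have hxr : x.1 ∈ closedSimplex r := by
      refine ⟨x.2.1, fun v hv => ?_, ?_⟩
      · by_contra hne
        by_cases hvs : v ∈ s
        · exact hv (Finset.mem_filter.mpr ⟨hvs, hne⟩)
        · exact hne (x.2.2.1 v hvs)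
      · rw [← x.2.2.2]
        exact Finset.sum_filter_ne_zero s
    have hrne : r.Nonempty := by
      rw [Finset.nonempty_iff_ne_empty]
      intro h0
      have := hxr.2.2
      rw [h0] at this
      simp at this
    have hyr : y.1 ∈ closedSimplex ((b⁻¹ * a) • r) := by
      have := closedSimplex_smul hxr (b⁻¹ * a)
      rwa [← funext h2] at this
    refine ⟨b⁻¹ * a, r, (K.isRelLowerSet_faces hs).2 hrs hrne, hxr, hrs, hyr, ?_, h2, ?_⟩
    · intro v hv
      obtain ⟨u, hu, rfl⟩ := Finset.mem_smul_finset.mp hv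
      by_contra hvt
      have h3 := y.2.2.1 _ hvt
      rw [h2, inv_smul_smul] at h3
      exact (Finset.mem_filter.mp hu).2 h3
    · simp [mul_assoc]
  · rintro ⟨g, r, hr, hxr, -, -, -, hy, hg⟩
    refine Subtype.ext (funext fun v => ?_)
    rw [chi_mk_val, chi_mk_val, hy]
    have h1 := apply_inv_smul hr (MulAction.mem_stabilizer_iff.mp hg) hxr (a⁻¹ • v)
    rw [← h1]
    simp [smul_smul, mul_assoc]

/-- For `n = p + 1` this is the subspace `X_p = X^p ∪ A`: the union of `A` and of all simplices
with at most `n` vertices, that is of dimension at most `p`. In particular it is `A` for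
`n = 0`. -/
def filt (A : K.Sub) (n : ℕ) : SubMulAction G K.Realization where
  carrier := {x | ∃ s ∈ K.faces, (s ∈ A.faces ∨ s.card ≤ n) ∧ x.1 ∈ closedSimplex s}
  smul_mem' := by
    rintro g x ⟨s, hs, h, hx⟩
    refine ⟨g • s, K.smul_mem_faces g s hs, ?_, closedSimplex_smul hx g⟩
    rcases h with h | h
    · exact Or.inl (A.smul_mem_faces g s h)
    · exact Or.inr (by rwa [Finset.card_smul_finset])

/-- The `G`-set `C_p(X, A)` of the `p`-simplices of `X` that are not in `A`. -/
@[ext]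
structure Cells (A : K.Sub) (p : ℕ) where
  vertices : Finset V
  mem_faces : vertices ∈ K.faces
  not_mem_faces : vertices ∉ A.faces
  card_eq : vertices.card = p + 1

instance (A : K.Sub) (p : ℕ) : MulAction G (Cells A p) where
  smul g s := ⟨g • s.1, K.smul_mem_faces g _ s.2, fun h => s.3 (by
      have := A.smul_mem_faces g⁻¹ _ h
      rwa [inv_smul_smul] at this), by rw [Finset.card_smul_finset]; exact s.4⟩
  one_smul s := Cells.ext (one_smul G s.1)
  mul_smul a b s := Cells.ext (mul_smul a b s.1)

theorem stabilizer_le {A : K.Sub} {p : ℕ} (s : Cells A p) :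
    MulAction.stabilizer G s ≤ MulAction.stabilizer G s.1 := fun _ hg =>
  congrArg Cells.vertices hg

/-- The orderings of the vertices of a `p`-simplex. -/
abbrev VertexOrder {A : K.Sub} {p : ℕ} (s : Cells A p) : Type u :=
  {v : Fin (p + 1) ↪ V // verts v = s.1}

theorem verts_mem_faces {A : K.Sub} {p : ℕ} {s : Cells A p} (v : VertexOrder s) :
    verts v.1 ∈ K.faces := by
  rw [v.2]
  exact s.mem_faces

theorem stabilizer_le_verts {A : K.Sub} {p : ℕ} {s : Cells A p} (v : VertexOrder s) :
    MulAction.stabilizer G s ≤ MulAction.stabilizer G (verts v.1) := by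
  rw [v.2]
  exact stabilizer_le s

/-- The `k`-th face of an ordered simplex, as a simplex of `X` (assuming that it is not in
`A`). -/
def faceSimplex {A : K.Sub} {p : ℕ} {s : Cells A (p + 1)} (v : VertexOrder s) (k : Fin (p + 2))
    (hk : verts (face v.1 k) ∉ A.faces) : Cells A p :=
  ⟨verts (face v.1 k), (K.isRelLowerSet_faces s.2).2
    ((verts_face_subset v.1 k).trans v.2.le) (by simp [verts]), hk, by simp [verts]⟩

theorem stabilizer_le_face {A : K.Sub} {p : ℕ} {s : Cells A (p + 1)} (v : VertexOrder s)
    (k : Fin (p + 2)) (hk : verts (face v.1 k) ∉ A.faces) (g : G) :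
    MulAction.stabilizer G (g • s) ≤ MulAction.stabilizer G (g • faceSimplex v k hk) := by
  have h0 : MulAction.stabilizer G s ≤ MulAction.stabilizer G (faceSimplex v k hk) := by
    intro a ha
    refine Cells.ext ?_
    change a • verts (face v.1 k) = verts (face v.1 k)
    have h1 : ∀ x ∈ verts (face v.1 k), a • x = x := fun x hx =>
      K.smul_vertex s.1 s.2 a (congrArg Cells.vertices ha) x
        (v.2.le (verts_face_subset v.1 k hx))
    change (verts (face v.1 k)).image (fun x => a • x) = _
    rw [Finset.image_congr (g := id) fun x hx => h1 x hx, Finset.image_id]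
  rw [MulAction.stabilizer_smul_eq_stabilizer_map_conj,
    MulAction.stabilizer_smul_eq_stabilizer_map_conj]
  exact Subgroup.map_mono h0

/-- The ordered simplex with vertices `g v₀ < ⋯ < g vₚ`. -/
def smulOrder {n : ℕ} (g : G) (v : Fin n ↪ V) : Fin n ↪ V :=
  ⟨fun i => g • v i, fun _ _ hij => v.injective (MulAction.injective g hij)⟩

open Classical in
/-- The sign of the permutation of the vertices that relates two orderings of the same simplex. -/
def orderSign {n : ℕ} (v v' : Fin n ↪ V) : ℤˣ :=
  if hτ : ∃ τ : Equiv.Perm (Fin n), ∀ i, v i = v' (τ i) then Equiv.Perm.sign hτ.choose else 1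

/-- A family of preferred vertex orderings of the simplices in `C_p(X, A)`, `p ≥ 0`. -/
abbrev Orders (A : K.Sub) : Type u := ∀ (p : ℕ) (s : Cells A p), VertexOrder s

/-- `sign(g, s)`: the sign of the vertex permutation that puts the vertices of `gs`, in the order
induced by that of `s`, into preferred order. -/
def simplexSign {A : K.Sub} (ord : Orders A) {p : ℕ} (g : G) (s : Cells A p) : ℤˣ :=
  orderSign (smulOrder g (ord p s).1) (ord p (g • s)).1

/-- Collections `T p` of orbit representatives for the `G`-sets `C_p(X, A)`. -/
structure OrbitReps (A : K.Sub) where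
  T : ∀ p : ℕ, Set (Cells A p)
  exists_unique : ∀ (p : ℕ) (t : Cells A p), ∃! r, r ∈ T p ∧ t ∈ MulAction.orbit G r

/-- The representative of the orbit of `t`. -/
def OrbitReps.rep {A : K.Sub} (T : OrbitReps A) {p : ℕ} (t : Cells A p) : Cells A p :=
  (T.exists_unique p t).choose

theorem OrbitReps.exists_smul_rep {A : K.Sub} (T : OrbitReps A) {p : ℕ} (t : Cells A p) :
    ∃ g : G, g • T.rep t = t :=
  (T.exists_unique p t).choose_spec.1.2

/-- The vertex ordering of `t = gr` transported by `g` from the preferred ordering of the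
representative `r` of the orbit of `t`. (It does not depend on the choice of `g`, because `G_r`
fixes the vertices of `r`.) -/
def refOrder {A : K.Sub} (ord : Orders A) (T : OrbitReps A) {p : ℕ} (t : Cells A p) :
    Fin (p + 1) ↪ V :=
  smulOrder (T.exists_smul_rep t).choose (ord p (T.rep t)).1

open Classical in
/-- The class `[M(κ(G_{g s_k}, G_{gs}))(x) ⊗ g s_k]` for the `k`-th face `s_k` of an ordered simplex
`s`; it is `0` by convention if `s_k` is a simplex of `A`. -/
def faceGen {R : Type v} [Ring R] (M : OrbitCat G ⥤ ModuleCat.{w} R) {A : K.Sub} {p : ℕ}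
    {s : Cells A (p + 1)} (v : VertexOrder s) (k : Fin (p + 2)) (g : G)
    (x : M.obj ⟨MulAction.stabilizer G (g • s)⟩) : GSetModule M (Cells A p) :=
  if hk : verts (face v.1 k) ∈ A.faces then 0
  else gen M (g • faceSimplex v k hk) ((M.map (kappa (stabilizer_le_face v k hk g))).hom x)

open Classical in
/-- The sign `ε(s, k)` that compares the vertex ordering of the face `s_k` induced by the preferred
ordering of `s` with the ordering transported from the orbit representative of `s_k`; it is `1` by
convention if `s_k` is a simplex of `A`. -/
def faceSign {A : K.Sub} (ord : Orders A) (T : OrbitReps A) {p : ℕ} (s : Cells A (p + 1))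
    (k : Fin (p + 2)) : ℤˣ :=
  if hk : verts (face (ord (p + 1) s).1 k) ∈ A.faces then 1
  else orderSign (face (ord (p + 1) s).1 k) (refOrder ord T (faceSimplex (ord (p + 1) s) k hk))

variable [TopologicalSpace G]

variable (K) in
/-- The topology of the realization: coherent with respect to the images of the characteristic
maps `χ_s : G ⧸ G_s × s → X`, each of which has the quotient topology. -/
instance : TopologicalSpace K.Realization :=
  ⨆ s : {s : Finset V // s ∈ K.faces},
    TopologicalSpace.coinduced (chi s.2 (MulAction.stabilizer G s.1) le_rfl) inferInstance

theorem continuous_chi {s : Finset V} (hs : s ∈ K.faces) (H : Subgroup G)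
    (hH : H ≤ MulAction.stabilizer G s) : Continuous (chi hs H hH) := by
  have h1 : Continuous (chi hs (MulAction.stabilizer G s) le_rfl) :=
    continuous_iff_coinduced_le.mpr (le_iSup (fun s : {s : Finset V // s ∈ K.faces} =>
      TopologicalSpace.coinduced (chi s.2 (MulAction.stabilizer G s.1) le_rfl) inferInstance)
      ⟨s, hs⟩)
  let f : G ⧸ H → G ⧸ MulAction.stabilizer G s :=
    Quotient.map' id fun a b hab =>
      QuotientGroup.leftRel_apply.mpr (hH (QuotientGroup.leftRel_apply.mp hab))
  have hf : Continuous f := continuous_id.quotient_map' _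
  have h2 : chi hs H hH = chi hs (MulAction.stabilizer G s) le_rfl ∘
      fun y : (G ⧸ H) × closedSimplex s => (f y.1, y.2) := by
    funext y
    obtain ⟨y, x⟩ := y
    induction y using Quotient.inductionOn with
    | h a => rfl
  rw [h2]
  exact h1.comp (by fun_prop)

instance [IsTopologicalGroup G] [LocallyCompactSpace G] : ContinuousSMul G K.Realization where
  continuous_smul := by
    have horb : ∀ x : K.Realization, Continuous fun g : G => g • x := by
      intro x
      obtain ⟨s, hs, y, rfl⟩ := exists_chi_eq x
      have h1 : (fun g : G => g • chi hs (MulAction.stabilizer G s) le_rfl y) =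
          fun g : G => chi hs (MulAction.stabilizer G s) le_rfl (g • y.1, y.2) :=
        funext fun g => (chi_smul hs _ le_rfl g y).symm
      rw [h1]
      exact (continuous_chi hs _ le_rfl).comp (by fun_prop)
    let Φ : K.Realization → C(G, K.Realization) := fun x => ⟨fun g => g • x, horb x⟩
    have hΦ : Continuous Φ := by
      refine continuous_iSup_dom.mpr fun s => continuous_coinduced_dom.mpr ?_
      let F : C(((G ⧸ MulAction.stabilizer G s.1) × closedSimplex s.1) × G, K.Realization) :=
        ⟨fun z => chi s.2 (MulAction.stabilizer G s.1) le_rfl (z.2 • z.1.1, z.1.2),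
          (continuous_chi s.2 _ le_rfl).comp (by fun_prop)⟩
      have h1 : Φ ∘ chi s.2 (MulAction.stabilizer G s.1) le_rfl = F.curry := by
        funext y
        ext1 g
        exact (chi_smul s.2 _ le_rfl g y).symm
      rw [h1]
      exact F.curry.continuous
    have h2 := ContinuousMap.continuous_uncurry_of_continuous ⟨Φ, hΦ⟩
    exact h2.comp continuous_swap

variable [IsTopologicalGroup G] [LocallyCompactSpace G]

/-- The pair `(X_p, X_{p-1})`. -/
abbrev relPair (A : K.Sub) (p : ℕ) : GPair G := GPair.of (filt A (p + 1)) (filt A p)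

/-- The map `χ_s : (G ⧸ G_s × s, G ⧸ G_s × ∂s) → (X_p, X_{p-1})` of a `p`-simplex `s`. -/
def chiHom {A : K.Sub} {p : ℕ} (s : Cells A p) (v : VertexOrder s) :
    simplexPair (MulAction.stabilizer G s) v.1 ⟶ relPair A p where
  toFun y := (⟨chi (verts_mem_faces v) (MulAction.stabilizer G s) (stabilizer_le_verts v)
      (y.1.1, ⟨y.1.2, y.2⟩), by
    obtain ⟨⟨y, x⟩, hx⟩ := y
    induction y using Quotient.inductionOn with
    | h a =>
      refine ⟨a • verts v.1, K.smul_mem_faces a _ (verts_mem_faces v), Or.inr ?_,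
        closedSimplex_smul hx a⟩
      rw [Finset.card_smul_finset]
      simp [verts]⟩ : filt A (p + 1))
  continuous_toFun := by
    refine Continuous.subtype_mk ?_ _
    refine (continuous_chi _ _ _).comp ?_
    have h1 : Continuous fun y : cellSub (MulAction.stabilizer G s) (closedSimplex (verts v.1)) =>
        (y.1 : (G ⧸ MulAction.stabilizer G s) × (V → ℝ)) := continuous_subtype_val
    exact (continuous_fst.comp h1).prodMk (Continuous.subtype_mk (continuous_snd.comp h1) _)
  map_smul g y := Subtype.ext (chi_smul (verts_mem_faces v) _ (stabilizer_le_verts v) g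
    (y.1.1, ⟨y.1.2, y.2⟩))
  map_mem y hy := by
    obtain ⟨⟨y, x⟩, hx0⟩ := y
    obtain ⟨hx, b, hb, hxb⟩ : x ∈ simplexBd (verts v.1) := hy
    induction y using Quotient.inductionOn with
    | h a =>
      have hx' : x ∈ closedSimplex ((verts v.1).erase b) := by
        refine ⟨hx.1, fun u hu => ?_, ?_⟩
        · by_cases hub : u = b
          · rw [hub]; exact hxb
          · exact hx.2.1 u fun h => hu (Finset.mem_erase.mpr ⟨hub, h⟩)
        · rw [← hx.2.2]
          exact Finset.sum_erase _ hxb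
      have hne : ((verts v.1).erase b).Nonempty := by
        rw [Finset.nonempty_iff_ne_empty]
        intro h0
        have := hx'.2.2
        rw [h0] at this
        simp at this
      refine ⟨a • (verts v.1).erase b, K.smul_mem_faces a _
        ((K.isRelLowerSet_faces s.2).2 ?_ hne), Or.inr ?_, closedSimplex_smul hx' a⟩
      · exact (Finset.erase_subset _ _).trans v.2.le
      · rw [Finset.card_smul_finset, Finset.card_erase_of_mem hb]
        simp [verts]

end GComplex

end Complexes

end EquivHom

end

open EquivHom GComplex

/-! Everything is reduced to one equivariant simplex `G ⧸ H × s` at a time. Its part `ŝ_k` of the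
boundary consists of the faces that contain `v_k`, so contracting `s` to `v_k` shows that the
homology of `(s, ŝ_k)` vanishes (`subsingleton_simplexHat`); hence the boundary map of the triple
`(s, ∂s, ŝ_k)` is an isomorphism. The inclusion of `(s_k, ∂s_k)` in `(∂s, ŝ_k)` is an excision up to
homotopy (`face_excision`). So `[s : s_k]` is an isomorphism, and by induction on the dimension so
is `ζ`.

The signs rest on two facts: `ζ` is alternating in the order of the vertices (`zeta_perm`), and
`ζ(s_k) ∘ [s : s_k] = (-1)^k ζ(s)` for every `k` (`zeta_face`). The second follows from the first by
moving `v_k` to the last place. For the first, adjacent transpositions suffice. Those that fix the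
last vertex are covered by induction. The exchange of the last two vertices is the anticommutation
of iterated incidence maps (`incidence_incidence`), a consequence of `∂∂ = 0`; for an edge it says
that a boundary of the edge vanishes in the edge.

The homology of `(X_p, X_{p-1})` is the direct sum, over orbit representatives `r`, of the homology
of `(G ⧸ G_r × r, G ⧸ G_r × ∂r)`. Indeed, radial expansion from the barycenters gives `X_{p-1}` a
collar in `X_p`, and outside a smaller collar `X_p` is a disjoint union of copies of the truncated
simplices (`Collar.sum_bijective`, `sum_chiHom_bijective`).

The map `α` is defined on all simplices at once, each with the order transported from its orbit
representative. This order is equivariant, so `α` respects the relations of the coefficient module;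
comparison with the preferred order produces the signs. Since the summands of the representatives
generate that module, the decomposition above makes `α` bijective. Finally `∂_p` is the triple
boundary conjugated by `α`. Its formula follows from naturality, from the splitting of the boundary
of a simplex into its faces modulo codimension two (`tripleBd_simplexSk`), and from `zeta_face`. -/

noncomputable section

namespace EquivHom

/-! ### Formal consequences of the axioms -/

section HomologyGeneral

variable {G : Type u} [Group G] [TopologicalSpace G] {R : Type v} [Ring R]

namespace GPair

theorem hom_ext {P Q : GPair G} {f g : P ⟶ Q} (hfg : ∀ x, f.toFun x = g.toFun x) : f = g :=
  Hom.ext (funext hfg)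

/-- The isomorphism `(B, ∅) → (B, B ∩ ∅)`, where `B` is the space of the pair `(B, A)`. -/
def absToOf {Y : Type u} [TopologicalSpace Y] [MulAction G Y] [ContinuousSMul G Y]
    (B A : SubMulAction G Y) : abs G (of B A).X ⟶ of B ⊥ where
  toFun := id
  continuous_toFun := continuous_id
  map_smul _ _ := rfl
  map_mem x hx := (not_mem_abs x hx).elim

/-- The pair `(X, A')` obtained from `(X, A)` by changing the subspace. -/
def withSub (P : GPair G) (A' : SubMulAction G P.X) : GPair G where
  X := P.X
  A := A'

/-- The inclusion `(X, A) → (X, A')` for `A ⊆ A'`. -/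
def toWithSub (P : GPair G) (A' : SubMulAction G P.X) (hA : P.A ≤ A') : P ⟶ P.withSub A' where
  toFun := id
  continuous_toFun := continuous_id
  map_smul _ _ := rfl
  map_mem _ hx := hA hx

end GPair

namespace HomologyTheory

variable (h : HomologyTheory.{u, v, w} G R)

/-- The linear map induced by a map of pairs. -/
abbrev ml (n : ℤ) {P Q : GPair G} (f : P ⟶ Q) : (h.H n).obj P →ₗ[R] (h.H n).obj Q :=
  ((h.H n).map f).hom

theorem ml_comp (n : ℤ) {P Q S : GPair G} (f : P ⟶ Q) (g : Q ⟶ S) (x : (h.H n).obj P) :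
    h.ml n (f ≫ g) x = h.ml n g (h.ml n f x) := by
  simp [ml]

theorem ml_id (n : ℤ) {P : GPair G} (x : (h.H n).obj P) : h.ml n (𝟙 P) x = x := by
  simp [ml]

theorem ml_bijective_of_inverse (n : ℤ) {P Q : GPair G} {f : P ⟶ Q} {g : Q ⟶ P}
    (hfg : h.ml n (f ≫ g) = h.ml n (𝟙 P)) (hgf : h.ml n (g ≫ f) = h.ml n (𝟙 Q)) :
    Function.Bijective (h.ml n f) := by
  refine Function.bijective_iff_has_inverse.mpr ⟨h.ml n g, fun x => ?_, fun x => ?_⟩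
  · rw [← ml_comp, hfg, ml_id]
  · rw [← ml_comp, hgf, ml_id]

/-- The inverse homeomorphism is automatically equivariant, and `hA` makes it a map of pairs. -/
theorem ml_bijective_of_isHomeomorph (n : ℤ) {P Q : GPair G} (f : P ⟶ Q)
    (hf : IsHomeomorph f.toFun) (hA : ∀ x, f.toFun x ∈ Q.A → x ∈ P.A) :
    Function.Bijective (h.ml n f) := by
  let e := hf.homeomorph
  have he : ∀ x, f.toFun (e.symm x) = x := fun x => e.apply_symm_apply x
  have he' : ∀ x, e.symm (f.toFun x) = x := fun x => e.symm_apply_apply x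
  let g : Q ⟶ P :=
    { toFun := e.symm
      continuous_toFun := e.symm.continuous
      map_smul := fun a x => hf.injective (by rw [f.map_smul, he, he])
      map_mem := fun x hx => hA _ (by rwa [he]) }
  refine h.ml_bijective_of_inverse n (g := g) ?_ ?_
  · exact congrArg _ (GPair.hom_ext he')
  · exact congrArg _ (GPair.hom_ext he)

/-- If `A = X`, then `𝔥(A) → 𝔥(X)` is bijective, so in the exact sequence both the map to `𝔥(X, A)`
and the boundary map out of it are zero. -/
theorem subsingleton_of_forall_mem (n : ℤ) {P : GPair G} (hP : ∀ x, x ∈ P.A) :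
    Subsingleton ((h.H n).obj P) := by
  have hb : ∀ k, Function.Bijective (h.ml k P.subIncl) := fun k => by
    refine h.ml_bijective_of_isHomeomorph k _ ?_ fun x hx => (GPair.not_mem_abs _ hx).elim
    exact (Homeomorph.Set.univ P.X).isHomeomorph.comp
      (Homeomorph.setCongr (s := (P.A : Set P.X)) (Set.eq_univ_of_forall hP)).isHomeomorph
  have h1 : ∀ x, h.ml n P.toPair x = 0 := fun x => by
    obtain ⟨y, rfl⟩ := (hb n).2 x
    exact (h.exact_space n P _).mpr ⟨y, rfl⟩
  have h2 : ∀ z : (h.H n).obj P, z = 0 := fun z => by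
    have h3 : ((h.bd n (n - 1) (by ring)).app P).hom z = 0 := by
      apply (hb (n - 1)).1
      rw [map_zero]
      exact (h.exact_sub n (n - 1) (by ring) P _).mpr ⟨z, rfl⟩
    obtain ⟨y, rfl⟩ := (h.exact_pair n (n - 1) (by ring) P z).mp h3
    exact h1 y
  exact ⟨fun a b => by rw [h2 a, h2 b]⟩

/-- Such a map factors through the pair `(X, X)`, which has no homology. -/
theorem ml_eq_zero (n : ℤ) {P Q : GPair G} (f : P ⟶ Q) (hf : ∀ x, f.toFun x ∈ Q.A)
    (x : (h.H n).obj P) : h.ml n f x = 0 := by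
  let f' : P.withSub ⊤ ⟶ Q :=
    { toFun := f.toFun
      continuous_toFun := f.continuous_toFun
      map_smul := f.map_smul
      map_mem := fun x _ => hf x }
  have h1 : f = P.toWithSub ⊤ le_top ≫ f' := rfl
  have := h.subsingleton_of_forall_mem n (P := P.withSub ⊤) fun x => trivial
  rw [h1, ml_comp, Subsingleton.elim (h.ml n (P.toWithSub ⊤ le_top) x) 0, map_zero]

/-- A map of pairs that is an embedding whose image has an excisable complement induces
isomorphisms. -/
theorem ml_bijective_of_isEmbedding (n : ℤ) {P Q : GPair G} (f : P ⟶ Q)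
    (hf : Topology.IsEmbedding f.toFun) (hA : ∀ x, f.toFun x ∈ Q.A → x ∈ P.A)
    (hU : closure (Set.range f.toFun)ᶜ ⊆ interior (Q.A : Set Q.X)) :
    Function.Bijective (h.ml n f) := by
  let U : SubMulAction G Q.X :=
    { carrier := (Set.range f.toFun)ᶜ
      smul_mem' := by
        rintro g x hx ⟨y, hy⟩
        exact hx ⟨g⁻¹ • y, by rw [f.map_smul, hy, inv_smul_smul]⟩ }
  let f' : P ⟶ GPair.of Uᶜ Q.A :=
    { toFun := fun x => (⟨f.toFun x, fun hx => hx ⟨x, rfl⟩⟩ : (Uᶜ : SubMulAction G Q.X))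
      continuous_toFun := Continuous.subtype_mk f.continuous_toFun _
      map_smul := fun g x => Subtype.ext (f.map_smul g x)
      map_mem := fun x hx => f.map_mem x hx }
  have h1 : f = f' ≫ Q.excisionIncl U := rfl
  have h2 : Function.Bijective (h.ml n f') := by
    refine h.ml_bijective_of_isHomeomorph n f' ?_ fun x hx => hA x hx
    rw [isHomeomorph_iff_isEmbedding_surjective]
    constructor
    · exact hf.codRestrict ((Uᶜ : SubMulAction G Q.X) : Set Q.X) fun x hx => hx ⟨x, rfl⟩
    · rintro ⟨y, hy⟩
      obtain ⟨x, rfl⟩ := not_not.mp hy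
      exact ⟨x, rfl⟩
  have h3 : Function.Bijective (h.ml n (Q.excisionIncl U)) := by
    have := h.excision Q U hU n
    exact ConcreteCategory.bijective_of_isIso ((h.H n).map (Q.excisionIncl U))
  have h4 : ⇑(h.ml n f) = h.ml n (Q.excisionIncl U) ∘ h.ml n f' := by
    funext x
    rw [h1, ml_comp]; rfl
  rw [h4]
  exact h3.comp h2

/-! ### The exact sequence of a triple of invariant subspaces -/

section Triples

variable {Y : Type u} [TopologicalSpace Y] [MulAction G Y] [ContinuousSMul G Y]

/-- Naturality of the boundary map of a triple. -/
theorem tripleBd_natural {Y' : Type u} [TopologicalSpace Y'] [MulAction G Y']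
    [ContinuousSMul G Y'] {B A C : SubMulAction G Y} {B' A' C' : SubMulAction G Y'}
    (f : GPair.of B A ⟶ GPair.of B' A') (f' : GPair.of A C ⟶ GPair.of A' C')
    (hf : ∀ (y : Y) (hB : y ∈ B) (hA : y ∈ A),
      (show A' from f'.toFun (⟨y, hA⟩ : A)).1 = (show B' from f.toFun (⟨y, hB⟩ : B)).1)
    (n m : ℤ) (hnm : m + 1 = n) (x : (h.H n).obj (GPair.of B A)) :
    h.tripleBd B' A' C' n m hnm (h.ml n f x) = h.ml m f' (h.tripleBd B A C n m hnm x) := by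
  have h1 : (GPair.subFunctor G).map f ≫ GPair.subToPair B' A' C' =
      GPair.subToPair B A C ≫ f' :=
    GPair.hom_ext fun x => Subtype.ext (hf x.1.1 x.1.2 x.2).symm
  have h2 : ((h.bd n m hnm).app (GPair.of B' A')).hom (h.ml n f x) =
      h.ml m ((GPair.subFunctor G).map f) (((h.bd n m hnm).app (GPair.of B A)).hom x) := by
    exact congrArg (fun φ => φ.hom x) ((h.bd n m hnm).naturality f)
  change h.ml m _ (((h.bd n m hnm).app (GPair.of B' A')).hom (h.ml n f x)) =
    h.ml m f' (h.ml m _ _)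
  rw [h2, ← ml_comp, ← ml_comp, h1]

/-- Identifies `A` as a subspace of the subtype `B` with `A` as a subspace of `Y`. This allows
absolute homology to be written throughout as that of a pair with subspace `⊥`. -/
theorem subToPair_bijective {B A : SubMulAction G Y} (hAB : A ≤ B) (n : ℤ) :
    Function.Bijective (h.ml n (GPair.subToPair B A ⊥)) := by
  let g : GPair.of A ⊥ ⟶ (GPair.subFunctor G).obj (GPair.of B A) :=
    { toFun := fun x => (⟨(⟨x.1, hAB x.2⟩ : B), x.2⟩ : (GPair.of B A).A)
      continuous_toFun := by
        have h0 : Continuous fun x : A => (⟨x.1, hAB x.2⟩ : B) :=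
          Continuous.subtype_mk continuous_subtype_val _
        exact Continuous.subtype_mk h0 _
      map_smul := fun _ _ => rfl
      map_mem := fun x hx => hx }
  exact h.ml_bijective_of_inverse n (g := g) rfl rfl

theorem absToOf_bijective (B A : SubMulAction G Y) (n : ℤ) :
    Function.Bijective (h.ml n (GPair.absToOf B A)) :=
  h.ml_bijective_of_isHomeomorph n _ (Homeomorph.refl _).isHomeomorph fun _ hx => hx

/-- Reduces every triple boundary to the case `C = ⊥`, which is the boundary map of a pair. -/
theorem tripleBd_eq (B A C : SubMulAction G Y) (n m : ℤ) (hnm : m + 1 = n)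
    (x : (h.H n).obj (GPair.of B A)) :
    h.tripleBd B A C n m hnm x =
      h.ml m (GPair.incl le_rfl bot_le) (h.tripleBd B A ⊥ n m hnm x) := by
  change h.ml m _ _ = h.ml m _ (h.ml m _ _)
  rw [← ml_comp]
  rfl

theorem exact_of_space {B A : SubMulAction G Y} (hAB : A ≤ B) (n : ℤ)
    (x : (h.H n).obj (GPair.of B ⊥))
    (hx : h.ml n (GPair.incl le_rfl bot_le : GPair.of B ⊥ ⟶ GPair.of B A) x = 0) :
    ∃ y : (h.H n).obj (GPair.of A ⊥), h.ml n (GPair.incl hAB le_rfl) y = x := by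
  obtain ⟨x, rfl⟩ := (h.absToOf_bijective B A n).2 x
  rw [← ml_comp] at hx
  obtain ⟨y, rfl⟩ := (h.exact_space n (GPair.of B A) x).mp hx
  refine ⟨h.ml n (GPair.subToPair B A ⊥) y, ?_⟩
  refine (h.ml_comp n _ _ y).symm.trans (Eq.trans ?_ (h.ml_comp n _ _ y))
  rfl

theorem exact_of_pair {B A : SubMulAction G Y} (hAB : A ≤ B) (n m : ℤ) (hnm : m + 1 = n)
    (x : (h.H n).obj (GPair.of B A)) (hx : h.tripleBd B A ⊥ n m hnm x = 0) :
    ∃ y : (h.H n).obj (GPair.of B ⊥), h.ml n (GPair.incl le_rfl bot_le) y = x := by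
  have h1 : ((h.bd n m hnm).app (GPair.of B A)).hom x = 0 :=
    (h.subToPair_bijective hAB m).1 (by rw [map_zero]; exact hx)
  obtain ⟨y, rfl⟩ := (h.exact_pair n m hnm _ x).mp h1
  refine ⟨h.ml n (GPair.absToOf B A) y, ?_⟩
  refine (h.ml_comp n _ _ y).symm.trans ?_
  rfl

theorem exact_of_sub {B A : SubMulAction G Y} (hAB : A ≤ B) (n m : ℤ) (hnm : m + 1 = n)
    (x : (h.H m).obj (GPair.of A ⊥)) :
    h.ml m (GPair.incl hAB le_rfl : GPair.of A ⊥ ⟶ GPair.of B ⊥) x = 0 ↔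
      ∃ y : (h.H n).obj (GPair.of B A), h.tripleBd B A ⊥ n m hnm y = x := by
  obtain ⟨x, rfl⟩ := (h.subToPair_bijective hAB m).2 x
  have h1 : h.ml m (GPair.incl hAB le_rfl : GPair.of A ⊥ ⟶ GPair.of B ⊥)
      (h.ml m (GPair.subToPair B A ⊥) x) =
      h.ml m (GPair.absToOf B A) (h.ml m (GPair.subIncl (GPair.of B A)) x) := by
    rw [← ml_comp, ← ml_comp]
    rfl
  have h2 : h.ml m (GPair.subIncl (GPair.of B A)) x = 0 ↔ _ := h.exact_sub n m hnm (GPair.of B A) x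
  rw [h1, map_eq_zero_iff _ (h.absToOf_bijective B A m).1, h2]
  constructor
  · rintro ⟨y, rfl⟩
    exact ⟨y, rfl⟩
  · rintro ⟨y, hy⟩
    exact ⟨y, (h.subToPair_bijective hAB m).1 hy⟩

theorem incl_incl {B A B' A' B'' A'' : SubMulAction G Y} (hB : B ≤ B') (hA : A ≤ A')
    (hB' : B' ≤ B'') (hA' : A' ≤ A'') (n : ℤ) (x : (h.H n).obj (GPair.of B A)) :
    h.ml n (GPair.incl hB' hA') (h.ml n (GPair.incl hB hA) x) =
      h.ml n (GPair.incl (hB.trans hB') (hA.trans hA')) x := by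
  rw [← ml_comp]
  rfl

theorem incl_self {B A : SubMulAction G Y} (hB : B ≤ B) (hA : A ≤ A) (n : ℤ)
    (x : (h.H n).obj (GPair.of B A)) : h.ml n (GPair.incl hB hA) x = x := by
  exact h.ml_id n x

theorem incl_eq_zero {B A B' A' : SubMulAction G Y} (hB : B ≤ B') (hA : A ≤ A') (hBA : B ≤ A')
    (n : ℤ) (x : (h.H n).obj (GPair.of B A)) : h.ml n (GPair.incl hB hA) x = 0 :=
  h.ml_eq_zero n _ (fun y : B => hBA y.2) x

theorem tripleBd_incl {B A C B' A' C' : SubMulAction G Y} (hB : B ≤ B') (hA : A ≤ A')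
    (hC : C ≤ C') (n m : ℤ) (hnm : m + 1 = n) (x : (h.H n).obj (GPair.of B A)) :
    h.tripleBd B' A' C' n m hnm (h.ml n (GPair.incl hB hA) x) =
      h.ml m (GPair.incl hA hC) (h.tripleBd B A C n m hnm x) :=
  h.tripleBd_natural (GPair.incl hB hA) (GPair.incl hA hC) (fun _ _ _ => rfl) n m hnm x

/-- Exactness of the sequence of a triple at `𝔥ₙ(B, C)`. -/
theorem exact_triple_mid {B A C : SubMulAction G Y} (hCA : C ≤ A) (hAB : A ≤ B) (n : ℤ)
    (x : (h.H n).obj (GPair.of B C))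
    (hx : h.ml n (GPair.incl le_rfl hCA : GPair.of B C ⟶ GPair.of B A) x = 0) :
    ∃ y : (h.H n).obj (GPair.of A C), h.ml n (GPair.incl hAB le_rfl) y = x := by
  have hn : n - 1 + 1 = n := by ring
  have h1 := h.tripleBd_incl (le_refl B) hCA (le_refl ⊥) n (n - 1) hn x
  rw [hx, map_zero] at h1
  -- The boundary of `x` in `𝔥(C)` dies in `𝔥(A)`, so a class `y` of `(A, C)` has the same boundary.
  -- Then `x - y` comes from an absolute class of `B`, and this class vanishes in `𝔥(B, A)`, hence
  -- comes from `A`.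
  obtain ⟨y, hy⟩ := (h.exact_of_sub hCA n (n - 1) hn _).mp h1.symm
  have h2 := h.tripleBd_incl hAB (le_refl C) (le_refl ⊥) n (n - 1) hn y
  rw [incl_self, hy] at h2
  obtain ⟨z, hz⟩ := h.exact_of_pair (hCA.trans hAB) n (n - 1) hn
    (x - h.ml n (GPair.incl hAB le_rfl) y) (by rw [map_sub, h2, sub_self])
  have h3 := congrArg (h.ml n (GPair.incl (le_refl B) hCA)) hz
  rw [map_sub, hx, incl_incl, incl_incl, h.incl_eq_zero _ _ le_rfl, sub_zero] at h3
  obtain ⟨t, rfl⟩ := h.exact_of_space hAB n z h3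
  refine ⟨y + h.ml n (GPair.incl le_rfl bot_le) t, ?_⟩
  rw [incl_incl] at hz
  rw [map_add, incl_incl, hz]
  abel

/-- Exactness of the sequence of a triple at `𝔥ₙ(B, A)`. -/
theorem exact_triple_pair {B A C : SubMulAction G Y} (hCA : C ≤ A) (hAB : A ≤ B) (n m : ℤ)
    (hnm : m + 1 = n) (x : (h.H n).obj (GPair.of B A)) (hx : h.tripleBd B A C n m hnm x = 0) :
    ∃ y : (h.H n).obj (GPair.of B C), h.ml n (GPair.incl le_rfl hCA) y = x := by
  rw [tripleBd_eq] at hx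
  obtain ⟨y, hy⟩ := h.exact_of_space hCA m _ hx
  have h1 := (h.exact_of_sub hAB n m hnm _).mpr ⟨x, rfl⟩
  rw [← hy, incl_incl] at h1
  -- The boundary of `x` comes from a class `y` of `C` that dies in `B`, so `y` is the boundary of
  -- some `z` in `𝔥(B, C)`; the difference of `x` and `z` has boundary zero and lifts to `𝔥(B)`.
  obtain ⟨z, hz⟩ := (h.exact_of_sub (hCA.trans hAB) n m hnm y).mp h1
  obtain ⟨t, ht⟩ := h.exact_of_pair hAB n m hnm (x - h.ml n (GPair.incl le_rfl hCA) z) (by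
    rw [map_sub, h.tripleBd_incl _ hCA (le_refl ⊥), hz, hy, sub_self])
  refine ⟨z + h.ml n (GPair.incl le_rfl bot_le) t, ?_⟩
  rw [map_add, incl_incl, ht]
  abel

/-- Exactness of the sequence of a triple at `𝔥ₙ₋₁(A, C)`. -/
theorem exact_triple_sub {B A C : SubMulAction G Y} (hCA : C ≤ A) (hAB : A ≤ B) (n m : ℤ)
    (hnm : m + 1 = n) (y : (h.H m).obj (GPair.of A C))
    (hy : h.ml m (GPair.incl hAB le_rfl : GPair.of A C ⟶ GPair.of B C) y = 0) :
    ∃ x : (h.H n).obj (GPair.of B A), h.tripleBd B A C n m hnm x = y := by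
  have hm : m - 1 + 1 = m := by ring
  have h1 := h.tripleBd_incl hAB (le_refl C) (le_refl ⊥) m (m - 1) hm y
  rw [hy, map_zero, incl_self] at h1
  -- The class `y` lifts to a class `z` of `A`. Its image in `B` comes from a class `t` of `C`, and
  -- `z - t` is then a boundary; subtracting `t` does not change the class in `𝔥(A, C)`.
  obtain ⟨z, rfl⟩ := h.exact_of_pair hCA m (m - 1) hm y h1.symm
  rw [incl_incl] at hy
  obtain ⟨t, ht⟩ := h.exact_of_space (hCA.trans hAB) m (h.ml m (GPair.incl hAB le_rfl) z) (by
    rw [incl_incl]; exact hy)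
  obtain ⟨x, hx⟩ := (h.exact_of_sub hAB n m hnm (z - h.ml m (GPair.incl hCA le_rfl) t)).mp (by
    rw [map_sub, incl_incl, ht, sub_self])
  refine ⟨x, ?_⟩
  rw [tripleBd_eq, hx, map_sub, incl_incl, h.incl_eq_zero _ _ le_rfl, sub_zero]

theorem incl_tripleBd {B A C : SubMulAction G Y} (hAB : A ≤ B) (n m : ℤ)
    (hnm : m + 1 = n) (x : (h.H n).obj (GPair.of B A)) :
    h.ml m (GPair.incl hAB le_rfl) (h.tripleBd B A C n m hnm x) = 0 := by
  rw [tripleBd_eq, incl_incl]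
  have h1 := (h.exact_of_sub hAB n m hnm _).mpr ⟨x, rfl⟩
  have h2 := congrArg (h.ml m (GPair.incl (le_refl B) (bot_le (a := C)))) h1
  rw [incl_incl, map_zero] at h2
  exact h2

/-- The first boundary comes from an absolute class of `A`, and the boundary of an absolute class
factors through the homology of the empty pair. -/
theorem tripleBd_tripleBd {B A C D : SubMulAction G Y} (n m l : ℤ)
    (hnm : m + 1 = n) (hml : l + 1 = m) (x : (h.H n).obj (GPair.of B A)) :
    h.tripleBd A C D m l hml (h.tripleBd B A C n m hnm x) = 0 := by
  rw [tripleBd_eq _ B, h.tripleBd_incl le_rfl bot_le (bot_le (a := D)) (C := ⊥)]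
  rw [tripleBd_eq _ A ⊥ ⊥]
  have := h.subsingleton_of_forall_mem l (P := GPair.of (⊥ : SubMulAction G Y) ⊥) fun x => x.2
  rw [Subsingleton.elim (h.tripleBd A ⊥ ⊥ m l hml _) 0, map_zero, map_zero]

/-- If `𝔥(B, C)` vanishes, then the boundary map of the triple `(B, A, C)` is bijective. -/
theorem tripleBd_bijective {B A C : SubMulAction G Y} (hCA : C ≤ A) (hAB : A ≤ B) (n m : ℤ)
    (hnm : m + 1 = n) (h0 : ∀ k, Subsingleton ((h.H k).obj (GPair.of B C))) :
    Function.Bijective (h.tripleBd B A C n m hnm) := by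
  constructor
  · refine (injective_iff_map_eq_zero _).mpr fun x hx => ?_
    obtain ⟨y, rfl⟩ := h.exact_triple_pair hCA hAB n m hnm x hx
    have := h0 n
    rw [Subsingleton.elim y 0, map_zero]
  · intro y
    have := h0 m
    exact h.exact_triple_sub hCA hAB n m hnm y (Subsingleton.elim _ _)

/-- If a filtration `B` over the finite subsets of `ι` is such that `𝔥(Q k)` maps onto
`𝔥(B (J ∪ {k}), B J)` for `k ∉ J`, then all elements of `𝔥(B J, L)` are sums of elements from
the modules `𝔥(Q k)`. -/
theorem exists_eq_sum {ι : Type*} [DecidableEq ι] {L : SubMulAction G Y}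
    (B : Finset ι → SubMulAction G Y) (hB : Monotone B) (hL : ∀ J, L ≤ B J) (hB0 : B ∅ ≤ L)
    {Bu : SubMulAction G Y} (hBu : ∀ J, B J ≤ Bu) (Q : ι → GPair G)
    (j : ∀ k, Q k ⟶ GPair.of Bu L) (n : ℤ)
    (hj : ∀ (J : Finset ι) (k : ι), k ∉ J → ∃ f : Q k ⟶ GPair.of (B (insert k J)) L,
      f ≫ GPair.incl (hBu _) le_rfl = j k ∧
      Function.Surjective (h.ml n (f ≫ GPair.incl le_rfl (hL J))))
    (J : Finset ι) (y : (h.H n).obj (GPair.of (B J) L)) :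
    ∃ z : ∀ k, (h.H n).obj (Q k), h.ml n (GPair.incl (hBu J) le_rfl) y =
      ∑ k ∈ J, h.ml n (j k) (z k) := by
  induction J using Finset.induction_on with
  | empty =>
    refine ⟨fun _ => 0, ?_⟩
    have := h.subsingleton_of_forall_mem n (P := GPair.of (B ∅) L) fun x => hB0 x.2
    rw [Subsingleton.elim y 0, map_zero, Finset.sum_empty]
  | insert k J hk ih =>
    obtain ⟨f, hf, hs⟩ := hj J k hk
    -- Modulo the previous stage, `y` is the image of a class of the new piece; the difference comes
    -- from the previous stage, where the induction hypothesis applies.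
    obtain ⟨t, ht⟩ := hs (h.ml n (GPair.incl le_rfl (hL J)) y)
    rw [ml_comp] at ht
    obtain ⟨y', hy'⟩ := h.exact_triple_mid (hL J) (hB (Finset.subset_insert k J)) n
      (y - h.ml n f t) (by rw [map_sub, ht, sub_self])
    obtain ⟨z, hz⟩ := ih y'
    refine ⟨Function.update z k t, ?_⟩
    have h1 : y = h.ml n (GPair.incl (hB (Finset.subset_insert k J)) le_rfl) y' + h.ml n f t := by
      rw [hy']; abel
    rw [Finset.sum_insert hk, Function.update_self, h1, map_add, incl_incl, hz, ← hf, ml_comp,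
      add_comm]
    congr 1
    refine Finset.sum_congr rfl fun i hi => ?_
    rw [Function.update_of_ne (ne_of_mem_of_not_mem hi hk)]

end Triples

/-! ### Finite additivity -/

section Sums

/-- Finite additivity. -/
theorem sigma_bijective_of_finite (n : ℤ) {ι : Type u} [DecidableEq ι] [Finite ι]
    (P : ι → GPair G) :
    Function.Bijective (DirectSum.toModule R ι ((h.H n).obj (GPair.sigma P))
      (fun i => ((h.H n).map (GPair.sigmaIncl P i)).hom)) := by
  have hcl : ∀ i, IsClopen (Set.range (GPair.sigmaIncl P i).toFun) := fun i =>
    isClopen_range_sigmaMk (X := fun j => (P j).X)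
  have hemb : ∀ i, Topology.IsEmbedding (GPair.sigmaIncl P i).toFun := fun i =>
    Topology.IsEmbedding.sigmaMk (σ := fun j => (P j).X)
  have hrange : ∀ (i : ι) (x : (GPair.sigma P).X), x.1 = i → x ∈ Set.range (GPair.sigmaIncl P i).toFun := by
    rintro i ⟨_, x⟩ rfl
    exact ⟨x, rfl⟩
  constructor
  -- Adjoining all summands but the `i`-th to the subspace gives a pair that excises to `P i`. Thus
  -- `ρ i` acts as the projection to the `i`-th component, and injectivity is tested one component
  -- at a time.
  · let A' : ι → SubMulAction G (GPair.sigma P).X := fun i =>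
      { carrier := {x | x ∈ (GPair.sigma P).A ∨ x.1 ≠ i}
        smul_mem' := by
          rintro g x (hx | hx)
          · exact Or.inl ((GPair.sigma P).A.smul_mem g hx)
          · exact Or.inr hx }
    let ρ : ∀ i, GPair.sigma P ⟶ (GPair.sigma P).withSub (A' i) := fun i =>
      GPair.toWithSub _ _ fun x hx => Or.inl hx
    have h1 : ∀ i, Function.Bijective (h.ml n (GPair.sigmaIncl P i ≫ ρ i)) := fun i => by
      refine h.ml_bijective_of_isEmbedding n _ (hemb i) ?_ ?_
      · rintro x (hx | hx)
        · exact hx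
        · exact (hx rfl).elim
      · have h2 : (Set.range (GPair.sigmaIncl P i).toFun)ᶜ ⊆ (A' i : Set (GPair.sigma P).X) :=
          fun x hx => Or.inr fun hxi => hx (hrange i x hxi)
        have h3 := (hcl i).compl
        have h4 := h3.isOpen.subset_interior_iff.mpr h2
        rwa [← h3.isClosed.closure_eq] at h4
    have h2 : ∀ i j, i ≠ j → ∀ x, h.ml n (GPair.sigmaIncl P j ≫ ρ i) x = 0 := fun i j hij =>
      h.ml_eq_zero n _ fun x => Or.inr hij.symm
    refine (injective_iff_map_eq_zero _).mpr fun z hz => ?_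
    refine DFinsupp.ext fun i => (h1 i).1 ?_
    have h3 : h.ml n (ρ i) ∘ₗ DirectSum.toModule R ι ((h.H n).obj (GPair.sigma P))
        (fun i => ((h.H n).map (GPair.sigmaIncl P i)).hom) =
        h.ml n (GPair.sigmaIncl P i ≫ ρ i) ∘ₗ DirectSum.component R ι _ i := by
      refine DirectSum.linearMap_ext R fun j => LinearMap.ext fun x => ?_
      simp only [LinearMap.comp_apply, DirectSum.toModule_lof]
      by_cases hij : j = i
      · subst hij
        rw [DirectSum.component.lof_self, ml_comp]
      · have h5 := h2 i j (Ne.symm hij) x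
        rw [ml_comp] at h5
        rw [DirectSum.component.of, dif_neg hij, map_zero]
        exact h5
    have h4 := LinearMap.congr_fun h3 z
    rw [LinearMap.comp_apply, hz, map_zero, LinearMap.comp_apply] at h4
    exact h4.symm.trans (map_zero _).symm
  -- Surjectivity: the summands are added to the subspace one by one, each step being an excision of
  -- clopen pieces, and `exists_eq_sum` applies.
  · cases nonempty_fintype ι
    let A := (GPair.sigma P).A
    let B : Finset ι → SubMulAction G (GPair.sigma P).X := fun J =>
      { carrier := {x | x ∈ A ∨ x.1 ∈ J}
        smul_mem' := by
          rintro g x (hx | hx)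
          · exact Or.inl (A.smul_mem g hx)
          · exact Or.inr hx }
    have hL : ∀ J, A ≤ B J := fun J x hx => Or.inl hx
    let toB : ∀ J i, i ∈ J → (P i ⟶ GPair.of (B J) A) := fun J i hi =>
      { toFun := fun x => (⟨(GPair.sigmaIncl P i).toFun x, Or.inr hi⟩ : B J)
        continuous_toFun := Continuous.subtype_mk (GPair.sigmaIncl P i).continuous_toFun _
        map_smul := fun _ _ => rfl
        map_mem := fun x hx => hx }
    let κ : GPair.sigma P ⟶ GPair.of (B Finset.univ) A :=
      { toFun := fun x => (⟨x, Or.inr (Finset.mem_univ _)⟩ : B Finset.univ)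
        continuous_toFun := Continuous.subtype_mk continuous_id _
        map_smul := fun _ _ => rfl
        map_mem := fun x hx => hx }
    let κ' : GPair.of (B Finset.univ) A ⟶ GPair.sigma P :=
      { toFun := Subtype.val
        continuous_toFun := continuous_subtype_val
        map_smul := fun _ _ => rfl
        map_mem := fun x hx => hx }
    have hBmono : Monotone B := fun J J' hJ x hx => hx.imp_right fun h => hJ h
    intro y
    obtain ⟨z, hz⟩ := h.exists_eq_sum B hBmono hL (fun x hx => hx.resolve_right
      (Finset.notMem_empty _)) (fun J => hBmono (Finset.subset_univ J)) P
      (fun k => toB Finset.univ k (Finset.mem_univ k)) n (fun J k hk => by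
        refine ⟨toB _ k (Finset.mem_insert_self k J), rfl, ?_⟩
        refine (h.ml_bijective_of_isEmbedding n _ ?_ ?_ ?_).2
        · exact (hemb k).codRestrict (B (insert k J) : Set (GPair.sigma P).X) fun x =>
            Or.inr (Finset.mem_insert_self k J)
        · rintro x (hx | hx)
          · exact hx
          · exact (hk hx).elim
        · have h0 : Set.range (toB _ k (Finset.mem_insert_self k J) ≫
              GPair.incl le_rfl (hL J)).toFun =
              (Subtype.val : B (insert k J) → _) ⁻¹' Set.range (GPair.sigmaIncl P k).toFun := by
            ext x
            constructor
            · rintro ⟨t, rfl⟩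
              exact ⟨t, rfl⟩
            · rintro ⟨t, ht⟩
              exact ⟨t, Subtype.ext ht⟩
          have h3 : IsClopen (Set.range (toB _ k (Finset.mem_insert_self k J) ≫
              GPair.incl le_rfl (hL J)).toFun)ᶜ := by
            rw [h0]
            exact ((hcl k).preimage continuous_subtype_val).compl
          rw [h3.isClosed.closure_eq]
          refine h3.isOpen.subset_interior_iff.mpr fun x hx => ?_
          rcases x.2 with hx' | hx'
          · exact Or.inl hx'
          · refine Or.inr ((Finset.mem_insert.mp hx').resolve_left fun hxk => hx ?_)
            rw [h0]
            exact hrange k x.1 hxk) Finset.univ (h.ml n κ y)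
    refine ⟨∑ k, DirectSum.lof R ι (fun i => (h.H n).obj (P i)) k (z k), ?_⟩
    rw [incl_self] at hz
    have h5 := congrArg (h.ml n κ') hz
    rw [← ml_comp, show κ ≫ κ' = 𝟙 _ from rfl, ml_id, map_sum] at h5
    rw [h5, map_sum]
    refine Finset.sum_congr rfl fun k _ => ?_
    rw [DirectSum.toModule_lof, ← ml_comp]
    rfl

end Sums

end HomologyTheory

end HomologyGeneral

section LinInv

variable {R : Type v} [Ring R] {M N : Type w} [AddCommGroup M] [AddCommGroup N] [Module R M]
    [Module R N] {f : M →ₗ[R] N}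

theorem linInv_eq (hf : Function.Bijective f) :
    linInv f = (LinearEquiv.ofBijective f hf).symm.toLinearMap := dif_pos hf

theorem apply_linInv (hf : Function.Bijective f) (y : N) : f (linInv f y) = y := by
  rw [linInv_eq hf]
  exact (LinearEquiv.ofBijective f hf).apply_symm_apply y

theorem linInv_apply (hf : Function.Bijective f) (x : M) : linInv f (f x) = x := by
  rw [linInv_eq hf]
  exact (LinearEquiv.ofBijective f hf).symm_apply_apply x

theorem linInv_bijective (hf : Function.Bijective f) : Function.Bijective (linInv f) := by
  rw [linInv_eq hf]
  exact (LinearEquiv.ofBijective f hf).symm.bijective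

end LinInv

/-! ### Excision of faces; the incidence maps and `ζ` are isomorphisms -/

section Simplices

variable {V : Type u}

/-- Unions of faces of a simplex. -/
structure IsFaceUnion (s : Finset V) (B : Set (V → ℝ)) : Prop where
  subset : B ⊆ closedSimplex s
  mem_of_zeros : ∀ x ∈ B, ∀ y ∈ closedSimplex s, (∀ v, x v = 0 → y v = 0) → y ∈ B

theorem isFaceUnion_simplexBd (s : Finset V) : IsFaceUnion s (simplexBd s) where
  subset _ hx := hx.1
  mem_of_zeros := by
    rintro x ⟨_, v, hv, hxv⟩ y hy h
    exact ⟨hy, v, hv, h v hxv⟩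

theorem isFaceUnion_simplexHat (s : Finset V) (a : V) : IsFaceUnion s (simplexHat s a) where
  subset _ hx := hx.1
  mem_of_zeros := by
    rintro x ⟨_, v, hv, hva, hxv⟩ y hy h
    exact ⟨hy, v, hv, hva, h v hxv⟩

theorem mem_closedSimplex_of_zeros {s r : Finset V} (hrs : r ⊆ s) {x : V → ℝ}
    (hx : x ∈ closedSimplex s) (hr : ∀ v ∈ s, v ∉ r → x v = 0) : x ∈ closedSimplex r := by
  refine ⟨hx.1, fun v hv => ?_, ?_⟩
  · by_cases hvs : v ∈ s
    · exact hr v hvs hv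
    · exact hx.2.1 v hvs
  · rw [← hx.2.2]
    exact Finset.sum_subset hrs hr

theorem mem_verts {n : ℕ} {v : Fin n ↪ V} {a : V} : a ∈ verts v ↔ ∃ i, v i = a := by
  simp [verts]

theorem apply_mem_verts {n : ℕ} (v : Fin n ↪ V) (i : Fin n) : v i ∈ verts v :=
  mem_verts.mpr ⟨i, rfl⟩

theorem face_apply {n : ℕ} (v : Fin (n + 1) ↪ V) (k : Fin (n + 1)) (i : Fin n) :
    face v k i = v (k.succAbove i) := rfl

theorem mem_verts_face {n : ℕ} {v : Fin (n + 1) ↪ V} {k : Fin (n + 1)} {a : V} :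
    a ∈ verts (face v k) ↔ a ∈ verts v ∧ a ≠ v k := by
  simp only [mem_verts, face_apply]
  constructor
  · rintro ⟨i, rfl⟩
    exact ⟨⟨_, rfl⟩, fun h => Fin.succAbove_ne k i (v.injective h)⟩
  · rintro ⟨⟨i, rfl⟩, h⟩
    obtain ⟨j, rfl⟩ := Fin.exists_succAbove_eq (x := i) (y := k) fun hik => h (by rw [hik])
    exact ⟨j, rfl⟩

theorem mem_closedSimplex_face {n : ℕ} {v : Fin (n + 1) ↪ V} {k : Fin (n + 1)} {x : V → ℝ} :
    x ∈ closedSimplex (verts (face v k)) ↔ x ∈ closedSimplex (verts v) ∧ x (v k) = 0 := by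
  constructor
  · intro hx
    exact ⟨closedSimplex_mono (verts_face_subset v k) hx, hx.2.1 _ (not_mem_verts_face v k)⟩
  · rintro ⟨hx, hk⟩
    refine mem_closedSimplex_of_zeros (verts_face_subset v k) hx fun a ha ha' => ?_
    have : a = v k := by
      by_contra hne
      exact ha' (mem_verts_face.mpr ⟨ha, hne⟩)
    rw [this, hk]

/-- The deformation of the simplex that multiplies the coordinates in `T` by `1 - t`. -/
def shrink [DecidableEq V] (T : Finset V) (t : ℝ) (x : V → ℝ) : V → ℝ := fun v =>
  if v ∈ T then (1 - t) * x v
  else x v * ((1 - (1 - t) * ∑ u ∈ T, x u) / (1 - ∑ u ∈ T, x u))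

section Shrink

variable [DecidableEq V] {s T : Finset V} {x : V → ℝ}

theorem shrink_zero (hT : ∑ u ∈ T, x u ≤ 1 / 2) : shrink T 0 x = x := by
  funext v
  have h1 : (1 - ∑ u ∈ T, x u) ≠ 0 := by linarith
  simp [shrink, h1]

theorem shrink_of_forall_eq_zero (t : ℝ) (hx : ∀ v ∈ T, x v = 0) : shrink T t x = x := by
  funext v
  rw [shrink, Finset.sum_eq_zero hx]
  split_ifs with hv
  · rw [hx v hv, mul_zero]
  · simp

theorem shrink_apply_eq_zero (t : ℝ) {v : V} (hv : x v = 0) : shrink T t x v = 0 := by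
  rw [shrink, hv]
  simp

theorem shrink_one_apply {v : V} (hv : v ∈ T) : shrink T 1 x v = 0 := by
  simp [shrink, hv]

theorem sum_shrink (t : ℝ) : ∑ v ∈ T, shrink T t x v = (1 - t) * ∑ v ∈ T, x v := by
  rw [Finset.mul_sum]
  exact Finset.sum_congr rfl fun v hv => if_pos hv

/-- The coordinates outside `T` are rescaled by the common factor that keeps the sum equal to `1`;
the bound `1 / 2` keeps the denominator of this factor away from `0`. -/
theorem shrink_mem (hTs : T ⊆ s) (hx : x ∈ closedSimplex s) (hT : ∑ u ∈ T, x u ≤ 1 / 2) {t : ℝ}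
    (ht : t ∈ Set.Icc (0 : ℝ) 1) : shrink T t x ∈ closedSimplex s := by
  have h0 : 0 ≤ ∑ u ∈ T, x u := Finset.sum_nonneg fun v _ => hx.1 v
  have h1 : 0 < 1 - ∑ u ∈ T, x u := by linarith
  obtain ⟨ht0, ht1⟩ := ht
  refine ⟨fun v => ?_, fun v hv => shrink_apply_eq_zero t (hx.2.1 v hv), ?_⟩
  · rw [shrink]
    split_ifs with hv
    · exact mul_nonneg (by linarith) (hx.1 v)
    · exact mul_nonneg (hx.1 v) (div_nonneg (by nlinarith) h1.le)
  · have h2 := hx.2.2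
    rw [← Finset.sum_sdiff hTs] at h2 ⊢
    have h3 : ∀ v ∈ s \ T, shrink T t x v =
        x v * ((1 - (1 - t) * ∑ u ∈ T, x u) / (1 - ∑ u ∈ T, x u)) :=
      fun v hv => if_neg (Finset.mem_sdiff.mp hv).2
    rw [sum_shrink, Finset.sum_congr rfl h3, ← Finset.sum_mul]
    rw [show ∑ v ∈ s \ T, x v = 1 - ∑ v ∈ T, x v by linarith]
    field_simp
    ring

theorem continuousOn_shrink (T : Finset V) :
    ContinuousOn (fun z : (V → ℝ) × ℝ => shrink T z.2 z.1) {z | ∑ u ∈ T, z.1 u ≤ 1 / 2} := by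
  refine continuousOn_pi.mpr fun v => ?_
  unfold shrink
  split_ifs with hv
  · fun_prop
  · refine ContinuousOn.mul (by fun_prop) (ContinuousOn.div (by fun_prop) (by fun_prop) ?_)
    intro z hz
    have : ∑ u ∈ T, z.1 u ≤ 1 / 2 := hz
    linarith

end Shrink

variable {G : Type u} [Group G] [TopologicalSpace G] [IsTopologicalGroup G]

/-- The map `G ⧸ H × B → G ⧸ K × B'` given by an equivariant map `G ⧸ H → G ⧸ K` and a map
`B → B'`. -/
def cellMap {H K : Subgroup G} (f : (⟨H⟩ : OrbitCat G) ⟶ ⟨K⟩) {B A B' A' : Set (V → ℝ)}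
    (φ : (V → ℝ) → (V → ℝ)) (hφ : ContinuousOn φ B) (hB : ∀ x ∈ B, φ x ∈ B')
    (hA : ∀ x ∈ B, x ∈ A → φ x ∈ A') : cellPair H B A ⟶ cellPair K B' A' where
  toFun y := (⟨(((orbitSpace G).map f).toFun y.1.1, φ y.1.2), hB _ y.2⟩ : cellSub K B')
  continuous_toFun := by
    have h1 : Continuous fun y : cellSub H B => (y.1 : (G ⧸ H) × (V → ℝ)) :=
      continuous_subtype_val
    refine Continuous.subtype_mk ?_ _
    exact (((orbitSpace G).map f).continuous_toFun.comp (continuous_fst.comp h1)).prodMk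
      (hφ.comp_continuous (continuous_snd.comp h1) fun y => y.2)
  map_smul g y := Subtype.ext (Prod.ext (((orbitSpace G).map f).map_smul g y.1.1) rfl)
  map_mem y hy := hA _ y.2 hy

variable {R : Type v} [Ring R] (h : HomologyTheory.{u, v, w} G R)

namespace HomologyTheory

theorem ml_cellPair_homotopic {H : Subgroup G} {B A B' A' : Set (V → ℝ)}
    (φ : ℝ → (V → ℝ) → (V → ℝ))
    (hφ : ContinuousOn (fun z : (V → ℝ) × ℝ => φ z.2 z.1) (B ×ˢ Set.Icc 0 1))
    (hB : ∀ t ∈ Set.Icc (0 : ℝ) 1, ∀ x ∈ B, φ t x ∈ B')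
    (hA : ∀ t ∈ Set.Icc (0 : ℝ) 1, ∀ x ∈ B, x ∈ A → φ t x ∈ A')
    (f g : cellPair H B A ⟶ cellPair H B' A')
    (hf : ∀ y : cellSub H B,
      (show cellSub H B' from f.toFun y).1 = ((y.1.1, φ 0 y.1.2) : (G ⧸ H) × (V → ℝ)))
    (hg : ∀ y : cellSub H B,
      (show cellSub H B' from g.toFun y).1 = ((y.1.1, φ 1 y.1.2) : (G ⧸ H) × (V → ℝ)))
    (n : ℤ) : h.ml n f = h.ml n g := by
  refine congrArg ModuleCat.Hom.hom (h.homotopy _ _ f g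
    (fun z => (⟨((show cellSub H B from z.1).1.1, φ z.2 (show cellSub H B from z.1).1.2),
      hB z.2 z.2.2 _ (show cellSub H B from z.1).2⟩ : cellSub H B')) ?_ (fun a x t => rfl)
      (fun x hx t => hA t t.2 _ (show cellSub H B from x).2 hx)
      (fun x => Subtype.ext (hf x).symm) (fun x => Subtype.ext (hg x).symm) n)
  have h1 : Continuous fun y : cellSub H B => (y.1 : (G ⧸ H) × (V → ℝ)) :=
    continuous_subtype_val
  refine Continuous.subtype_mk ?_ _
  refine (continuous_fst.comp (h1.comp continuous_fst)).prodMk ?_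
  exact hφ.comp_continuous ((continuous_snd.comp (h1.comp continuous_fst)).prodMk
    (continuous_subtype_val.comp continuous_snd)) fun z =>
      ⟨(show cellSub H B from z.1).2, z.2.2⟩

/-- If all points of `B` with a nonzero coordinate in `T` are in `B'`, then the inclusion of the
pair of the subspaces of `B` and `B'` where the coordinates in `T` vanish induces isomorphisms. -/
theorem face_excision (H : Subgroup G) {s T : Finset V} (hTs : T ⊆ s) {B B' C D : Set (V → ℝ)}
    (hB : IsFaceUnion s B) (hB' : IsFaceUnion s B')
    (hC : ∀ x, x ∈ C ↔ x ∈ B ∧ ∀ v ∈ T, x v = 0) (hD : ∀ x, x ∈ D ↔ x ∈ B' ∧ ∀ v ∈ T, x v = 0)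
    (hBB' : ∀ x ∈ B, ∀ v ∈ T, x v ≠ 0 → x ∈ B') (hCB : cellSub H C ≤ cellSub H B)
    (hDB : cellSub H D ≤ cellSub H B') (n : ℤ) :
    Function.Bijective (h.ml n (GPair.incl hCB hDB)) := by
  classical
  -- `N` is a neighbourhood of the face on which the coordinates in `T` vanish. The inclusion is
  -- factored into `i`, a homotopy equivalence by `shrink`, and `j`, an excision.
  let N : Set (V → ℝ) := {x | ∑ u ∈ T, x u ≤ 1 / 2}
  have hCN : ∀ x ∈ C, x ∈ N := fun x hx => by
    change ∑ u ∈ T, x u ≤ 1 / 2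
    rw [Finset.sum_eq_zero ((hC x).mp hx).2]
    norm_num
  have hDN : ∀ x ∈ D, x ∈ N := fun x hx => by
    change ∑ u ∈ T, x u ≤ 1 / 2
    rw [Finset.sum_eq_zero ((hD x).mp hx).2]
    norm_num
  let i : cellPair H C D ⟶ cellPair H (B ∩ N) (B' ∩ N) :=
    GPair.incl (cellSub_mono H fun x hx => ⟨((hC x).mp hx).1, hCN x hx⟩)
      (cellSub_mono H fun x hx => ⟨((hD x).mp hx).1, hDN x hx⟩)
  let j : cellPair H (B ∩ N) (B' ∩ N) ⟶ cellPair H B B' :=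
    GPair.incl (cellSub_mono H Set.inter_subset_left) (cellSub_mono H Set.inter_subset_left)
  have hI1 : (1 : ℝ) ∈ Set.Icc (0 : ℝ) 1 := ⟨zero_le_one, le_rfl⟩
  have hBt : ∀ t ∈ Set.Icc (0 : ℝ) 1, ∀ x ∈ B, x ∈ N → shrink T t x ∈ B := fun t ht x hx hN =>
    hB.mem_of_zeros x hx _ (shrink_mem hTs (hB.subset hx) hN ht) fun v => shrink_apply_eq_zero t
  have hBt' : ∀ t ∈ Set.Icc (0 : ℝ) 1, ∀ x ∈ B', x ∈ N → shrink T t x ∈ B' := fun t ht x hx hN =>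
    hB'.mem_of_zeros x hx _ (shrink_mem hTs (hB'.subset hx) hN ht) fun v => shrink_apply_eq_zero t
  have hNt : ∀ t ∈ Set.Icc (0 : ℝ) 1, ∀ x ∈ closedSimplex s, x ∈ N → shrink T t x ∈ N := by
    intro t ht x hx hN
    change ∑ u ∈ T, shrink T t x u ≤ 1 / 2
    have hN' : ∑ u ∈ T, x u ≤ 1 / 2 := hN
    rw [sum_shrink]
    have h0 : 0 ≤ ∑ u ∈ T, x u := Finset.sum_nonneg fun v _ => hx.1 v
    nlinarith [ht.1, ht.2]
  let r : cellPair H (B ∩ N) (B' ∩ N) ⟶ cellPair H C D :=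
    cellMap (𝟙 _) (shrink T 1) (by
        refine (continuousOn_shrink T).comp (f := fun x => (x, (1 : ℝ))) (by fun_prop) ?_
        exact fun x hx => hx.2)
      (fun x hx => (hC _).mpr ⟨hBt 1 hI1 x hx.1 hx.2, fun v hv => shrink_one_apply hv⟩)
      (fun x _ hx => (hD _).mpr ⟨hBt' 1 hI1 x hx.1 hx.2, fun v hv => shrink_one_apply hv⟩)
  have hi : Function.Bijective (h.ml n i) := by
    refine h.ml_bijective_of_inverse n (g := r) (congrArg _ ?_) ?_
    · refine GPair.hom_ext fun (y : cellSub H C) => ?_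
      refine Subtype.ext (Prod.ext rfl ?_)
      exact shrink_of_forall_eq_zero 1 ((hC _).mp y.2).2
    · refine (h.ml_cellPair_homotopic (shrink T) ?_ ?_ ?_ _ _ ?_ ?_ n).symm
      · exact (continuousOn_shrink T).mono fun z hz => hz.1.2
      · exact fun t ht x hx => ⟨hBt t ht x hx.1 hx.2, hNt t ht x (hB.subset hx.1) hx.2⟩
      · exact fun t ht x _ hx => ⟨hBt' t ht x hx.1 hx.2, hNt t ht x (hB'.subset hx.1) hx.2⟩
      · exact fun y => Prod.ext rfl (shrink_zero y.2.2).symm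
      · exact fun y => rfl
  have hσ : Continuous fun y : cellSub H B => ∑ u ∈ T, y.1.2 u := by
    have h1 : Continuous fun y : cellSub H B => (y.1 : (G ⧸ H) × (V → ℝ)) :=
      continuous_subtype_val
    have h2 : Continuous fun z : (G ⧸ H) × (V → ℝ) => ∑ u ∈ T, z.2 u := by fun_prop
    exact h2.comp h1
  have hj : Function.Bijective (h.ml n j) := by
    refine h.ml_bijective_of_isEmbedding n j ?_ ?_ ?_
    · exact Topology.IsEmbedding.inclusion
        (show (cellSub H (B ∩ N) : Set (CellSpace H V)) ⊆ cellSub H B from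
          cellSub_mono H Set.inter_subset_left)
    · exact fun (y : cellSub H (B ∩ N)) hy => ⟨hy, y.2.2⟩
    -- The removed set has closure in `{∑ ≥ 1 / 2}`. This lies in the open set `{∑ > 1 / 4}`, where
    -- some coordinate in `T` is nonzero, so that `hBB'` puts it inside the subspace `B'`.
    · have h1 : closure (Set.range j.toFun)ᶜ ⊆
          {y : cellSub H B | 1 / 2 ≤ ∑ u ∈ T, y.1.2 u} := by
        refine closure_minimal ?_ (isClosed_le continuous_const hσ)
        intro y hy
        by_contra hlt
        have hlt' : ¬1 / 2 ≤ ∑ u ∈ T, y.1.2 u := hlt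
        have hN : ∑ u ∈ T, y.1.2 u ≤ 1 / 2 := (not_le.mp hlt').le
        exact hy ⟨(⟨y.1, y.2, hN⟩ : cellSub H (B ∩ N)), rfl⟩
      have h2 : {y : cellSub H B | 1 / 4 < ∑ u ∈ T, y.1.2 u} ⊆
          interior ((cellPair H B B').A : Set (cellPair H B B').X) := by
        refine interior_maximal ?_ (isOpen_lt continuous_const hσ)
        intro y hy
        have h3 : ∑ u ∈ T, y.1.2 u ≠ 0 := by
          have : 1 / 4 < ∑ u ∈ T, y.1.2 u := hy
          linarith
        obtain ⟨v, hv, hne⟩ := Finset.exists_ne_zero_of_sum_ne_zero h3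
        exact hBB' _ y.2 v hv hne
      refine h1.trans (Set.Subset.trans ?_ h2)
      intro y hy
      have : 1 / 2 ≤ ∑ u ∈ T, y.1.2 u := hy
      change 1 / 4 < ∑ u ∈ T, y.1.2 u
      linarith
  have h1 : ⇑(h.ml n (GPair.incl hCB hDB)) = h.ml n j ∘ h.ml n i := by
    funext x
    exact (h.incl_incl _ _ _ _ n x).symm
  rw [h1]
  exact hj.comp hi

/-- This is `face_excision` with `T = {v k}`: a boundary point off the `k`-th face has a zero
coordinate at another vertex, hence lies in `ŝ_k`. -/
theorem faceIncl_bijective (H : Subgroup G) {p : ℕ} (v : Fin (p + 1) ↪ V) (k : Fin (p + 1))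
    (n : ℤ) : Function.Bijective (h.ml n (faceIncl H v k)) := by
  refine h.face_excision H (s := verts v) (T := {v k}) ?_ (isFaceUnion_simplexBd _)
    (isFaceUnion_simplexHat _ _) ?_ ?_ ?_ _ _ n
  · simp
  · intro x
    rw [mem_closedSimplex_face]
    simp only [Finset.mem_singleton, forall_eq]
    exact ⟨fun hx => ⟨⟨hx.1, v k, apply_mem_verts v k, hx.2⟩, hx.2⟩, fun hx => ⟨hx.1.1, hx.2⟩⟩
  · intro x
    simp only [Finset.mem_singleton, forall_eq]
    constructor
    · intro hx
      exact ⟨simplexBd_face_subset v k hx, (mem_closedSimplex_face.mp hx.1).2⟩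
    · rintro ⟨⟨hx, a, ha, hak, hxa⟩, hxk⟩
      exact ⟨mem_closedSimplex_face.mpr ⟨hx, hxk⟩, a, mem_verts_face.mpr ⟨ha, hak⟩, hxa⟩
  · intro x hx a ha hxa
    rw [Finset.mem_singleton] at ha
    subst ha
    obtain ⟨b, hb, hxb⟩ := hx.2
    exact ⟨hx.1, b, hb, fun hbk => hxa (hbk ▸ hxb), hxb⟩

/-- The straight contraction of `s` to the vertex `a` preserves the faces that contain `a`, whose
union is `ŝ_a`. It ends in the vertex `a`, a point of `ŝ_a` because there is another vertex. So the
identity of the pair induces zero. -/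
theorem subsingleton_simplexHat (H : Subgroup G) {s : Finset V} {a : V} (ha : a ∈ s)
    (hs : ∃ b ∈ s, b ≠ a) (n : ℤ) :
    Subsingleton ((h.H n).obj (cellPair H (closedSimplex s) (simplexHat s a))) := by
  classical
  let φ : ℝ → (V → ℝ) → (V → ℝ) := fun t x v => (1 - t) * x v + t * Pi.single (M := fun _ => ℝ) a 1 v
  have hφ : Continuous fun z : (V → ℝ) × ℝ => φ z.2 z.1 := by
    refine continuous_pi fun v => ?_
    fun_prop
  have hB : ∀ t ∈ Set.Icc (0 : ℝ) 1, ∀ x ∈ closedSimplex s, φ t x ∈ closedSimplex s := by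
    intro t ht x hx
    refine ⟨fun v => ?_, fun v hv => ?_, ?_⟩
    · have h1 : (0 : ℝ) ≤ Pi.single (M := fun _ => ℝ) a 1 v := by
        by_cases hva : v = a
        · subst hva; simp
        · simp [hva]
      have := mul_nonneg (sub_nonneg.mpr ht.2) (hx.1 v)
      have := mul_nonneg ht.1 h1
      change 0 ≤ (1 - t) * x v + t * _
      linarith
    · have hva : v ≠ a := fun hva => hv (hva ▸ ha)
      simp [φ, hva, hx.2.1 v hv]
    · change ∑ v ∈ s, ((1 - t) * x v + t * _) = 1
      rw [Finset.sum_add_distrib, ← Finset.mul_sum, ← Finset.mul_sum, hx.2.2,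
        Finset.sum_pi_single', if_pos ha]
      ring
  have hA : ∀ t ∈ Set.Icc (0 : ℝ) 1, ∀ x ∈ closedSimplex s, x ∈ simplexHat s a →
      φ t x ∈ simplexHat s a := by
    rintro t ht x hx ⟨_, v, hv, hva, hxv⟩
    exact ⟨hB t ht x hx, v, hv, hva, by simp [φ, hva, hxv]⟩
  have hI1 : (1 : ℝ) ∈ Set.Icc (0 : ℝ) 1 := ⟨zero_le_one, le_rfl⟩
  let g : cellPair H (closedSimplex s) (simplexHat s a) ⟶
      cellPair H (closedSimplex s) (simplexHat s a) :=
    cellMap (𝟙 _) (φ 1) (hφ.comp (by fun_prop : Continuous fun x => (x, (1 : ℝ)))).continuousOn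
      (hB 1 hI1) (hA 1 hI1)
  have h1 : h.ml n (𝟙 _) = h.ml n g := by
    refine h.ml_cellPair_homotopic φ hφ.continuousOn hB hA _ _ ?_ ?_ n
    · refine fun y => Prod.ext rfl (funext fun v => ?_)
      change y.1.2 v = (1 - 0) * y.1.2 v + 0 * _
      ring
    · exact fun y => rfl
  have h2 : ∀ x, h.ml n g x = 0 := h.ml_eq_zero n g fun (y : cellSub H (closedSimplex s)) => by
    obtain ⟨b, hb, hba⟩ := hs
    refine ⟨hB 1 hI1 _ y.2, b, hb, hba, ?_⟩
    change (1 - 1) * y.1.2 b + 1 * _ = (0 : ℝ)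
    simp [hba]
  have h3 : ∀ x : (h.H n).obj (cellPair H (closedSimplex s) (simplexHat s a)), x = 0 := fun x => by
    rw [← h.ml_id n x, h1, h2]
  exact ⟨fun x y => by rw [h3 x, h3 y]⟩

/-- With at least two vertices the homology of `(s, ŝ_k)` vanishes, so the boundary map of the
triple is bijective; the inverted map is bijective in any case. -/
theorem incidence_bijective (H : Subgroup G) {p : ℕ} (v : Fin (p + 2) ↪ V) (k : Fin (p + 2))
    (n m : ℤ) (hnm : m + 1 = n) : Function.Bijective (h.incidence H v k n m hnm) := by
  have h1 := h.tripleBd_bijective (B := cellSub H (closedSimplex (verts v)))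
    (A := cellSub H (simplexBd (verts v))) (C := cellSub H (simplexHat (verts v) (v k)))
    (cellSub_mono H fun x ⟨hx, b, hb, _, hxb⟩ => ⟨hx, b, hb, hxb⟩)
    (cellSub_mono H fun x hx => hx.1) n m hnm fun l =>
      h.subsingleton_simplexHat H (apply_mem_verts v k)
        ⟨v (k.succAbove 0), apply_mem_verts v _,
          fun hk => Fin.succAbove_ne k 0 (v.injective hk)⟩ l
  exact (linInv_bijective (h.faceIncl_bijective H v k m)).comp h1

/-- Trades the inverse in the incidence map for an equation in the homology of `(∂s, ŝ_k)`, to which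
naturality applies. -/
theorem incidence_eq_iff (H : Subgroup G) {p : ℕ} (v : Fin (p + 1) ↪ V) (k : Fin (p + 1))
    (n m : ℤ) (hnm : m + 1 = n) (x : (h.H n).obj (simplexPair H v))
    (y : (h.H m).obj (simplexPair H (face v k))) :
    h.incidence H v k n m hnm x = y ↔
      h.tripleBd (cellSub H (closedSimplex (verts v))) (cellSub H (simplexBd (verts v)))
        (cellSub H (simplexHat (verts v) (v k))) n m hnm x = h.ml m (faceIncl H v k) y := by
  constructor
  · rintro rfl
    exact (apply_linInv (h.faceIncl_bijective H v k m) _).symm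
  · intro hxy
    change linInv _ (h.tripleBd _ _ _ n m hnm x) = y
    rw [hxy]
    exact linInv_apply (h.faceIncl_bijective H v k m) y

theorem cellProj_bijective (H : Subgroup G) (v : Fin 1 ↪ V) (n : ℤ) :
    Function.Bijective (h.ml n (cellProj H v)) := by
  classical
  have hv : verts v = {v 0} := by
    ext a
    simp [eq_comm]
  let g : (orbitSpace G).obj ⟨H⟩ ⟶ simplexPair H v :=
    { toFun := fun y => (⟨((y : G ⧸ H), Pi.single (v 0) 1), by
        change Pi.single (v 0) 1 ∈ closedSimplex (verts v)
        rw [hv]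
        refine ⟨fun a => ?_, fun a ha => ?_, by simp⟩
        · by_cases hav : a = v 0
          · subst hav; simp
          · simp [hav]
        · have : a ≠ v 0 := by simpa using ha
          simp [this]⟩ : cellSub H (closedSimplex (verts v)))
      continuous_toFun := by
        refine Continuous.subtype_mk ?_ _
        have : Continuous fun y : G ⧸ H => (y, (Pi.single (v 0) 1 : V → ℝ)) := by fun_prop
        exact this
      map_smul := fun _ _ => rfl
      map_mem := fun x hx => (GPair.not_mem_abs x hx).elim }
  refine h.ml_bijective_of_inverse n (g := g) (congrArg _ ?_) (congrArg _ rfl)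
  refine GPair.hom_ext fun (y : cellSub H (closedSimplex (verts v))) => ?_
  refine Subtype.ext (Prod.ext rfl (funext fun a => ?_))
  have hy : y.1.2 ∈ closedSimplex {v 0} := hv ▸ (show y.1.2 ∈ closedSimplex (verts v) from y.2)
  change Pi.single (M := fun _ => ℝ) (v 0) 1 a = y.1.2 a
  by_cases hav : a = v 0
  · subst hav
    simpa using hy.2.2.symm
  · rw [hy.2.1 a (by simpa using hav)]
    simp [hav]

theorem zeta_zero_apply (H : Subgroup G) (v : Fin 1 ↪ V) (n m : ℤ) (hnm : m + (0 : ℕ) = n)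
    (hnm' : n = m) (x : (h.H n).obj (simplexPair H v)) :
    h.zeta H v n m hnm x = h.ml m (cellProj H v) (hnm' ▸ x) := by
  subst hnm'
  rfl

theorem zeta_succ_apply (H : Subgroup G) {p : ℕ} (v : Fin (p + 2) ↪ V) (n m : ℤ)
    (hnm : m + (p + 1 : ℕ) = n) (x : (h.H n).obj (simplexPair H v)) :
    h.zeta H v n m hnm x = (-1 : ℤ) ^ (p + 1) • h.zeta H (face v (Fin.last (p + 1))) (m + p) m rfl
      (h.incidence H v (Fin.last (p + 1)) n (m + p) (by rw [← hnm]; push_cast; ring) x) := rfl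

theorem zeta_bijective (H : Subgroup G) {p : ℕ} (v : Fin (p + 1) ↪ V) (n m : ℤ)
    (hnm : m + p = n) : Function.Bijective (h.zeta H v n m hnm) := by
  induction p generalizing n with
  | zero =>
    have hnm' : n = m := by simpa using hnm.symm
    subst hnm'
    exact h.cellProj_bijective H v n
  | succ p ih =>
    have h1 := (ih (face v (Fin.last (p + 1))) (m + p) rfl).comp
      (h.incidence_bijective H v (Fin.last (p + 1)) n (m + p) (by rw [← hnm]; push_cast; ring))
    rcases neg_one_pow_eq_or ℤ (p + 1) with h2 | h2
    · convert h1 using 1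
      funext x
      rw [zeta_succ_apply, h2, one_smul]
      rfl
    · have h3 := (Equiv.neg _).bijective.comp h1
      convert h3 using 1
      funext x
      rw [zeta_succ_apply, h2, neg_smul, one_smul]
      rfl

end HomologyTheory

end Simplices

/-! ### Boundary modulo codimension two, relabelling, and anticommutation of incidences -/

section Simplices

variable {V : Type u}

/-- The union of the faces of codimension two of a simplex. -/
def simplexSk (s : Finset V) : Set (V → ℝ) :=
  {x | x ∈ closedSimplex s ∧ ∃ a ∈ s, ∃ b ∈ s, a ≠ b ∧ x a = 0 ∧ x b = 0}

theorem simplexSk_subset_hat (s : Finset V) (a : V) : simplexSk s ⊆ simplexHat s a := by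
  rintro x ⟨hx, b, hb, c, hc, hbc, hxb, hxc⟩
  by_cases hba : b = a
  · exact ⟨hx, c, hc, fun hca => hbc (hba.trans hca.symm), hxc⟩
  · exact ⟨hx, b, hb, hba, hxb⟩

theorem simplexHat_subset_bd (s : Finset V) (a : V) : simplexHat s a ⊆ simplexBd s := by
  rintro x ⟨hx, b, hb, _, hxb⟩
  exact ⟨hx, b, hb, hxb⟩

theorem mem_simplexBd_face {n : ℕ} {v : Fin (n + 1) ↪ V} {k : Fin (n + 1)} {x : V → ℝ} :
    x ∈ simplexBd (verts (face v k)) ↔ x (v k) = 0 ∧ x ∈ simplexHat (verts v) (v k) := by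
  constructor
  · intro hx
    exact ⟨(mem_closedSimplex_face.mp hx.1).2, simplexBd_face_subset v k hx⟩
  · rintro ⟨hxk, hx, a, ha, hak, hxa⟩
    exact ⟨mem_closedSimplex_face.mpr ⟨hx, hxk⟩, a, mem_verts_face.mpr ⟨ha, hak⟩, hxa⟩

theorem simplexBd_face_subset_sk {n : ℕ} (v : Fin (n + 1) ↪ V) (k : Fin (n + 1)) :
    simplexBd (verts (face v k)) ⊆ simplexSk (verts v) := by
  intro x hx
  obtain ⟨hxk, hx, a, ha, hak, hxa⟩ := mem_simplexBd_face.mp hx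
  exact ⟨hx, a, ha, v k, apply_mem_verts v k, hak, hxa, hxk⟩

section Perm

variable {e : Equiv.Perm V} {s t : Finset V}

theorem comp_mem_closedSimplex (hst : ∀ a, a ∈ t ↔ e a ∈ s) {x : V → ℝ}
    (hx : x ∈ closedSimplex s) : x ∘ e ∈ closedSimplex t := by
  refine ⟨fun a => hx.1 _, fun a ha => hx.2.1 _ fun h => ha ((hst a).mpr h), ?_⟩
  rw [← hx.2.2]
  exact Finset.sum_equiv e hst fun _ _ => rfl

theorem comp_mem_simplexBd (hst : ∀ a, a ∈ t ↔ e a ∈ s) {x : V → ℝ}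
    (hx : x ∈ simplexBd s) : x ∘ e ∈ simplexBd t := by
  obtain ⟨hx, a, ha, hxa⟩ := hx
  exact ⟨comp_mem_closedSimplex hst hx, e.symm a, (hst _).mpr (by simpa using ha), by simpa using hxa⟩

theorem comp_mem_simplexHat (hst : ∀ a, a ∈ t ↔ e a ∈ s) {b : V} {x : V → ℝ}
    (hx : x ∈ simplexHat s (e b)) : x ∘ e ∈ simplexHat t b := by
  obtain ⟨hx, a, ha, hab, hxa⟩ := hx
  exact ⟨comp_mem_closedSimplex hst hx, e.symm a, (hst _).mpr (by simpa using ha),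
    fun h => hab (by rw [← h, e.apply_symm_apply]), by simpa using hxa⟩

end Perm

variable {G : Type u} [Group G] [TopologicalSpace G] [IsTopologicalGroup G]

/-- The map `G ⧸ H × B → G ⧸ K × B'` given by an equivariant map `G ⧸ H → G ⧸ K` and a
permutation of the vertices. -/
def relabel {H K : Subgroup G} (f : (⟨H⟩ : OrbitCat G) ⟶ ⟨K⟩) (e : Equiv.Perm V)
    {B A B' A' : Set (V → ℝ)} (hB : ∀ x ∈ B, x ∘ e ∈ B') (hA : ∀ x ∈ A, x ∘ e ∈ A') :
    cellPair H B A ⟶ cellPair K B' A' :=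
  cellMap f (fun x => x ∘ e)
    (continuous_pi fun a => continuous_apply (e a)).continuousOn hB fun x _ hx => hA x hx

variable {R : Type v} [Ring R] (h : HomologyTheory.{u, v, w} G R)

namespace HomologyTheory

/-- Modulo the faces of codimension two, `∂s` is assembled from its faces by excisions, so the
boundary is a sum of classes of faces. The `k`-th summand is identified by passing to `(∂s, ŝ_k)`,
where the other faces die. -/
theorem tripleBd_simplexSk (H : Subgroup G) {p : ℕ} (v : Fin (p + 1) ↪ V) (n m : ℤ)
    (hnm : m + 1 = n) (x : (h.H n).obj (simplexPair H v)) :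
    h.tripleBd (cellSub H (closedSimplex (verts v))) (cellSub H (simplexBd (verts v)))
      (cellSub H (simplexSk (verts v))) n m hnm x =
    ∑ k, h.ml m (GPair.incl (cellSub_mono H (closedSimplex_face_subset v k))
      (cellSub_mono H (simplexBd_face_subset_sk v k))) (h.incidence H v k n m hnm x) := by
  let s := verts v
  -- The codimension-two skeleton together with the faces numbered by `J`, the filtration for
  -- `exists_eq_sum`.
  let BJ : Finset (Fin (p + 1)) → Set (V → ℝ) := fun J =>
    {x | x ∈ simplexSk s ∨ x ∈ closedSimplex s ∧ ∃ k ∈ J, x (v k) = 0}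
  have hBJ : ∀ J, BJ J ⊆ simplexBd s := by
    rintro J x (hx | ⟨hx, k, _, hxk⟩)
    · exact simplexHat_subset_bd s (v 0) (simplexSk_subset_hat s _ hx)
    · exact ⟨hx, v k, apply_mem_verts v k, hxk⟩
  have hF : ∀ J, IsFaceUnion s (BJ J) := fun J =>
    { subset := fun x hx => (hBJ J hx).1
      mem_of_zeros := by
        rintro x (⟨hx, a, ha, b, hb, hab, hxa, hxb⟩ | ⟨hx, k, hk, hxk⟩) y hy hxy
        · exact Or.inl ⟨hy, a, ha, b, hb, hab, hxy a hxa, hxy b hxb⟩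
        · exact Or.inr ⟨hy, k, hk, hxy _ hxk⟩ }
  have hmono : Monotone fun J => cellSub H (BJ J) := fun J J' hJ => cellSub_mono H fun x hx =>
    hx.imp_right fun ⟨hx, k, hk, hxk⟩ => ⟨hx, k, hJ hk, hxk⟩
  have hL : ∀ J, cellSub H (simplexSk s) ≤ cellSub H (BJ J) := fun J =>
    cellSub_mono H fun x hx => Or.inl hx
  have huniv : cellSub H (simplexBd s) ≤ cellSub H (BJ Finset.univ) := by
    refine cellSub_mono H ?_
    rintro x ⟨hx, a, ha, hxa⟩
    obtain ⟨k, rfl⟩ := mem_verts.mp ha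
    exact Or.inr ⟨hx, k, Finset.mem_univ k, hxa⟩
  have hface : ∀ (J : Finset (Fin (p + 1))) (k : Fin (p + 1)), k ∈ J →
      closedSimplex (verts (face v k)) ⊆ BJ J := fun J k hk x hx =>
    Or.inr ⟨(mem_closedSimplex_face.mp hx).1, k, hk, (mem_closedSimplex_face.mp hx).2⟩
  obtain ⟨z, hz⟩ := h.exists_eq_sum (fun J => cellSub H (BJ J)) hmono hL
    (cellSub_mono H fun x hx => hx.resolve_right fun ⟨_, k, hk, _⟩ => Finset.notMem_empty k hk)
    (fun J => cellSub_mono H (hBJ J)) (fun k => simplexPair H (face v k))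
    (fun k => GPair.incl (cellSub_mono H (closedSimplex_face_subset v k))
      (cellSub_mono H (simplexBd_face_subset_sk v k))) m (fun J k hk => by
      refine ⟨GPair.incl (cellSub_mono H (hface _ k (Finset.mem_insert_self k J)))
        (cellSub_mono H (simplexBd_face_subset_sk v k)), rfl, ?_⟩
      refine (h.face_excision H (s := s) (T := {v k}) ?_ (hF (insert k J)) (hF J) ?_ ?_ ?_
        (cellSub_mono H (hface _ k (Finset.mem_insert_self k J)))
        ((cellSub_mono H (simplexBd_face_subset_sk v k)).trans (hL J)) m).2
      · simp [s]
      · simp only [Finset.mem_singleton, forall_eq]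
        exact fun x => ⟨fun hx => ⟨hface _ k (Finset.mem_insert_self k J) hx,
          (mem_closedSimplex_face.mp hx).2⟩,
          fun hx => mem_closedSimplex_face.mpr ⟨(hF _).subset hx.1, hx.2⟩⟩
      · simp only [Finset.mem_singleton, forall_eq]
        refine fun x => ⟨fun hx => ⟨Or.inl (simplexBd_face_subset_sk v k hx),
          (mem_simplexBd_face.mp hx).1⟩, ?_⟩
        rintro ⟨hx | ⟨hx, i, hi, hxi⟩, hxk⟩
        · exact mem_simplexBd_face.mpr ⟨hxk, simplexSk_subset_hat _ _ hx⟩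
        · exact mem_simplexBd_face.mpr ⟨hxk, hx, v i, apply_mem_verts v i,
            fun hik => hk (v.injective hik ▸ hi), hxi⟩
      · rintro x (hx | ⟨hx, i, hi, hxi⟩) a ha hxa
        · exact Or.inl hx
        · rw [Finset.mem_singleton] at ha
          subst ha
          rcases Finset.mem_insert.mp hi with rfl | hi
          · exact (hxa hxi).elim
          · exact Or.inr ⟨hx, i, hi, hxi⟩) Finset.univ
    (h.ml m (GPair.incl huniv le_rfl) (h.tripleBd (cellSub H (closedSimplex s))
      (cellSub H (simplexBd s)) (cellSub H (simplexSk s)) n m hnm x))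
  rw [incl_incl, incl_self] at hz
  rw [hz]
  refine Finset.sum_congr rfl fun k _ => ?_
  congr 1
  symm
  rw [incidence_eq_iff]
  have hsk := cellSub_mono H (simplexSk_subset_hat s (v k))
  -- Pushing forward to `(∂s, ŝ_k)` leaves only the `k`-th summand, and this is the defining
  -- equation of the incidence map.
  have h1 := h.tripleBd_incl (le_refl (cellSub H (closedSimplex s)))
    (le_refl (cellSub H (simplexBd s))) hsk n m hnm x
  rw [incl_self, hz, map_sum, Finset.sum_eq_single k, incl_incl] at h1
  · exact h1
  · intro i _ hik
    rw [incl_incl]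
    refine h.incl_eq_zero _ _ (cellSub_mono H fun x hx => ?_) _ _
    exact ⟨(mem_closedSimplex_face.mp hx).1, v i, apply_mem_verts v i,
      fun hi => hik (v.injective hi), (mem_closedSimplex_face.mp hx).2⟩
  · exact fun hk => (hk (Finset.mem_univ k)).elim

section Relabel

variable {H K : Subgroup G} (f : (⟨H⟩ : OrbitCat G) ⟶ ⟨K⟩) (e : Equiv.Perm V)

theorem mem_verts_face_iff {p : ℕ} {v w : Fin (p + 1) ↪ V} {k l : Fin (p + 1)} {e : Equiv.Perm V}
    (hvw : ∀ a, a ∈ verts w ↔ e a ∈ verts v) (hkl : e (w l) = v k) (a : V) :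
    a ∈ verts (face w l) ↔ e a ∈ verts (face v k) := by
  rw [mem_verts_face, mem_verts_face, hvw, ← hkl, e.injective.ne_iff]

theorem incidence_relabel {p : ℕ} (v w : Fin (p + 1) ↪ V) (k l : Fin (p + 1))
    (hvw : ∀ a, a ∈ verts w ↔ e a ∈ verts v) (hkl : e (w l) = v k) (n m : ℤ) (hnm : m + 1 = n)
    (x : (h.H n).obj (simplexPair H v)) :
    h.incidence K w l n m hnm (h.ml n (relabel f e
        (fun _ hx => comp_mem_closedSimplex hvw hx) (fun _ hx => comp_mem_simplexBd hvw hx)) x) =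
      h.ml m (relabel f e (fun _ hx => comp_mem_closedSimplex (mem_verts_face_iff hvw hkl) hx)
        (fun _ hx => comp_mem_simplexBd (mem_verts_face_iff hvw hkl) hx))
          (h.incidence H v k n m hnm x) := by
  rw [incidence_eq_iff]
  have h1 := (h.incidence_eq_iff H v k n m hnm x _).mp rfl
  have h2 := h.tripleBd_natural
    (C := cellSub H (simplexHat (verts v) (v k))) (C' := cellSub K (simplexHat (verts w) (w l)))
    (relabel f e (fun _ hx => comp_mem_closedSimplex hvw hx)
      (fun _ hx => comp_mem_simplexBd hvw hx))
    (relabel f e (fun _ hx => comp_mem_simplexBd hvw hx)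
      (fun _ hx => comp_mem_simplexHat hvw (hkl ▸ hx))) (fun _ _ _ => rfl) n m hnm x
  rw [h2, h1, ← ml_comp, ← ml_comp]
  rfl

/-- Precomposition with `e` carries the vertex `v i` to `w i`, because `e (w i) = v i`. This one
statement serves both for enlarging the subgroup (`e` the identity) and for translating by a group
element (`e` its action on `V`). -/
theorem zeta_relabel {p : ℕ} (v w : Fin (p + 1) ↪ V) (hvw : ∀ i, e (w i) = v i) (n m : ℤ)
    (hnm : m + p = n) (hB : ∀ x ∈ closedSimplex (verts v), x ∘ e ∈ closedSimplex (verts w))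
    (hA : ∀ x ∈ simplexBd (verts v), x ∘ e ∈ simplexBd (verts w))
    (x : (h.H n).obj (simplexPair H v)) :
    h.zeta K w n m hnm (h.ml n (relabel f e hB hA) x) =
      ((h.coeff m).map f).hom (h.zeta H v n m hnm x) := by
  induction p generalizing n with
  | zero =>
    obtain rfl : m = n := by simpa using hnm
    rw [zeta_zero_apply _ _ _ _ _ _ rfl, zeta_zero_apply _ _ _ _ _ _ rfl]
    change h.ml m _ _ = h.ml m ((orbitSpace G).map f) (h.ml m (cellProj H v) x)
    rw [← ml_comp, ← ml_comp]
    rfl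
  | succ p ih =>
    have hvw' : ∀ a, a ∈ verts w ↔ e a ∈ verts v := by
      intro a
      simp only [mem_verts, ← hvw, e.injective.eq_iff]
    rw [zeta_succ_apply, zeta_succ_apply, map_zsmul]
    rw [h.incidence_relabel f e v w _ _ hvw' (hvw _), ih]
    exact fun i => hvw _

end Relabel

/-- The incidence map depends only on the vertex set and on the omitted vertex, not on the order.
The inclusions stand for identifications of equal simplices. -/
theorem incidence_incl {H : Subgroup G} {p : ℕ} (v w : Fin (p + 1) ↪ V) (k l : Fin (p + 1))
    (hvw : verts v = verts w) (hkl : w l = v k) (n m : ℤ) (hnm : m + 1 = n)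
    {hB : cellSub H (closedSimplex (verts v)) ≤ cellSub H (closedSimplex (verts w))}
    {hA : cellSub H (simplexBd (verts v)) ≤ cellSub H (simplexBd (verts w))}
    (hB' : cellSub H (closedSimplex (verts (face v k))) ≤
      cellSub H (closedSimplex (verts (face w l))))
    (hA' : cellSub H (simplexBd (verts (face v k))) ≤ cellSub H (simplexBd (verts (face w l))))
    (x : (h.H n).obj (simplexPair H v)) :
    h.incidence H w l n m hnm (h.ml n (GPair.incl hB hA) x) =
      h.ml m (GPair.incl hB' hA') (h.incidence H v k n m hnm x) :=
  h.incidence_relabel (𝟙 _) (Equiv.refl V) v w k l (fun a => by rw [hvw]; rfl) hkl n m hnm x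

theorem zeta_incl_of_eq {H : Subgroup G} {p : ℕ} {v w : Fin (p + 1) ↪ V} (hvw : w = v) (n m : ℤ)
    (hnm : m + p = n)
    (hB : cellSub H (closedSimplex (verts v)) ≤ cellSub H (closedSimplex (verts w)))
    (hA : cellSub H (simplexBd (verts v)) ≤ cellSub H (simplexBd (verts w)))
    (x : (h.H n).obj (simplexPair H v)) :
    h.zeta H w n m hnm (h.ml n (GPair.incl hB hA) x) = h.zeta H v n m hnm x := by
  subst hvw
  rw [incl_self]

/-- The incidence maps anticommute. -/
theorem incidence_incidence (H : Subgroup G) {q : ℕ} (v : Fin (q + 3) ↪ V) (n m l : ℤ)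
    (hnm : m + 1 = n) (hml : l + 1 = m)
    (hB : cellSub H (closedSimplex (verts (face (face v (Fin.last (q + 1)).castSucc)
      (Fin.last (q + 1))))) ≤
      cellSub H (closedSimplex (verts (face (face v (Fin.last (q + 2))) (Fin.last (q + 1))))))
    (hA : cellSub H (simplexBd (verts (face (face v (Fin.last (q + 1)).castSucc)
      (Fin.last (q + 1))))) ≤
      cellSub H (simplexBd (verts (face (face v (Fin.last (q + 2))) (Fin.last (q + 1))))))
    (x : (h.H n).obj (simplexPair H v)) :
    h.ml l (GPair.incl hB hA) (h.incidence H (face v (Fin.last (q + 1)).castSucc)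
        (Fin.last (q + 1)) m l hml (h.incidence H v (Fin.last (q + 1)).castSucc n m hnm x)) =
      -h.incidence H (face v (Fin.last (q + 2))) (Fin.last (q + 1)) m l hml
        (h.incidence H v (Fin.last (q + 2)) n m hnm x) := by
  -- The vertices `v a` and `v b` are the last two. After either is omitted, the other is the last
  -- vertex, with number `c`, of the remaining face.
  set b := Fin.last (q + 2) with hb
  set a := (Fin.last (q + 1)).castSucc with ha
  set c := Fin.last (q + 1) with hc
  have hab : a ≠ b := by
    rw [Ne, Fin.ext_iff]; simp [a, b]
  have hfa : face v a c = v b := by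
    rw [face_apply]
    congr 1
    simp [a, b, c]
  have hfb : face v b c = v a := by
    rw [face_apply]
    congr 1
    simp [a, b, c]
  let s := verts v
  -- The union of all faces of codimension two except the one opposite to both `v a` and `v b`;
  -- modulo `E` only that face remains.
  let E : Set (V → ℝ) := {x | x ∈ closedSimplex s ∧
    ∃ i ∈ s, ∃ j ∈ s, i ≠ j ∧ x i = 0 ∧ x j = 0 ∧ i ≠ v a ∧ i ≠ v b}
  have hEF : IsFaceUnion s E :=
    { subset := fun x hx => hx.1
      mem_of_zeros := by
        rintro x ⟨hx, i, hi, j, hj, hij, hxi, hxj, h1⟩ y hy hxy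
        exact ⟨hy, i, hi, j, hj, hij, hxy _ hxi, hxy _ hxj, h1⟩ }
  have hSF : IsFaceUnion s (simplexSk s) :=
    { subset := fun x hx => hx.1
      mem_of_zeros := by
        rintro x ⟨hx, i, hi, j, hj, hij, hxi, hxj⟩ y hy hxy
        exact ⟨hy, i, hi, j, hj, hij, hxy _ hxi, hxy _ hxj⟩ }
  -- The relation comes from `∂∂ = 0` in the homology of the codimension-two skeleton modulo `E`,
  -- expanded over the faces of `s`.
  have hz0 := h.tripleBd_tripleBd (B := cellSub H (closedSimplex s))
    (A := cellSub H (simplexBd s)) (C := cellSub H (simplexSk s)) (D := cellSub H E) n m l hnm hml x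
  rw [tripleBd_simplexSk, map_sum, Finset.sum_eq_add b a hab.symm] at hz0
  rotate_left
  -- The boundary of any face other than those opposite to `v a` and `v b` lies in `E`, so these
  -- faces contribute nothing.
  · rintro k - ⟨hkb, hka⟩
    have h1 : cellSub H (simplexBd (verts (face v k))) ≤ cellSub H E := by
      refine cellSub_mono H ?_
      intro x hx
      obtain ⟨hxk, hx, i, hi, hik, hxi⟩ := mem_simplexBd_face.mp hx
      exact ⟨hx, v k, apply_mem_verts v k, i, hi, hik.symm, hxk, hxi,
        fun hk => hka (v.injective hk), fun hk => hkb (v.injective hk)⟩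
    rw [h.tripleBd_incl _ _ h1]
    exact h.incl_eq_zero _ _ h1 _ _
  · exact fun hk => (hk (Finset.mem_univ _)).elim
  · exact fun hk => (hk (Finset.mem_univ _)).elim
  have hEb : cellSub H (simplexHat (verts (face v b)) (face v b c)) ≤ cellSub H E := by
    refine cellSub_mono H ?_
    rw [hfb]
    rintro x ⟨hx, i, hi, hia, hxi⟩
    obtain ⟨hi, hib⟩ := mem_verts_face.mp hi
    obtain ⟨hx, hxb⟩ := mem_closedSimplex_face.mp hx
    exact ⟨hx, i, hi, v b, apply_mem_verts v b, hib, hxi, hxb, hia, hib⟩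
  have hEa : cellSub H (simplexHat (verts (face v a)) (face v a c)) ≤ cellSub H E := by
    refine cellSub_mono H ?_
    rw [hfa]
    rintro x ⟨hx, i, hi, hib, hxi⟩
    obtain ⟨hi, hia⟩ := mem_verts_face.mp hi
    obtain ⟨hx, hxa⟩ := mem_closedSimplex_face.mp hx
    exact ⟨hx, i, hi, v a, apply_mem_verts v a, hia, hxi, hxa, hia, hib⟩
  rw [h.tripleBd_incl _ _ hEb, h.tripleBd_incl _ _ hEa,
    (h.incidence_eq_iff H (face v b) c m l hml _ _).mp rfl,
    (h.incidence_eq_iff H (face v a) c m l hml _ _).mp rfl] at hz0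
  have hCr : ∀ x, x ∈ closedSimplex (verts (face (face v b) c)) ↔
      x ∈ closedSimplex s ∧ x (v b) = 0 ∧ x (v a) = 0 := by
    intro x
    rw [mem_closedSimplex_face, mem_closedSimplex_face, hfb, and_assoc]
  have hDr : ∀ x, x ∈ simplexBd (verts (face (face v b) c)) ↔
      x ∈ E ∧ x (v b) = 0 ∧ x (v a) = 0 := by
    intro x
    constructor
    · rintro ⟨hx, i, hi, hxi⟩
      obtain ⟨hi, hia⟩ := mem_verts_face.mp hi
      obtain ⟨hi, hib⟩ := mem_verts_face.mp hi
      rw [hfb] at hia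
      obtain ⟨hx, hxb, hxa⟩ := (hCr x).mp hx
      exact ⟨⟨hx, i, hi, v a, apply_mem_verts v a, hia, hxi, hxa, hia, hib⟩, hxb, hxa⟩
    · rintro ⟨⟨hx, i, hi, j, hj, hij, hxi, hxj, hia, hib⟩, hxb, hxa⟩
      exact ⟨(hCr x).mpr ⟨hx, hxb, hxa⟩, i,
        mem_verts_face.mpr ⟨mem_verts_face.mpr ⟨hi, hib⟩, by rwa [hfb]⟩, hxi⟩
  have hC : cellSub H (closedSimplex (verts (face (face v b) c))) ≤ cellSub H (simplexSk s) := by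
    refine cellSub_mono H fun x hx => ?_
    obtain ⟨hx, hxb, hxa⟩ := (hCr x).mp hx
    exact ⟨hx, v b, apply_mem_verts v b, v a, apply_mem_verts v a,
      fun hvab => hab (v.injective hvab.symm), hxb, hxa⟩
  have hD : cellSub H (simplexBd (verts (face (face v b) c))) ≤ cellSub H E :=
    cellSub_mono H fun x hx => ((hDr x).mp hx).1
  -- The face opposite to both vertices is cut out by the vanishing of the coordinates in `T = {v b,
  -- v a}`, and a point of the skeleton off this face is in `E`. So `face_excision` applies and the
  -- relation pulls back to that face.
  have hinj : Function.Injective (h.ml l (GPair.incl hC hD)) := by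
    classical
    refine (h.face_excision H (s := s) (T := {v b, v a}) ?_ hSF hEF ?_ ?_ ?_ hC hD l).1
    · intro i hi
      rcases Finset.mem_insert.mp hi with rfl | hi
      · exact apply_mem_verts v b
      · rw [Finset.mem_singleton.mp hi]
        exact apply_mem_verts v a
    · intro x
      simp only [Finset.mem_insert, Finset.mem_singleton, forall_eq_or_imp, forall_eq]
      rw [hCr]
      refine ⟨fun hx => ⟨⟨hx.1, v b, apply_mem_verts v b, v a, apply_mem_verts v a,
        fun hvab => hab (v.injective hvab.symm), hx.2.1, hx.2.2⟩, hx.2⟩,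
        fun hx => ⟨hx.1.1, hx.2⟩⟩
    · intro x
      simp only [Finset.mem_insert, Finset.mem_singleton, forall_eq_or_imp, forall_eq]
      exact hDr x
    · rintro x ⟨hx, i, hi, j, hj, hij, hxi, hxj⟩ k hk hxk
      by_cases hi' : i ≠ v a ∧ i ≠ v b
      · exact ⟨hx, i, hi, j, hj, hij, hxi, hxj, hi'⟩
      · refine ⟨hx, j, hj, i, hi, hij.symm, hxj, hxi, ?_, ?_⟩
        · rintro rfl
          simp only [Finset.mem_insert, Finset.mem_singleton] at hk
          rcases hk with rfl | rfl
          · exact hi' ⟨hij, fun hib => hxk (hib ▸ hxi)⟩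
          · exact hxk hxj
        · rintro rfl
          simp only [Finset.mem_insert, Finset.mem_singleton] at hk
          rcases hk with rfl | rfl
          · exact hxk hxj
          · exact hi' ⟨fun hia => hxk (hia ▸ hxi), hij⟩
  refine eq_neg_of_add_eq_zero_right (hinj ?_)
  rw [map_zero, map_add, incl_incl]
  exact (congrArg₂ (· + ·) (h.incl_incl _ _ _ _ l _) (h.incl_incl _ _ _ _ l _)).symm.trans hz0

end HomologyTheory

end Simplices

/-! ### Behaviour of `ζ` under permutations of vertices and under passage to faces -/

section Simplices

variable {V : Type u} {G : Type u} [Group G] [TopologicalSpace G] [IsTopologicalGroup G]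
  {R : Type v} [Ring R] (h : HomologyTheory.{u, v, w} G R)

theorem verts_eq_of_perm {p : ℕ} {v w : Fin p ↪ V} {τ : Equiv.Perm (Fin p)}
    (hτ : ∀ i, w i = v (τ i)) : verts w = verts v := by
  ext a
  simp only [mem_verts, hτ]
  exact τ.exists_congr_left.trans (by simp)

omit [TopologicalSpace G] [IsTopologicalGroup G] in
-- Orderings with equal vertex sets have equal, but not definitionally equal, simplex pairs; they
-- are compared by inclusions instead of casts.
theorem incl_hyps {H : Subgroup G} {p q : ℕ} {v : Fin p ↪ V} {w : Fin q ↪ V}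
    (hvw : verts w = verts v) :
    cellSub H (closedSimplex (verts v)) ≤ cellSub H (closedSimplex (verts w)) ∧
      cellSub H (simplexBd (verts v)) ≤ cellSub H (simplexBd (verts w)) := by
  rw [hvw]
  exact ⟨le_rfl, le_rfl⟩

theorem face_eq_of_perm {p : ℕ} {v w : Fin (p + 1) ↪ V} {k l : Fin (p + 1)}
    (hkl : ∀ i, w (l.succAbove i) = v (k.succAbove i)) : face w l = face v k :=
  DFunLike.ext _ _ hkl

namespace HomologyTheory

/-- The projections of the two endpoints to `G ⧸ H` extend to the whole edge, and the boundary of a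
class of `(s, ∂s)` vanishes in `s`; so the two contributions cancel. This is the lowest case of the
exchange of the last two vertices. -/
theorem zeta_face_add_zeta_face (H : Subgroup G) (v : Fin 2 ↪ V) (n m l : ℤ)
    (hnm : m + 1 = n) (hlm : l + (0 : ℕ) = m) (x : (h.H n).obj (simplexPair H v)) :
    h.zeta H (face v 0) m l hlm (h.incidence H v 0 n m hnm x) =
      -h.zeta H (face v 1) m l hlm (h.incidence H v 1 n m hnm x) := by
  obtain rfl : l = m := by simpa using hlm
  rw [zeta_zero_apply _ _ _ _ _ _ rfl, zeta_zero_apply _ _ _ _ _ _ rfl]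
  -- For an edge `simplexSk` is empty, since two zero coordinates contradict the sum `1`; so `π` is
  -- a map to a pair with empty subspace.
  let π : cellPair H (closedSimplex (verts v)) (simplexSk (verts v)) ⟶ (orbitSpace G).obj ⟨H⟩ :=
    { toFun := fun (y : cellSub H (closedSimplex (verts v))) =>
        Prod.fst (α := G ⧸ H) (β := V → ℝ) y.1
      continuous_toFun := by
        have h : Continuous fun y : (G ⧸ H) × (V → ℝ) => y.1 := continuous_fst
        exact h.comp continuous_subtype_val
      map_smul := fun _ _ => rfl
      map_mem := fun y hy => by
        exfalso
        obtain ⟨hx, a, ha, b, hb, hab, hxa, hxb⟩ := hy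
        obtain ⟨i, rfl⟩ := mem_verts.mp ha
        obtain ⟨j, rfl⟩ := mem_verts.mp hb
        have hij : i ≠ j := fun hij => hab (by rw [hij])
        have hsum := hx.2.2
        rw [Finset.sum_map, Finset.sum_eq_zero] at hsum
        · exact zero_ne_one hsum
        · intro k _
          have : k = i ∨ k = j := by omega
          rcases this with rfl | rfl
          · exact hxa
          · exact hxb }
  have hle : cellSub H (simplexBd (verts v)) ≤ cellSub H (closedSimplex (verts v)) :=
    cellSub_mono H fun x hx => hx.1
  have h1 := congrArg (h.ml l π) (h.incl_tripleBd (C := cellSub H (simplexSk (verts v)))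
    hle n l hnm x)
  rw [map_zero, tripleBd_simplexSk, map_sum, map_sum, Fin.sum_univ_two, ← ml_comp, ← ml_comp,
    ← ml_comp, ← ml_comp] at h1
  exact eq_neg_of_add_eq_zero_left h1

/-- `ζ(H, s)` changes by the sign of the permutation when the vertices of `s` are permuted. -/
theorem zeta_perm (H : Subgroup G) {p : ℕ} (τ : Equiv.Perm (Fin (p + 1))) (v w : Fin (p + 1) ↪ V)
    (hτ : ∀ i, w i = v (τ i)) (n m : ℤ) (hnm : m + p = n)
    (hB : cellSub H (closedSimplex (verts v)) ≤ cellSub H (closedSimplex (verts w)))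
    (hA : cellSub H (simplexBd (verts v)) ≤ cellSub H (simplexBd (verts w)))
    (x : (h.H n).obj (simplexPair H v)) :
    h.zeta H w n m hnm (h.ml n (GPair.incl hB hA) x) =
      (Equiv.Perm.sign τ : ℤ) • h.zeta H v n m hnm x := by
  induction p generalizing n with
  | zero =>
    obtain rfl : τ = 1 := Equiv.ext fun i => Subsingleton.elim (α := Fin 1) _ _
    rw [h.zeta_incl_of_eq (DFunLike.ext _ _ hτ)]
    simp
  | succ p ih =>
    -- Adjacent transpositions generate the symmetric group as a monoid, and the claim is
    -- multiplicative in the permutation.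
    have hmem : τ ∈ Submonoid.closure
        (Set.range fun i : Fin (p + 1) => Equiv.swap i.castSucc i.succ) := by
      rw [Equiv.Perm.mclosure_swap_castSucc_succ]
      trivial
    induction hmem using Submonoid.closure_induction generalizing v w with
    | one =>
      rw [h.zeta_incl_of_eq (DFunLike.ext _ _ hτ)]
      simp
    | mul σ ρ _ _ ih1 ih2 =>
      let t : Fin (p + 2) ↪ V := σ.toEmbedding.trans v
      have ht : ∀ i, t i = v (σ i) := fun i => rfl
      have hw : ∀ i, w i = t (ρ i) := fun i => by rw [hτ, ht]; rfl
      obtain ⟨hB1, hA1⟩ := incl_hyps (H := H) (verts_eq_of_perm ht)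
      obtain ⟨hB2, hA2⟩ := incl_hyps (H := H) (verts_eq_of_perm hw)
      have h1 := ih1 v t ht hB1 hA1 x
      have h2 := ih2 t w hw hB2 hA2 (h.ml n (GPair.incl hB1 hA1) x)
      rw [incl_incl] at h2
      rw [h2, h1, smul_smul, map_mul, mul_comm]
      push_cast
      rfl
    | mem σ hσ =>
      obtain ⟨i, rfl⟩ := hσ
      have hsign : (Equiv.Perm.sign (Equiv.swap i.castSucc i.succ) : ℤ) = -1 := by
        rw [Equiv.Perm.sign_swap (Fin.castSucc_lt_succ).ne]
        rfl
      dsimp only at hτ ⊢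
      rw [hsign]
      rw [zeta_succ_apply, zeta_succ_apply, smul_comm (-1 : ℤ)]
      congr 1
      have hverts := verts_eq_of_perm hτ
      induction i using Fin.lastCases with
      -- The transposition fixes the last vertex and restricts to an adjacent transposition of the
      -- last face, so the induction on the dimension applies.
      | cast i =>
        have hlast : w (Fin.last (p + 1)) = v (Fin.last (p + 1)) := by
          rw [hτ, Equiv.swap_apply_of_ne_of_ne]
          · exact (Fin.castSucc_lt_last _).ne'
          · rw [← Fin.castSucc_succ]
            exact (Fin.castSucc_lt_last _).ne'
        have hface : ∀ j, face w (Fin.last (p + 1)) j =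
            face v (Fin.last (p + 1)) (Equiv.swap i.castSucc i.succ j) := by
          intro j
          rw [face_apply, face_apply, Fin.succAbove_last, hτ]
          congr 1
          rw [← Fin.castSucc_succ]
          exact (Fin.castSucc_injective _).swap_apply _ _ _
        obtain ⟨hB1, hA1⟩ := incl_hyps (H := H) (verts_eq_of_perm hface)
        rw [h.incidence_incl v w _ _ hverts.symm hlast n (m + p) _ hB1 hA1, ih _ _ _ hface]
        rw [Equiv.Perm.sign_swap (Fin.castSucc_lt_succ).ne]
        rfl
      -- The last two vertices are exchanged, so the last face of `w` is the face of `v` opposite to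
      -- its penultimate vertex, in the same order. The sign comes from the edge case if `p = 0`,
      -- and from `incidence_incidence` after one more unfolding of `ζ` otherwise.
      | last =>
        have hlast : w (Fin.last (p + 1)) = v (Fin.last p).castSucc := by
          rw [hτ, Fin.succ_last, Equiv.swap_apply_right]
        have hfv : verts (face w (Fin.last (p + 1))) = verts (face v (Fin.last p).castSucc) := by
          ext a
          rw [mem_verts_face, mem_verts_face, hverts, hlast]
        have hface : face w (Fin.last (p + 1)) = face v (Fin.last p).castSucc := by
          refine face_eq_of_perm fun j => ?_
          rw [Fin.succAbove_last, hτ]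
          congr 1
          induction j using Fin.lastCases with
          | last => rw [Equiv.swap_apply_left, Fin.succAbove_castSucc_self]
          | cast j =>
            have h1 : j.castSucc < Fin.last p := Fin.castSucc_lt_last j
            rw [Equiv.swap_apply_of_ne_of_ne, Fin.succAbove_castSucc_of_lt _ _ h1]
            · exact fun h => h1.ne (Fin.castSucc_injective _ h)
            · rw [Fin.succ_last]
              exact (Fin.castSucc_lt_last _).ne
        obtain ⟨hB1, hA1⟩ := incl_hyps (H := H) hfv
        rw [h.incidence_incl v w _ _ hverts.symm hlast n (m + p) _ hB1 hA1,
          h.zeta_incl_of_eq hface, neg_one_smul]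
        cases p with
        | zero => exact h.zeta_face_add_zeta_face H v n _ m _ _ x
        | succ q =>
          rw [zeta_succ_apply, zeta_succ_apply, ← smul_neg]
          congr 1
          have hr : face (face v (Fin.last (q + 2))) (Fin.last (q + 1)) =
              face (face v (Fin.last (q + 1)).castSucc) (Fin.last (q + 1)) := by
            refine DFunLike.ext _ _ fun j => ?_
            simp only [face_apply, Fin.succAbove_last]
            rw [Fin.succAbove_castSucc_of_lt _ _ (Fin.castSucc_lt_last j)]
          obtain ⟨hB2, hA2⟩ := incl_hyps (H := H) (congrArg verts hr)
          rw [← map_neg, ← h.incidence_incidence H v n _ _ _ _ hB2 hA2, h.zeta_incl_of_eq hr]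

/-- The compatibility of the maps `ζ` with all incidence maps. -/
theorem zeta_face (H : Subgroup G) {p : ℕ} (v : Fin (p + 2) ↪ V) (k : Fin (p + 2)) (n m l : ℤ)
    (hnm : m + 1 = n) (hlm : l + p = m) (hln : l + (p + 1 : ℕ) = n)
    (x : (h.H n).obj (simplexPair H v)) :
    h.zeta H (face v k) m l hlm (h.incidence H v k n m hnm x) =
      (-1 : ℤ) ^ (k : ℕ) • h.zeta H v n l hln x := by
  -- The cycle that puts the vertex with number `k` last and keeps the order of the others. Its sign
  -- is `(-1)^(p+1) (-1)^k`, and the first factor cancels the one in the definition of `ζ`.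
  let τ : Equiv.Perm (Fin (p + 2)) := k.cycleRange.symm * finRotate (p + 2)
  have hτl : τ (Fin.last (p + 1)) = k := by
    change k.cycleRange.symm (finRotate (p + 2) (Fin.last (p + 1))) = k
    rw [finRotate_last, Fin.cycleRange_symm_zero]
  have hτc : ∀ j : Fin (p + 1), τ j.castSucc = k.succAbove j := fun j => by
    change k.cycleRange.symm (finRotate (p + 2) j.castSucc) = _
    rw [finRotate_apply, Fin.coeSucc_eq_succ, Fin.cycleRange_symm_succ]
  have hsign : (Equiv.Perm.sign τ : ℤ) = (-1) ^ (p + 1) * (-1) ^ (k : ℕ) := by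
    have : Equiv.Perm.sign τ = (-1) ^ (k : ℕ) * (-1) ^ (p + 1) := by
      rw [map_mul, Equiv.Perm.sign_symm, Fin.sign_cycleRange, sign_finRotate,
        Nat.add_succ_sub_one]
    rw [this, mul_comm]
    push_cast
    rfl
  let w : Fin (p + 2) ↪ V := τ.toEmbedding.trans v
  have hw : ∀ i, w i = v (τ i) := fun i => rfl
  have hface : face w (Fin.last (p + 1)) = face v k := by
    refine face_eq_of_perm fun i => ?_
    rw [Fin.succAbove_last, hw, hτc]
  obtain ⟨hB, hA⟩ := incl_hyps (H := H) (verts_eq_of_perm hw)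
  have h1 := h.zeta_perm H τ v w hw n l hln hB hA x
  obtain rfl : l + p = m := hlm
  obtain ⟨hB1, hA1⟩ := incl_hyps (H := H) (congrArg verts hface)
  rw [zeta_succ_apply, h.incidence_incl v w k (Fin.last (p + 1)) (verts_eq_of_perm hw).symm
    (by rw [hw, hτl]) n _ _ hB1 hA1, h.zeta_incl_of_eq hface, hsign, mul_smul] at h1
  have h2 := congrArg (fun y => (-1 : ℤ) ^ (p + 1) • y) h1
  have h3 : (-1 : ℤ) ^ (p + 1) * (-1) ^ (p + 1) = 1 := by
    rw [← mul_pow, neg_one_mul, neg_neg, one_pow]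
  simpa only [smul_smul, ← mul_assoc, h3, one_mul, one_smul] using h2

end HomologyTheory

end Simplices

/-! ### Bijectivity of maps out of direct sums -/

section DirectSums

variable {R : Type v} [Ring R] {ι : Type u} [DecidableEq ι] {M N : ι → Type w} {L : Type w}
  [∀ i, AddCommGroup (M i)] [∀ i, AddCommGroup (N i)] [AddCommGroup L]
  [∀ i, Module R (M i)] [∀ i, Module R (N i)] [Module R L]

theorem toModule_comp_bijective_iff (e : ∀ i, M i →ₗ[R] N i) (he : ∀ i, Function.Bijective (e i))
    (g : ∀ i, N i →ₗ[R] L) :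
    Function.Bijective (DirectSum.toModule R ι L fun i => g i ∘ₗ e i) ↔
      Function.Bijective (DirectSum.toModule R ι L g) := by
  let E : (⨁ i, M i) ≃ₗ[R] ⨁ i, N i :=
    DFinsupp.mapRange.linearEquiv fun i => LinearEquiv.ofBijective (e i) (he i)
  have hE : ∀ (i : ι) (x : M i), E (DirectSum.lof R ι M i x) = DirectSum.lof R ι N i (e i x) :=
    fun i x => DFinsupp.mapRange_single (hf := fun i => map_zero (e i))
  have h1 : (DirectSum.toModule R ι L fun i => g i ∘ₗ e i) =
      DirectSum.toModule R ι L g ∘ₗ E.toLinearMap := by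
    refine DirectSum.linearMap_ext R fun i => LinearMap.ext fun x => ?_
    simp only [LinearMap.comp_apply, DirectSum.toModule_lof, LinearEquiv.coe_coe, hE]
  rw [h1, LinearMap.coe_comp]
  exact Function.Bijective.of_comp_iff _ E.bijective

theorem comp_toModule_bijective_iff (g : ∀ i, N i →ₗ[R] L) {L' : Type w} [AddCommGroup L']
    [Module R L'] (e : L →ₗ[R] L') (he : Function.Bijective e) :
    Function.Bijective (DirectSum.toModule R ι L' fun i => e ∘ₗ g i) ↔
      Function.Bijective (DirectSum.toModule R ι L g) := by
  have h1 : (DirectSum.toModule R ι L' fun i => e ∘ₗ g i) =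
      e ∘ₗ DirectSum.toModule R ι L g := by
    refine DirectSum.linearMap_ext R fun i => LinearMap.ext fun x => ?_
    simp only [LinearMap.comp_apply, DirectSum.toModule_lof]
  rw [h1, LinearMap.coe_comp]
  exact Function.Bijective.of_comp_iff' he _

end DirectSums

/-! ### Collars and the decomposition of relative homology -/

section Collars

variable {G : Type u} [Group G] [TopologicalSpace G]

/-- An invariant function `c` on the space of a pair `(X, A)`, together with an equivariant
deformation of `(X, {c ≤ δ})` into `(X, A)`. -/
structure Collar (P : GPair G) (δ : ℝ) where
  c : P.X → ℝ
  continuous_c : Continuous c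
  c_smul : ∀ (g : G) (x : P.X), c (g • x) = c x
  c_le : ∀ x ∈ P.A, c x ≤ δ
  F : P.X × unitInterval → P.X
  continuous_F : Continuous F
  F_smul : ∀ (g : G) (x : P.X) (t : unitInterval), F (g • x, t) = g • F (x, t)
  F_zero : ∀ x, F (x, 0) = x
  F_mem : ∀ x ∈ P.A, ∀ t, F (x, t) ∈ P.A
  F_le : ∀ x, c x ≤ δ → ∀ t, c (F (x, t)) ≤ δ
  F_one : ∀ x, c x ≤ δ → F (x, 1) ∈ P.A

namespace Collar

variable {P : GPair G} {δ : ℝ} (C : Collar P δ)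

/-- The invariant subspace `{c ≤ δ}`. -/
def sub : SubMulAction G P.X where
  carrier := {x | C.c x ≤ δ}
  smul_mem' g x hx := by
    change C.c (g • x) ≤ δ
    rwa [C.c_smul]

/-- The invariant subspace `{c ≥ δ / 2}`. -/
def coreSub : SubMulAction G P.X where
  carrier := {x | δ / 2 ≤ C.c x}
  smul_mem' g x hx := by
    change δ / 2 ≤ C.c (g • x)
    rwa [C.c_smul]

/-- The pair `({c ≥ δ / 2}, {δ ≥ c ≥ δ / 2})`. -/
abbrev core : GPair G := GPair.of C.coreSub C.sub

/-- The inclusion `(X, A) → (X, {c ≤ δ})`. -/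
abbrev toSub : P ⟶ P.withSub C.sub := P.toWithSub C.sub C.c_le

/-- The inclusion of the core in `(X, {c ≤ δ})`. -/
def coreIncl : C.core ⟶ P.withSub C.sub where
  toFun := Subtype.val
  continuous_toFun := continuous_subtype_val
  map_smul _ _ := rfl
  map_mem _ hx := hx

variable {R : Type v} [Ring R] (h : HomologyTheory.{u, v, w} G R)

/-- The time-one map of `F` is a homotopy inverse: `F` preserves both `A` and `{c ≤ δ}`, so it is a
homotopy of either pair. -/
theorem toSub_bijective (n : ℤ) : Function.Bijective (h.ml n C.toSub) := by
  let r : P.withSub C.sub ⟶ P :=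
    { toFun := fun x => C.F (x, 1)
      continuous_toFun := C.continuous_F.comp (Continuous.prodMk_left 1)
      map_smul := fun g x => C.F_smul g x 1
      map_mem := fun x hx => C.F_one x hx }
  refine h.ml_bijective_of_inverse n (g := r) ?_ ?_
  · exact congrArg ModuleCat.Hom.hom (h.homotopy _ _ _ _ C.F C.continuous_F C.F_smul C.F_mem
      C.F_zero (fun _ => rfl) n).symm
  · exact congrArg ModuleCat.Hom.hom (h.homotopy _ _ (𝟙 (P.withSub C.sub)) (r ≫ C.toSub) C.F
      C.continuous_F C.F_smul C.F_le C.F_zero (fun _ => rfl) n).symm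

/-- The closed set `{c ≤ δ / 2}` lies in the open set `{c < δ}`. The two levels `δ / 2` and `δ` are
there to leave this room for excision. -/
theorem closure_subset_interior (hδ : 0 < δ) {S : Set P.X} (hS : ∀ x ∈ S, C.c x < δ / 2) :
    closure S ⊆ interior (C.sub : Set P.X) := by
  have h1 : closure S ⊆ {x | C.c x ≤ δ / 2} :=
    closure_minimal (fun x hx => (hS x hx).le) (isClosed_le C.continuous_c continuous_const)
  have h2 : {x | C.c x < δ} ⊆ interior (C.sub : Set P.X) :=
    interior_maximal (fun x hx => le_of_lt (show C.c x < δ from hx))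
      (isOpen_lt C.continuous_c continuous_const)
  refine h1.trans (Set.Subset.trans (fun x hx => ?_) h2)
  have : C.c x ≤ δ / 2 := hx
  change C.c x < δ
  linarith

theorem coreIncl_bijective (hδ : 0 < δ) (n : ℤ) : Function.Bijective (h.ml n C.coreIncl) := by
  refine h.ml_bijective_of_isEmbedding n _ Topology.IsEmbedding.subtypeVal (fun x hx => hx) ?_
  refine C.closure_subset_interior hδ fun x hx => ?_
  by_contra hlt
  exact hx ⟨(⟨x, not_lt.mp hlt⟩ : C.coreSub), rfl⟩

/-- If the cores of pairs `Pᵢ` decompose the core of a pair `X`, then the homology of `X` is the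
direct sum of those of the pairs `Pᵢ`. -/
theorem sum_bijective (hδ : 0 < δ) {X : GPair G} (D : Collar X δ) {ι : Type u} [DecidableEq ι]
    {P : ι → GPair G} (C : ∀ i, Collar (P i) δ) (j : ∀ i, P i ⟶ X)
    (hj : ∀ i x, D.c ((j i).toFun x) = (C i).c x)
    (hinj : ∀ i i' x x', δ / 2 ≤ (C i).c x → δ / 2 ≤ (C i').c x' →
      (j i).toFun x = (j i').toFun x' → (⟨i, x⟩ : Σ i, (P i).X) = ⟨i', x'⟩)
    (hsurj : ∀ y, δ / 2 ≤ D.c y → ∃ i x, (j i).toFun x = y)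
    (hclosed : ∀ S : ∀ i, Set (P i).X, (∀ i, IsClosed (S i)) →
      (∀ i, ∀ x ∈ S i, δ / 2 ≤ (C i).c x) → IsClosed (⋃ i, (j i).toFun '' S i))
    (n : ℤ)
    (hsum : ∀ Q : ι → GPair G, Function.Bijective (DirectSum.toModule R ι
      ((h.H n).obj (GPair.sigma Q)) (fun i => h.ml n (GPair.sigmaIncl Q i)))) :
    Function.Bijective (DirectSum.toModule R ι ((h.H n).obj X) fun i => h.ml n (j i)) := by
  let j' : ∀ i, (P i).withSub (C i).sub ⟶ X.withSub D.sub := fun i =>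
    { toFun := (j i).toFun
      continuous_toFun := (j i).continuous_toFun
      map_smul := (j i).map_smul
      map_mem := fun x hx => (hj i x).trans_le hx }
  let Q : ι → GPair G := fun i => (C i).core
  -- The disjoint union of the cores maps bijectively onto `{D.c ≥ δ / 2}`. By `hclosed` this is a
  -- closed embedding, and the complement of its image can be excised.
  let Ψ : GPair.sigma Q ⟶ X.withSub D.sub :=
    { toFun := fun x => (j x.1).toFun x.2.1
      continuous_toFun := continuous_sigma (σ := fun i => (Q i).X) fun i =>
        (j i).continuous_toFun.comp continuous_subtype_val
      map_smul := fun g x => (j x.1).map_smul g x.2.1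
      map_mem := fun x hx => (j' x.1).map_mem _ hx }
  have hΨ : Function.Bijective (h.ml n Ψ) := by
    refine h.ml_bijective_of_isEmbedding n Ψ ?_ ?_ ?_
    · refine (Topology.IsClosedEmbedding.of_continuous_injective_isClosedMap
        Ψ.continuous_toFun ?_ ?_).isEmbedding
      · rintro ⟨i, x, hx⟩ ⟨i', x', hx'⟩ hxx'
        have h1 := hinj i i' x x' hx hx' hxx'
        obtain rfl : i = i' := congrArg Sigma.fst h1
        obtain rfl : x = x' := eq_of_heq (Sigma.mk.inj_iff.mp h1).2
        rfl
      · intro S hS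
        have h1 : Ψ.toFun '' S = ⋃ i, (j i).toFun '' ((fun x : (Q i).X =>
            (show (P i).X from x.1)) '' ((GPair.sigmaIncl Q i).toFun ⁻¹' S)) := by
          ext y
          constructor
          · rintro ⟨⟨i, x⟩, hx, rfl⟩
            exact Set.mem_iUnion.mpr ⟨i, x.1, ⟨x, hx, rfl⟩, rfl⟩
          · intro hy
            obtain ⟨i, _, ⟨x, hx, rfl⟩, rfl⟩ := Set.mem_iUnion.mp hy
            exact ⟨⟨i, x⟩, hx, rfl⟩
        rw [h1]
        refine hclosed _ (fun i => ?_) ?_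
        · have h2 : IsClosed ((C i).coreSub : Set (P i).X) :=
            isClosed_le continuous_const (C i).continuous_c
          exact h2.isClosedEmbedding_subtypeVal.isClosedMap _
            (isClosed_sigma_iff (σ := fun i => (Q i).X).mp hS i)
        · rintro i _ ⟨x, _, rfl⟩
          exact x.2
    · exact fun x hx => (hj x.1 x.2.1).symm.trans_le hx
    · refine D.closure_subset_interior hδ fun y hy => ?_
      by_contra hlt
      obtain ⟨i, x, rfl⟩ := hsurj y (not_lt.mp hlt)
      exact hy ⟨⟨i, (⟨x, (not_lt.mp hlt).trans_eq (hj i x)⟩ : (C i).coreSub)⟩, rfl⟩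
  have h1 := (comp_toModule_bijective_iff (fun i => h.ml n (GPair.sigmaIncl Q i)) _ hΨ).mpr
    (hsum Q)
  have h2 : ∀ i, h.ml n Ψ ∘ₗ h.ml n (GPair.sigmaIncl Q i) =
      h.ml n (j' i) ∘ₗ h.ml n (C i).coreIncl := fun i => by
    refine LinearMap.ext fun x => ?_
    rw [LinearMap.comp_apply, LinearMap.comp_apply, ← h.ml_comp, ← h.ml_comp]
    rfl
  have h3 : ∀ i, h.ml n D.toSub ∘ₗ h.ml n (j i) = h.ml n (j' i) ∘ₗ h.ml n (C i).toSub :=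
    fun i => by
      refine LinearMap.ext fun x => ?_
      rw [LinearMap.comp_apply, LinearMap.comp_apply, ← h.ml_comp, ← h.ml_comp]
      rfl
  -- Passing from each pair to the pair with enlarged subspace, and from there to the core, are
  -- isomorphisms compatible with the maps to `X`. So the decomposition for the cores carries over
  -- to the original pairs.
  rw [funext h2, toModule_comp_bijective_iff (fun i => h.ml n (C i).coreIncl)
    (fun i => (C i).coreIncl_bijective h hδ n)] at h1
  rw [← comp_toModule_bijective_iff _ _ (D.toSub_bijective h n), funext h3,
    toModule_comp_bijective_iff (fun i => h.ml n (C i).toSub)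
    (fun i => (C i).toSub_bijective h n)]
  exact h1

end Collar

end Collars

/-! ### Radial expansion of a simplex from its barycenter -/

section MinCoord

variable {V : Type u}

/-- The smallest barycentric coordinate. -/
def minCoord (s : Finset V) (x : V → ℝ) : ℝ :=
  if hs : s.Nonempty then s.inf' hs x else 0

/-- The radial expansion of a simplex with `n` vertices from its barycenter, truncated so that it
maps the points with `c = minCoord ≤ 1 / (2 n)` to the boundary at time `t = 1`. -/
def pushOut (n : ℕ) (c t : ℝ) (x : V → ℝ) : V → ℝ := fun v =>
  max (x v - t * min c (1 / (2 * n))) 0 / (1 - n * (t * min c (1 / (2 * n))))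

variable {s : Finset V} {x : V → ℝ}

theorem minCoord_le {v : V} (hv : v ∈ s) : minCoord s x ≤ x v := by
  rw [minCoord, dif_pos ⟨v, hv⟩]
  exact Finset.inf'_le x hv

theorem exists_eq_minCoord (hs : s.Nonempty) : ∃ v ∈ s, x v = minCoord s x := by
  rw [minCoord, dif_pos hs]
  obtain ⟨v, hv, h⟩ := Finset.exists_mem_eq_inf' hs x
  exact ⟨v, hv, h.symm⟩

theorem continuous_minCoord (s : Finset V) : Continuous (minCoord s) := by
  unfold minCoord
  split_ifs with hs
  · exact Continuous.finset_inf'_apply hs fun v _ => continuous_apply v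
  · exact continuous_const

theorem nonempty_of_mem_closedSimplex (hx : x ∈ closedSimplex s) : s.Nonempty := by
  rw [Finset.nonempty_iff_ne_empty]
  rintro rfl
  simpa using hx.2.2

theorem minCoord_nonneg (hx : x ∈ closedSimplex s) : 0 ≤ minCoord s x := by
  obtain ⟨v, _, hv⟩ := exists_eq_minCoord (x := x) (nonempty_of_mem_closedSimplex hx)
  exact hv ▸ hx.1 v

theorem card_mul_minCoord_le (hx : x ∈ closedSimplex s) : s.card * minCoord s x ≤ 1 := by
  rw [← hx.2.2, ← nsmul_eq_mul]
  exact Finset.card_nsmul_le_sum s x _ fun v hv => minCoord_le hv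

theorem minCoord_eq_zero (hx : x ∈ closedSimplex s) {v : V} (hv : v ∈ s) (hxv : x v = 0) :
    minCoord s x = 0 :=
  le_antisymm (hxv ▸ minCoord_le hv) (minCoord_nonneg hx)

theorem pushOut_zero (n : ℕ) (c : ℝ) (hx : ∀ v, 0 ≤ x v) : pushOut n c 0 x = x := by
  funext v
  simp [pushOut, hx v]

theorem pushOut_min_zero (n : ℕ) (t : ℝ) (hx : ∀ v, 0 ≤ x v) : pushOut n 0 t x = x := by
  funext v
  have : min (0 : ℝ) (1 / (2 * n)) = 0 := min_eq_left (by positivity)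
  simp only [pushOut, this]
  simp [hx v]

/-- The cutoff `1 / (2 n)` bounds the total amount subtracted from the `n` coordinates by `1 / 2`.
Without it the denominator would vanish at the barycenter for `t = 1`. -/
theorem denominator_pos {n : ℕ} {c t : ℝ} (ht : t ∈ Set.Icc (0 : ℝ) 1) :
    0 < 1 - n * (t * min c (1 / (2 * n))) := by
  rcases Nat.eq_zero_or_pos n with rfl | hn
  · simp
  have hn' : (0 : ℝ) < n := Nat.cast_pos.mpr hn
  have h1 : t * min c (1 / (2 * n)) ≤ 1 / (2 * n) := by
    have h2 : t * min c (1 / (2 * n)) ≤ t * (1 / (2 * n)) :=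
      mul_le_mul_of_nonneg_left (min_le_right _ _) ht.1
    have h3 : t * (1 / (2 * n) : ℝ) ≤ 1 * (1 / (2 * n)) :=
      mul_le_mul_of_nonneg_right ht.2 (by positivity)
    linarith
  have h4 := mul_le_mul_of_nonneg_left h1 hn'.le
  have h5 : (n : ℝ) * (1 / (2 * n)) = 1 / 2 := by field_simp
  linarith

theorem continuousOn_pushOut (n : ℕ) :
    ContinuousOn (fun z : ℝ × ℝ × (V → ℝ) => pushOut n z.1 z.2.1 z.2.2)
      {z | z.2.1 ∈ Set.Icc (0 : ℝ) 1} := by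
  refine continuousOn_pi.mpr fun v => ?_
  refine ContinuousOn.div (by fun_prop) (by fun_prop) fun z hz => ?_
  exact (denominator_pos hz).ne'

/-- The subtracted amount is at most the smallest coordinate, so on the vertices of `s` the
truncation by `max` is inactive. It only serves to keep the coordinates outside `s` equal to `0`. -/
theorem pushOut_apply_of_mem {t : ℝ} (ht : t ∈ Set.Icc (0 : ℝ) 1) (hx : x ∈ closedSimplex s)
    {v : V} (hv : v ∈ s) : pushOut s.card (minCoord s x) t x v =
      (x v - t * min (minCoord s x) (1 / (2 * s.card))) /
        (1 - s.card * (t * min (minCoord s x) (1 / (2 * s.card)))) := by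
  have h1 : t * min (minCoord s x) (1 / (2 * s.card)) ≤ x v := by
    have h2 : 0 ≤ min (minCoord s x) (1 / (2 * s.card)) :=
      le_min (minCoord_nonneg hx) (by positivity)
    have h3 : min (minCoord s x) (1 / (2 * s.card)) ≤ x v := (min_le_left _ _).trans (minCoord_le hv)
    nlinarith [ht.1, ht.2]
  rw [pushOut, max_eq_left (by linarith)]

theorem pushOut_mem {t : ℝ} (ht : t ∈ Set.Icc (0 : ℝ) 1) (hx : x ∈ closedSimplex s) :
    pushOut s.card (minCoord s x) t x ∈ closedSimplex s := by
  have hd := denominator_pos (n := s.card) (c := minCoord s x) ht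
  refine ⟨fun v => div_nonneg (le_max_right _ _) hd.le, fun v hv => ?_, ?_⟩
  · have h2 : 0 ≤ t * min (minCoord s x) (1 / (2 * s.card)) :=
      mul_nonneg ht.1 (le_min (minCoord_nonneg hx) (by positivity))
    rw [pushOut, hx.2.1 v hv, max_eq_right (by linarith), zero_div]
  · rw [Finset.sum_congr rfl fun v hv => pushOut_apply_of_mem ht hx hv, ← Finset.sum_div,
      Finset.sum_sub_distrib, hx.2.2, Finset.sum_const, nsmul_eq_mul]
    exact div_self hd.ne'

/-- If `m` is the smallest of `n` coordinates and `u ≥ 0` is subtracted, then `(m - u) / (1 - n u) ≤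
m` amounts to `n m u ≤ u`. This holds because `n m ≤ 1`. -/
theorem minCoord_pushOut_le {t : ℝ} (ht : t ∈ Set.Icc (0 : ℝ) 1) (hx : x ∈ closedSimplex s) :
    minCoord s (pushOut s.card (minCoord s x) t x) ≤ minCoord s x := by
  obtain ⟨v, hv, hxv⟩ := exists_eq_minCoord (x := x) (nonempty_of_mem_closedSimplex hx)
  refine (minCoord_le hv).trans ?_
  rw [pushOut_apply_of_mem ht hx hv, div_le_iff₀ (denominator_pos ht), hxv]
  have h1 := card_mul_minCoord_le hx
  have h2 : 0 ≤ t * min (minCoord s x) (1 / (2 * s.card)) :=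
    mul_nonneg ht.1 (le_min (minCoord_nonneg hx) (by positivity))
  nlinarith

theorem pushOut_one_mem (hx : x ∈ closedSimplex s) (hc : minCoord s x ≤ 1 / (2 * s.card)) :
    pushOut s.card (minCoord s x) 1 x ∈ simplexBd s := by
  have h1 : (1 : ℝ) ∈ Set.Icc (0 : ℝ) 1 := ⟨zero_le_one, le_rfl⟩
  obtain ⟨v, hv, hxv⟩ := exists_eq_minCoord (x := x) (nonempty_of_mem_closedSimplex hx)
  refine ⟨pushOut_mem h1 hx, v, hv, ?_⟩
  rw [pushOut_apply_of_mem h1 hx hv, hxv, min_eq_left hc, one_mul, sub_self, zero_div]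

theorem pushOut_of_mem_bd (n : ℕ) (t : ℝ) (hx : x ∈ simplexBd s) :
    pushOut n (minCoord s x) t x = x := by
  obtain ⟨hx, v, hv, hxv⟩ := hx
  rw [minCoord_eq_zero hx hv hxv, pushOut_min_zero n t hx.1]

end MinCoord

/-! ### The collar of an equivariant simplex -/

section CellCollar

variable {V : Type u} {G : Type u} [Group G] [TopologicalSpace G] [IsTopologicalGroup G]

/-- The collar of the boundary of an equivariant simplex. -/
def cellCollar (H : Subgroup G) {p : ℕ} (v : Fin (p + 1) ↪ V) {δ : ℝ}
    (hδ : δ = 1 / (2 * (verts v).card)) : Collar (simplexPair H v) δ where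
  c (y : cellSub H (closedSimplex (verts v))) := minCoord (verts v) y.1.2
  continuous_c := by
    have h1 : Continuous fun y : cellSub H (closedSimplex (verts v)) =>
      (y.1 : (G ⧸ H) × (V → ℝ)) := continuous_subtype_val
    exact (continuous_minCoord _).comp (continuous_snd.comp h1)
  c_smul _ _ := rfl
  c_le := by
    rintro x ⟨hx, a, ha, hxa⟩
    rw [minCoord_eq_zero hx ha hxa, hδ]
    positivity
  F z := (⟨((show cellSub H (closedSimplex (verts v)) from z.1).1.1,
      pushOut (verts v).card
        (minCoord (verts v) (show cellSub H (closedSimplex (verts v)) from z.1).1.2) z.2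
        (show cellSub H (closedSimplex (verts v)) from z.1).1.2),
      pushOut_mem z.2.2 (show cellSub H (closedSimplex (verts v)) from z.1).2⟩ :
        cellSub H (closedSimplex (verts v)))
  continuous_F := by
    have h1 : Continuous fun y : cellSub H (closedSimplex (verts v)) =>
      (y.1 : (G ⧸ H) × (V → ℝ)) := continuous_subtype_val
    have h2 : Continuous fun z : cellSub H (closedSimplex (verts v)) × unitInterval =>
      (z.1.1 : (G ⧸ H) × (V → ℝ)).2 := continuous_snd.comp (h1.comp continuous_fst)
    refine Continuous.subtype_mk ?_ _
    refine (continuous_fst.comp (h1.comp continuous_fst)).prodMk ?_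
    exact (continuousOn_pushOut (verts v).card).comp_continuous
      (((continuous_minCoord _).comp h2).prodMk
        ((continuous_subtype_val.comp continuous_snd).prodMk h2)) fun z => z.2.2
  F_smul _ _ _ := rfl
  F_zero := fun (y : cellSub H (closedSimplex (verts v))) =>
    Subtype.ext (Prod.ext rfl (pushOut_zero _ _ y.2.1))
  F_mem y hy t := by
    refine ⟨pushOut_mem t.2 (show cellSub H (closedSimplex (verts v)) from y).2, ?_⟩
    change ∃ a ∈ _, pushOut _ _ _ _ a = 0
    rw [pushOut_of_mem_bd _ _ hy]
    exact hy.2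
  F_le := fun (y : cellSub H (closedSimplex (verts v))) hy t =>
    (minCoord_pushOut_le t.2 y.2).trans hy
  F_one := fun (y : cellSub H (closedSimplex (verts v))) hy => pushOut_one_mem y.2 (hδ ▸ hy)

end CellCollar

namespace GComplex

variable {G V : Type u} [Group G] [MulAction G V] [DecidableEq V] {K : GComplex G V}

/-! ### Supports of points and the coherent topology of the filtration -/

section Supports

variable {s t r : Finset V} {x : V → ℝ}

omit [DecidableEq V] in
theorem exists_support (hx : x ∈ closedSimplex s) :
    ∃ r ⊆ s, r.Nonempty ∧ x ∈ closedSimplex r ∧ ∀ v ∈ r, x v ≠ 0 := by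
  classical
  have h1 : x ∈ closedSimplex (s.filter fun v => x v ≠ 0) := by
    refine mem_closedSimplex_of_zeros (Finset.filter_subset _ _) hx fun v hv hv' => ?_
    by_contra hne
    exact hv' (Finset.mem_filter.mpr ⟨hv, hne⟩)
  exact ⟨_, Finset.filter_subset _ _, nonempty_of_mem_closedSimplex h1, h1,
    fun v hv => (Finset.mem_filter.mp hv).2⟩

theorem support_subset (hr : ∀ v ∈ r, x v ≠ 0) (hx : x ∈ closedSimplex t) : r ⊆ t := by
  intro v hv
  by_contra hvt
  exact hr v hv (hx.2.1 v hvt)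

theorem smul_fixes_of_subset (hs : s ∈ K.faces) (hrs : r ⊆ s) {g : G} (hg : g • s = s) :
    g • r = r := by
  change r.image (fun v => g • v) = r
  rw [Finset.image_congr (g := id) fun v hv => K.smul_vertex s hs g hg v (hrs hv), Finset.image_id]

theorem minCoord_smul (g : G) (s : Finset V) (x : V → ℝ) :
    minCoord (g • s) (fun v => x (g⁻¹ • v)) = minCoord s x := by
  rcases s.eq_empty_or_nonempty with rfl | hs
  · simp [minCoord]
  · refine le_antisymm ?_ ?_
    · obtain ⟨v, hv, hxv⟩ := exists_eq_minCoord (x := x) hs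
      have h1 := minCoord_le (x := fun v => x (g⁻¹ • v)) (Finset.smul_mem_smul_finset (a := g) hv)
      rwa [inv_smul_smul, hxv] at h1
    · obtain ⟨v, hv, hxv⟩ := exists_eq_minCoord (x := fun v => x (g⁻¹ • v)) (hs.smul_finset (a := g))
      obtain ⟨b, hb, rfl⟩ := Finset.mem_smul_finset.mp hv
      rw [← hxv, inv_smul_smul]
      exact minCoord_le hb

end Supports

section Filtration

variable (A : K.Sub) (n : ℕ)

/-- The simplices of the subcomplex whose realization is `filt A n`. -/
def filtFaces : Set (Finset V) := {t | t ∈ K.faces ∧ (t ∈ A.faces ∨ t.card ≤ n)}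

variable {A n}

theorem filtFaces_of_subset {s r : Finset V} (hs : s ∈ filtFaces A n) (hrs : r ⊆ s)
    (hr : r.Nonempty) : r ∈ filtFaces A n :=
  ⟨(K.isRelLowerSet_faces hs.1).2 hrs hr, hs.2.imp
    (fun h => (A.isRelLowerSet_faces h).2 hrs hr) (fun h => (Finset.card_le_card hrs).trans h)⟩

theorem filtFaces_smul {s : Finset V} (hs : s ∈ filtFaces A n) (g : G) : g • s ∈ filtFaces A n :=
  ⟨K.smul_mem_faces g s hs.1, hs.2.imp (A.smul_mem_faces g s)
    fun h => by rwa [Finset.card_smul_finset]⟩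

theorem mem_filt {x : K.Realization} :
    x ∈ filt A n ↔ ∃ t ∈ filtFaces A n, x.1 ∈ closedSimplex t :=
  ⟨fun ⟨t, ht, h, hx⟩ => ⟨t, ⟨ht, h⟩, hx⟩, fun ⟨t, ⟨ht, h⟩, hx⟩ => ⟨t, ht, h, hx⟩⟩

theorem chi_mem_closedSimplex {t : Finset V} (ht : t ∈ K.faces) (H : Subgroup G)
    (hH : H ≤ MulAction.stabilizer G t) (a : G) (x : closedSimplex t) :
    (chi ht H hH ((a : G ⧸ H), x)).1 ∈ closedSimplex (a • t) := closedSimplex_smul x.2 a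

theorem chi_mem_filt {t : Finset V} (ht : t ∈ filtFaces A n) (H : Subgroup G)
    (hH : H ≤ MulAction.stabilizer G t) (y : (G ⧸ H) × closedSimplex t) :
    chi ht.1 H hH y ∈ filt A n := by
  obtain ⟨y, x⟩ := y
  induction y using Quotient.inductionOn with
  | h a => exact mem_filt.mpr ⟨a • t, filtFaces_smul ht a, chi_mem_closedSimplex _ _ _ a x⟩

/-- The characteristic map of a simplex of `filt A n`. -/
def chiFilt {t : Finset V} (ht : t ∈ filtFaces A n)
    (y : (G ⧸ MulAction.stabilizer G t) × closedSimplex t) : filt A n :=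
  ⟨chi ht.1 _ le_rfl y, chi_mem_filt ht _ le_rfl y⟩

theorem exists_chiFilt_eq (x : filt A n) : ∃ (t : Finset V) (ht : t ∈ filtFaces A n)
    (y : (G ⧸ MulAction.stabilizer G t) × closedSimplex t), chiFilt ht y = x := by
  obtain ⟨⟨x, hx'⟩, hx⟩ := x
  obtain ⟨t, ht, hxt⟩ := mem_filt.mp hx
  refine ⟨t, ht, (((1 : G) : G ⧸ MulAction.stabilizer G t), ⟨x, hxt⟩), ?_⟩
  refine Subtype.ext (Subtype.ext (funext fun v => ?_))
  change x ((1 : G)⁻¹ • v) = x v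
  rw [inv_one, one_smul]

variable [TopologicalSpace G]

omit [DecidableEq V] in
theorem isClosed_closedSimplex (s : Finset V) : IsClosed (closedSimplex s) := by
  have h1 : closedSimplex s = {x | ∀ v, 0 ≤ x v} ∩ ({x | ∀ v, v ∉ s → x v = 0} ∩
      {x | ∑ v ∈ s, x v = 1}) := rfl
  rw [h1]
  refine IsClosed.inter ?_ (IsClosed.inter ?_ ?_)
  · simp only [Set.ofPred_forall]
    exact isClosed_iInter fun v => isClosed_le continuous_const (continuous_apply v)
  · simp only [Set.ofPred_forall]
    exact isClosed_iInter fun v => isClosed_iInter fun _ =>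
      isClosed_eq (continuous_apply v) continuous_const
  · exact isClosed_eq (by fun_prop) continuous_const

theorem continuous_chiFilt {t : Finset V} (ht : t ∈ filtFaces A n) :
    Continuous (chiFilt ht) :=
  Continuous.subtype_mk (continuous_chi ht.1 _ le_rfl) _

/-- The topology of `filt A n` is coherent with respect to the characteristic maps of its
simplices. -/
theorem isClosed_of_chiFilt {C : Set (filt A n)}
    (hC : ∀ (t : Finset V) (ht : t ∈ filtFaces A n), IsClosed (chiFilt ht ⁻¹' C)) :
    IsClosed C := by
  have h0 : C = Subtype.val ⁻¹' ((Subtype.val : filt A n → K.Realization) '' C) :=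
    (Set.preimage_image_eq C Subtype.val_injective).symm
  rw [h0]
  refine IsClosed.preimage continuous_subtype_val ?_
  -- Closedness in the realization must be tested on all simplices `s` of `K`, while the hypothesis
  -- covers only those of the filtration stage; faces of `s` mediate between the two.
  refine isClosed_iSup_iff.mpr fun ⟨s, hs⟩ => isClosed_coinduced.mpr ?_
  let pr : ∀ t, t ⊆ s → G ⧸ MulAction.stabilizer G s → G ⧸ MulAction.stabilizer G t :=
    fun t hts => Quotient.map' id fun a b hab => QuotientGroup.leftRel_apply.mpr
      (smul_fixes_of_subset hs hts (QuotientGroup.leftRel_apply.mp hab))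
  have hpr : ∀ t hts, Continuous (pr t hts) := fun t hts => continuous_id.quotient_map' _
  let Z : ∀ t : Finset V, Set ((G ⧸ MulAction.stabilizer G s) × closedSimplex s) := fun t =>
    {y | y.2.1 ∈ closedSimplex t}
  have hZ : ∀ t, IsClosed (Z t) := fun t => (isClosed_closedSimplex t).preimage
    (continuous_subtype_val.comp continuous_snd)
  let θ : ∀ t, t ⊆ s → Z t → (G ⧸ MulAction.stabilizer G t) × closedSimplex t := fun t hts y =>
    (pr t hts y.1.1, ⟨y.1.2.1, y.2⟩)
  have hθ : ∀ t hts, Continuous (θ t hts) := fun t hts =>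
    ((hpr t hts).comp (continuous_fst.comp continuous_subtype_val)).prodMk
      (Continuous.subtype_mk (continuous_subtype_val.comp
        (continuous_snd.comp continuous_subtype_val)) _)
  have hchi : ∀ (t : Finset V) (hts : t ⊆ s) (ht : t ∈ filtFaces A n) (y : Z t),
      (chiFilt ht (θ t hts y)).1 = chi hs _ le_rfl y.1 := by
    rintro t hts ht ⟨⟨y, x⟩, hx⟩
    induction y using Quotient.inductionOn with
    | h a => rfl
  -- The preimage in `G ⧸ G_s × s` is a union over the finitely many faces `t` of `s` in the
  -- filtration stage. Each piece is closed in a closed subspace because `χ_s` restricted to `t`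
  -- factors through `χ_t`.
  have h1 : chi hs (MulAction.stabilizer G s) le_rfl ⁻¹' (Subtype.val '' C) =
      ⋃ t : {t : Finset V // t ⊆ s ∧ t ∈ filtFaces A n},
        Subtype.val '' (θ t.1 t.2.1 ⁻¹' (chiFilt t.2.2 ⁻¹' C)) := by
    ext y
    constructor
    · rintro ⟨z, hz, hzy⟩
      obtain ⟨r, hrs, hrne, hyr, hr⟩ := exists_support y.2.2
      -- `r` is the support of the point. Its translate lies in every simplex that contains the
      -- image point, in particular in one of the filtration stage, which is closed under faces and
      -- translation.
      have hrA : r ∈ filtFaces A n := by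
        obtain ⟨t, ht, hzt⟩ := mem_filt.mp z.2
        obtain ⟨y, x⟩ := y
        induction y using Quotient.inductionOn with
        | h a =>
          have h2 : a • r ⊆ t := by
            refine support_subset (fun v hv => ?_) hzt
            obtain ⟨b, hb, rfl⟩ := Finset.mem_smul_finset.mp hv
            rw [hzy]
            change x.1 (a⁻¹ • a • b) ≠ 0
            rw [inv_smul_smul]
            exact hr b hb
          have h3 := filtFaces_smul (filtFaces_of_subset ht h2 (hrne.smul_finset (a := a))) a⁻¹
          rwa [inv_smul_smul] at h3
      refine Set.mem_iUnion.mpr ⟨⟨r, hrs, hrA⟩, ⟨y, hyr⟩, ?_, rfl⟩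
      change chiFilt hrA _ ∈ C
      have h4 : chiFilt hrA (θ r hrs ⟨y, hyr⟩) = z := Subtype.ext ((hchi r hrs hrA _).trans hzy.symm)
      rwa [h4]
    · intro hy
      obtain ⟨⟨t, hts, ht⟩, z, hz, rfl⟩ := Set.mem_iUnion.mp hy
      exact ⟨_, hz, hchi t hts ht z⟩
  rw [h1]
  have : Finite {t : Finset V // t ⊆ s ∧ t ∈ filtFaces A n} :=
    (s.powerset.finite_toSet.subset fun t ht =>
      Finset.mem_coe.mpr (Finset.mem_powerset.mpr ht.1)).to_subtype
  refine isClosed_iUnion_of_finite fun t => ?_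
  exact (hZ t.1).isClosedEmbedding_subtypeVal.isClosedMap _ 
    ((hC t.1 t.2.2).preimage (hθ t.1 t.2.1))

theorem continuous_filt {Z : Type*} [TopologicalSpace Z] {f : filt A n → Z}
    (hf : ∀ (t : Finset V) (ht : t ∈ filtFaces A n), Continuous (f ∘ chiFilt ht)) :
    Continuous f :=
  continuous_iff_isClosed.mpr fun _ hC => isClosed_of_chiFilt fun t ht =>
    (hC.preimage (hf t ht))

/-- The product of the coherent topology with the interval is again coherent. By the exponential
law, `f` is viewed as a map into the space of paths in `Z`, whose continuity can be tested on
characteristic maps. -/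
theorem continuous_filt_prod {Z : Type*} [TopologicalSpace Z] {f : filt A n × unitInterval → Z}
    (hf : ∀ (t : Finset V) (ht : t ∈ filtFaces A n), Continuous
      fun z : ((G ⧸ MulAction.stabilizer G t) × closedSimplex t) × unitInterval =>
        f (chiFilt ht z.1, z.2)) :
    Continuous f := by
  have h0 : ∀ x, Continuous fun t : unitInterval => f (x, t) := fun x => by
    obtain ⟨t, ht, y, rfl⟩ := exists_chiFilt_eq x
    exact (hf t ht).comp (Continuous.prodMk_right y)
  let Φ : filt A n → C(unitInterval, Z) := fun x => ⟨fun t => f (x, t), h0 x⟩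
  have hΦ : Continuous Φ := continuous_filt fun t ht =>
    (ContinuousMap.curry ⟨_, hf t ht⟩).continuous
  exact ContinuousMap.continuous_uncurry_of_continuous ⟨Φ, hΦ⟩

end Filtration

end GComplex

namespace GComplex

variable {G V : Type u} [Group G] [MulAction G V] [DecidableEq V] {K : GComplex G V}

/-! ### The collar of `X_{p-1}` in `X_p` -/

section CellCoord

variable (A : K.Sub) (p : ℕ)

open Classical in
/-- The smallest barycentric coordinate on the `p`-simplices that are not in `A`, and `0` on
`filt A p`. -/
def cellCoord (x : V → ℝ) : ℝ :=
  if hx : ∃ t : Cells A p, x ∈ closedSimplex t.1 ∧ ∀ v ∈ t.1, x v ≠ 0 then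
    minCoord hx.choose.1 x else 0

variable {A p}

theorem filtFaces_succ {s : Finset V} (hs : s ∈ filtFaces A (p + 1)) :
    (∃ t : Cells A p, t.1 = s) ∨ s ∈ filtFaces A p := by
  by_cases hA : s ∈ A.faces
  · exact Or.inr ⟨hs.1, Or.inl hA⟩
  · rcases Nat.le_succ_iff.mp (hs.2.resolve_left hA) with h | h
    · exact Or.inr ⟨hs.1, Or.inr h⟩
    · exact Or.inl ⟨⟨s, hs.1, hA, h⟩, rfl⟩

theorem Cells.mem_filtFaces (t : Cells A p) : t.1 ∈ filtFaces A (p + 1) := ⟨t.2, Or.inr t.4.le⟩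

/-- A `p`-simplex whose coordinates at `x` are all nonzero is contained in every simplex containing
`x`, hence equals `t` by cardinality. If there is none, then `x` is in `∂t` and both sides are `0`.
-/
theorem cellCoord_of_cell (t : Cells A p) {x : V → ℝ} (hx : x ∈ closedSimplex t.1) :
    cellCoord A p x = minCoord t.1 x := by
  have huniq : ∀ t' : Cells A p, (x ∈ closedSimplex t'.1 ∧ ∀ v ∈ t'.1, x v ≠ 0) →
      t'.1 = t.1 := fun t' ht' =>
    Finset.eq_of_subset_of_card_le (support_subset ht'.2 hx) (t.4.trans t'.4.symm).le
  rw [cellCoord]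
  split_ifs with h
  · rw [huniq _ h.choose_spec]
  · by_contra hne
    refine h ⟨t, hx, fun v hv hxv => hne ?_⟩
    rw [minCoord_eq_zero hx hv hxv]

/-- A `p`-simplex outside `A` that supports `x` would be a face of `s`. This is impossible if `s` is
in `A`, which is closed under faces, and also if `s` has at most `p` vertices. -/
theorem cellCoord_of_filtFaces {s : Finset V} (hs : s ∈ filtFaces A p) {x : V → ℝ}
    (hx : x ∈ closedSimplex s) : cellCoord A p x = 0 := by
  rw [cellCoord]
  split_ifs with h
  · have h1 := support_subset h.choose_spec.2 hx
    exfalso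
    rcases hs.2 with h2 | h2
    · refine h.choose.3 ((A.isRelLowerSet_faces h2).2 h1 ?_)
      exact nonempty_of_mem_closedSimplex h.choose_spec.1
    · have h3 := Finset.card_le_card h1
      have h4 := h.choose.4
      omega
  · rfl

theorem cellCoord_smul {s : Finset V} (hs : s ∈ filtFaces A (p + 1)) {x : V → ℝ}
    (hx : x ∈ closedSimplex s) (g : G) :
    cellCoord A p (fun v => x (g⁻¹ • v)) = cellCoord A p x := by
  rcases filtFaces_succ hs with ⟨t, rfl⟩ | hs
  · rw [cellCoord_of_cell t hx, cellCoord_of_cell (g • t) (closedSimplex_smul hx g)]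
    exact minCoord_smul g t.1 x
  · rw [cellCoord_of_filtFaces hs hx,
      cellCoord_of_filtFaces (filtFaces_smul hs g) (closedSimplex_smul hx g)]

theorem pushOut_cellCoord_mem {s : Finset V} (hs : s ∈ filtFaces A (p + 1)) {x : V → ℝ}
    (hx : x ∈ closedSimplex s) {t : ℝ} (ht : t ∈ Set.Icc (0 : ℝ) 1) :
    pushOut (p + 1) (cellCoord A p x) t x ∈ closedSimplex s := by
  rcases filtFaces_succ hs with ⟨s, rfl⟩ | hs
  · rw [cellCoord_of_cell s hx, ← s.4]
    exact pushOut_mem ht hx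
  · rwa [cellCoord_of_filtFaces hs hx, pushOut_min_zero _ _ hx.1]

theorem cellCoord_pushOut_le {s : Finset V} (hs : s ∈ filtFaces A (p + 1)) {x : V → ℝ}
    (hx : x ∈ closedSimplex s) {t : ℝ} (ht : t ∈ Set.Icc (0 : ℝ) 1) :
    cellCoord A p (pushOut (p + 1) (cellCoord A p x) t x) ≤ cellCoord A p x := by
  have h1 := pushOut_cellCoord_mem hs hx ht
  rcases filtFaces_succ hs with ⟨s, rfl⟩ | hs
  · rw [cellCoord_of_cell s h1, cellCoord_of_cell s hx, ← s.4]
    exact minCoord_pushOut_le ht hx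
  · rw [cellCoord_of_filtFaces hs h1, cellCoord_of_filtFaces hs hx]

theorem pushOut_cellCoord_one_mem (s : Cells A p) {x : V → ℝ} (hx : x ∈ closedSimplex s.1)
    (hc : cellCoord A p x ≤ 1 / (2 * (p + 1 : ℕ))) :
    pushOut (p + 1) (cellCoord A p x) 1 x ∈ simplexBd s.1 := by
  rw [cellCoord_of_cell s hx, ← s.4] at hc ⊢
  exact pushOut_one_mem hx hc

theorem cellCoord_of_vertexOrder {s : Cells A p} (v : VertexOrder s) {x : V → ℝ}
    (hx : x ∈ closedSimplex (verts v.1)) : cellCoord A p x = minCoord (verts v.1) x := by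
  rw [v.2] at hx ⊢
  exact cellCoord_of_cell s hx

theorem smul_mem_closedSimplex_verts {r t : Cells A p} (v : VertexOrder r) {g : G}
    (hg : g • r = t) {x : V → ℝ} (hx : x ∈ closedSimplex t.1) :
    (fun u => x (g • u)) ∈ closedSimplex (verts v.1) := by
  have h1 := closedSimplex_smul hx g⁻¹
  rw [inv_inv, ← hg, show (g • r).1 = g • r.1 from rfl, inv_smul_smul] at h1
  rwa [v.2]

theorem exists_mem_erase {s : Finset V} {x : V → ℝ} (hx : x ∈ simplexBd s) :
    ∃ b ∈ s, x ∈ closedSimplex (s.erase b) := by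
  obtain ⟨hx, b, hb, hxb⟩ := hx
  refine ⟨b, hb, mem_closedSimplex_of_zeros (Finset.erase_subset _ _) hx fun v hv hv' => ?_⟩
  have : v = b := by
    by_contra hne
    exact hv' (Finset.mem_erase.mpr ⟨hne, hv⟩)
  rw [this, hxb]

theorem mem_filt_of_mem_bd (t : Cells A p) {x : K.Realization} (hx : x.1 ∈ simplexBd t.1) :
    x ∈ filt A p := by
  obtain ⟨b, hb, hxb⟩ := exists_mem_erase hx
  refine mem_filt.mpr ⟨t.1.erase b, ⟨(K.isRelLowerSet_faces t.2).2 (Finset.erase_subset _ _)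
    (nonempty_of_mem_closedSimplex hxb), Or.inr ?_⟩, hxb⟩
  rw [Finset.card_erase_of_mem hb, t.4]
  rfl

end CellCoord

variable [TopologicalSpace G] [IsTopologicalGroup G] [LocallyCompactSpace G]

/-- The deformation of `X_p` that pushes a neighbourhood of `X_{p-1}` to `X_{p-1}`. -/
def pushFilt (A : K.Sub) (p : ℕ) (z : filt A (p + 1) × unitInterval) : filt A (p + 1) :=
  ⟨⟨pushOut (p + 1) (cellCoord A p z.1.1.1) z.2 z.1.1.1, by
    obtain ⟨s, hs, hx⟩ := mem_filt.mp z.1.2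
    exact ⟨s, hs.1, pushOut_cellCoord_mem hs hx z.2.2⟩⟩, by
    obtain ⟨s, hs, hx⟩ := mem_filt.mp z.1.2
    exact mem_filt.mpr ⟨s, hs, pushOut_cellCoord_mem hs hx z.2.2⟩⟩

omit [TopologicalSpace G] [IsTopologicalGroup G] [LocallyCompactSpace G] in
theorem cellCoord_chi {A : K.Sub} {p : ℕ} {s : Finset V} (hs : s ∈ filtFaces A (p + 1))
    (H : Subgroup G) (hH : H ≤ MulAction.stabilizer G s) (y : (G ⧸ H) × closedSimplex s) :
    cellCoord A p (chi hs.1 H hH y).1 = cellCoord A p y.2.1 := by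
  obtain ⟨y, x⟩ := y
  induction y using Quotient.inductionOn with
  | h a => exact cellCoord_smul hs x.2 a

omit [TopologicalSpace G] [IsTopologicalGroup G] [LocallyCompactSpace G] in
theorem cellCoord_eq_zero {A : K.Sub} {p : ℕ} {x : K.Realization} (hx : x ∈ filt A p) :
    cellCoord A p x.1 = 0 := by
  obtain ⟨s, hs, hx⟩ := mem_filt.mp hx
  exact cellCoord_of_filtFaces hs hx

omit [TopologicalSpace G] [IsTopologicalGroup G] [LocallyCompactSpace G] in
theorem pushFilt_of_mem {A : K.Sub} {p : ℕ} {x : filt A (p + 1)} (hx : x.1 ∈ filt A p)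
    (t : unitInterval) : pushFilt A p (x, t) = x := by
  refine Subtype.ext (Subtype.ext ?_)
  change pushOut _ _ _ _ = _
  obtain ⟨s, hs, hxs⟩ := mem_filt.mp hx
  rw [cellCoord_eq_zero hx, pushOut_min_zero _ _ hxs.1]

omit [IsTopologicalGroup G] [LocallyCompactSpace G] in
-- The definition of the deformation by `cellCoord` is not cellwise, but on each `p`-simplex outside
-- `A` it agrees with the expansion of that simplex, and on all other simplices it is stationary.
theorem continuous_pushFilt (A : K.Sub) (p : ℕ) : Continuous (pushFilt A p) := by
  refine continuous_filt_prod fun s hs => ?_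
  rcases filtFaces_succ hs with ⟨s, rfl⟩ | hs'
  · let F : ((G ⧸ MulAction.stabilizer G s.1) × closedSimplex s.1) × unitInterval →
        (G ⧸ MulAction.stabilizer G s.1) × closedSimplex s.1 := fun z =>
      (z.1.1, ⟨pushOut s.1.card (minCoord s.1 z.1.2.1) z.2 z.1.2.1, pushOut_mem z.2.2 z.1.2.2⟩)
    have hF : Continuous F := by
      have h2 : Continuous fun z : ((G ⧸ MulAction.stabilizer G s.1) × closedSimplex s.1) ×
          unitInterval => z.1.2.1 := by fun_prop
      refine (continuous_fst.comp continuous_fst).prodMk (Continuous.subtype_mk ?_ _)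
      exact (continuousOn_pushOut s.1.card).comp_continuous
        (((continuous_minCoord _).comp h2).prodMk
          ((continuous_subtype_val.comp continuous_snd).prodMk h2)) fun z => z.2.2
    have h1 : (fun z : ((G ⧸ MulAction.stabilizer G s.1) × closedSimplex s.1) × unitInterval =>
        pushFilt A p (chiFilt hs z.1, z.2)) = chiFilt hs ∘ F := by
      funext ⟨⟨y, x⟩, t⟩
      induction y using Quotient.inductionOn with
      | h a =>
        refine Subtype.ext (Subtype.ext ?_)
        change pushOut (p + 1) (cellCoord A p fun v => x.1 (a⁻¹ • v)) t (fun v => x.1 (a⁻¹ • v)) =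
          fun v => pushOut s.1.card (minCoord s.1 x.1) t x.1 (a⁻¹ • v)
        rw [cellCoord_smul hs x.2, cellCoord_of_cell s x.2, s.4]
        rfl
    rw [h1]
    exact (continuous_chiFilt hs).comp hF
  · have h1 : (fun z : ((G ⧸ MulAction.stabilizer G s) × closedSimplex s) × unitInterval =>
        pushFilt A p (chiFilt hs z.1, z.2)) = chiFilt hs ∘ Prod.fst := by
      funext ⟨y, t⟩
      exact pushFilt_of_mem (chi_mem_filt hs' _ le_rfl y) t
    rw [h1]
    exact (continuous_chiFilt hs).comp continuous_fst

/-- The collar of `X_{p-1}` in `X_p`. -/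
def filtCollar (A : K.Sub) (p : ℕ) : Collar (relPair A p) (1 / (2 * (p + 1 : ℕ))) where
  c (x : filt A (p + 1)) := cellCoord A p x.1.1
  continuous_c := by
    refine continuous_filt fun s hs => ?_
    have h1 : (fun x : filt A (p + 1) => cellCoord A p x.1.1) ∘ chiFilt hs =
        fun y => cellCoord A p y.2.1 := funext fun y => cellCoord_chi hs _ le_rfl y
    rcases filtFaces_succ hs with ⟨s, rfl⟩ | hs'
    · rw [h1, show (fun y : (G ⧸ MulAction.stabilizer G s.1) × closedSimplex s.1 =>
        cellCoord A p y.2.1) = fun y => minCoord s.1 y.2.1 from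
        funext fun y => cellCoord_of_cell s y.2.2]
      exact (continuous_minCoord _).comp (continuous_subtype_val.comp continuous_snd)
    · rw [h1, show (fun y : (G ⧸ MulAction.stabilizer G s) × closedSimplex s =>
        cellCoord A p y.2.1) = fun y => 0 from
        funext fun y => cellCoord_of_filtFaces hs' y.2.2]
      exact continuous_const
  c_smul := fun g (x : filt A (p + 1)) => by
    obtain ⟨s, hs, hx⟩ := mem_filt.mp x.2
    exact cellCoord_smul hs hx g
  c_le := fun (x : filt A (p + 1)) hx => (cellCoord_eq_zero hx).trans_le (by positivity)
  F := pushFilt A p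
  continuous_F := continuous_pushFilt A p
  F_smul := fun g (x : filt A (p + 1)) t => by
    obtain ⟨s, hs, hx⟩ := mem_filt.mp x.2
    refine Subtype.ext (Subtype.ext ?_)
    change pushOut _ (cellCoord A p fun v => x.1.1 (g⁻¹ • v)) _ _ = _
    rw [cellCoord_smul hs hx]
    rfl
  F_zero := fun (x : filt A (p + 1)) => by
    obtain ⟨s, hs, hx⟩ := mem_filt.mp x.2
    exact Subtype.ext (Subtype.ext (pushOut_zero _ _ hx.1))
  F_mem := fun (x : filt A (p + 1)) hx t => by
    change (pushFilt A p ((x : filt A (p + 1)), t)).1 ∈ filt A p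
    rw [pushFilt_of_mem hx]
    exact hx
  F_le := fun (x : filt A (p + 1)) hx t => by
    obtain ⟨s, hs, hxs⟩ := mem_filt.mp x.2
    exact (cellCoord_pushOut_le hs hxs t.2).trans hx
  F_one := fun (x : filt A (p + 1)) hx => by
    obtain ⟨s, hs, hxs⟩ := mem_filt.mp x.2
    rcases filtFaces_succ hs with ⟨s, rfl⟩ | hs
    · exact mem_filt_of_mem_bd (x := (pushFilt A p (x, 1)).1) s
        (pushOut_cellCoord_one_mem s hxs hx)
    · have h1 := mem_filt.mpr ⟨s, hs, hxs⟩
      change (pushFilt A p ((x : filt A (p + 1)), 1)).1 ∈ filt A p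
      rw [pushFilt_of_mem h1]
      exact h1

/-! ### Decomposition of the homology of `(X_p, X_{p-1})` over orbit representatives -/

section Decomposition

variable {A : K.Sub} {p : ℕ}

/-- All coordinates at the vertices of `r` are nonzero, so `b⁻¹a` carries `r` into `r'`, and onto it
by cardinality. Uniqueness of representatives gives `r = r'`. Then `b⁻¹a` stabilizes `r`, hence
fixes its points, so the two cosets and the two points of the simplex agree. -/
theorem chiHom_injective_on_core (T : OrbitReps A) {r r' : Cells A p} (hr : r ∈ T.T p)
    (hr' : r' ∈ T.T p) (v : VertexOrder r) (v' : VertexOrder r')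
    (y : cellSub (MulAction.stabilizer G r) (closedSimplex (verts v.1)))
    (y' : cellSub (MulAction.stabilizer G r') (closedSimplex (verts v'.1)))
    (hy : 0 < minCoord (verts v.1) y.1.2) (hy' : 0 < minCoord (verts v'.1) y'.1.2)
    (hyy' : (show filt A (p + 1) from (chiHom r v).toFun y) = (chiHom r' v').toFun y') :
    ∃ _ : r = r', y.1.1 ≍ y'.1.1 ∧ y.1.2 = y'.1.2 := by
  obtain ⟨⟨y, x⟩, hx⟩ := y
  obtain ⟨⟨y', x'⟩, hx'⟩ := y'
  induction y using Quotient.inductionOn with | h a => ?_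
  induction y' using Quotient.inductionOn with | h b => ?_
  have h1 : ∀ u, x (a⁻¹ • u) = x' (b⁻¹ • u) := fun u =>
    congrFun (congrArg (fun z : filt A (p + 1) => z.1.1) hyy') u
  have hxr : x ∈ closedSimplex r.1 := v.2 ▸ hx
  have hxr' : x' ∈ closedSimplex r'.1 := v'.2 ▸ hx'
  have hsub : ∀ u ∈ r.1, b⁻¹ • a • u ∈ r'.1 := fun u hu => by
    by_contra hne
    have h2 := h1 (a • u)
    rw [inv_smul_smul, hxr'.2.1 _ hne] at h2
    have h3 : minCoord (verts v.1) x ≤ x u := minCoord_le (v.2.symm.subset hu)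
    have h4 : 0 < minCoord (verts v.1) x := hy
    linarith
  have h2 : (b⁻¹ * a) • r = r' := by
    refine Cells.ext (Finset.eq_of_subset_of_card_le ?_ ?_)
    · intro u hu
      obtain ⟨u', hu', rfl⟩ :=
        Finset.mem_smul_finset.mp (show u ∈ (b⁻¹ * a) • r.1 from hu)
      rw [mul_smul]
      exact hsub u' hu'
    · rw [r'.4, ((b⁻¹ * a) • r).4]
  have h3 : r = r' := (T.exists_unique p r').unique ⟨hr, b⁻¹ * a, h2⟩
    ⟨hr', MulAction.mem_orbit_self _⟩
  subst h3
  refine ⟨rfl, heq_of_eq ?_, ?_⟩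
  · refine (QuotientGroup.eq.mpr ?_).symm
    exact MulAction.mem_stabilizer_iff.mpr h2
  · funext u
    have h4 := h1 (a • u)
    rw [inv_smul_smul] at h4
    have h5 := apply_inv_smul r.2 (g := (b⁻¹ * a)⁻¹) (by
      rw [inv_smul_eq_iff]
      exact (congrArg Cells.vertices h2).symm) hxr' u
    rw [inv_inv, mul_smul] at h5
    exact h4.trans h5

theorem cellCoord_chiHom {s : Cells A p} (v : VertexOrder s)
    (y : cellSub (MulAction.stabilizer G s) (closedSimplex (verts v.1))) :
    cellCoord A p (show filt A (p + 1) from (chiHom s v).toFun y).1.1 =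
      minCoord (verts v.1) y.1.2 := by
  have h1 := cellCoord_chi (A := A) (p := p) (s := verts v.1)
    (v.2.symm ▸ Cells.mem_filtFaces s) (MulAction.stabilizer G s) (stabilizer_le_verts v)
    (y.1.1, ⟨y.1.2, y.2⟩)
  exact h1.trans (cellCoord_of_vertexOrder v y.2)

/-- The map `G ⧸ G_t × t → G ⧸ G_r × r`, `(aG_t, x) ↦ (agG_r, g⁻¹x)`, where `t = gr`. -/
def transport {r t : Cells A p} (v : VertexOrder r) {g : G} (hg : g • r = t)
    (y : (G ⧸ MulAction.stabilizer G t.1) × closedSimplex t.1) :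
    (simplexPair (MulAction.stabilizer G r) v.1).X :=
  (⟨(((orbitSpace G).map (cosetMap (MulAction.stabilizer G t.1) (MulAction.stabilizer G r) g
    (by
      intro a ha
      rw [MulAction.mem_stabilizer_iff] at ha ⊢
      have ha' : a • t = t := Cells.ext ha
      rw [mul_smul, mul_smul, hg, ha', ← hg, inv_smul_smul]))).toFun y.1,
    fun u => y.2.1 (g • u)), by
    exact smul_mem_closedSimplex_verts v hg y.2.2⟩ : cellSub (MulAction.stabilizer G r) (closedSimplex (verts v.1)))

omit [LocallyCompactSpace G] in
theorem continuous_transport {r t : Cells A p} (v : VertexOrder r) {g : G} (hg : g • r = t) :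
    Continuous (transport v hg) := by
  refine Continuous.subtype_mk ?_ _
  refine (((orbitSpace G).map _).continuous_toFun.comp continuous_fst).prodMk ?_
  exact continuous_pi fun u => (continuous_apply (g • u)).comp
    (continuous_subtype_val.comp continuous_snd)

/-- The characteristic map of any cell factors through that of the representative of its orbit, so
the representatives suffice both to cover `X_p` and to test closedness. -/
theorem chiHom_transport {r t : Cells A p} (v : VertexOrder r) {g : G} (hg : g • r = t)
    (y : (G ⧸ MulAction.stabilizer G t.1) × closedSimplex t.1) :
    (show filt A (p + 1) from (chiHom r v).toFun (transport v hg y)) =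
      chiFilt (Cells.mem_filtFaces t) y := by
  obtain ⟨y, x⟩ := y
  induction y using Quotient.inductionOn with | h a => ?_
  refine Subtype.ext (Subtype.ext (funext fun u => ?_))
  change x.1 (g • (a * g)⁻¹ • u) = x.1 (a⁻¹ • u)
  rw [mul_inv_rev, mul_smul, smul_inv_smul]

variable {R : Type v} [Ring R] (h : HomologyTheory.{u, v, w} G R)

open Classical in
theorem sum_chiHom_bijective (ord : Orders A) (T : OrbitReps A) (n : ℤ)
    (hsum : ∀ Q : T.T p → GPair G, Function.Bijective (DirectSum.toModule R (T.T p)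
      ((h.H n).obj (GPair.sigma Q)) (fun i => h.ml n (GPair.sigmaIncl Q i)))) :
    Function.Bijective (DirectSum.toModule R (T.T p) ((h.H n).obj (relPair A p))
      fun r => h.ml n (chiHom r.1 (ord p r.1))) := by
  -- All cells have `p + 1` vertices, so one `δ` serves for their collars and for that of `X_{p-1}`.
  have hδ : (0 : ℝ) < 1 / (2 * (p + 1 : ℕ)) := by positivity
  refine (filtCollar A p).sum_bijective h hδ
    (fun r : T.T p => cellCollar (MulAction.stabilizer G r.1) (ord p r.1).1 (by simp)) _
    (fun r y => cellCoord_chiHom _ y) ?_ ?_ ?_ n hsum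
  · rintro ⟨r, hr⟩ ⟨r', hr'⟩ y y' hy hy' hyy'
    obtain ⟨h1, h2, h3⟩ := chiHom_injective_on_core T hr hr' (ord p r) (ord p r') y y'
      ((half_pos hδ).trans_le hy) ((half_pos hδ).trans_le hy') hyy'
    subst h1
    obtain rfl : y = y' := Subtype.ext (Prod.ext (eq_of_heq h2) h3)
    rfl
  · intro (y : filt A (p + 1)) hy
    have hy' : 0 < cellCoord A p y.1.1 := (half_pos hδ).trans_le hy
    obtain ⟨s, hs, y, rfl⟩ := exists_chiFilt_eq y
    rcases filtFaces_succ hs with ⟨t, rfl⟩ | hs'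
    · obtain ⟨g, hg⟩ := T.exists_smul_rep t
      exact ⟨⟨T.rep t, (T.exists_unique p t).choose_spec.1.1⟩, _, chiHom_transport _ hg y⟩
    · exact (hy'.ne' (cellCoord_eq_zero (chi_mem_filt hs' _ le_rfl y))).elim
  · intro S hS hSc
    refine isClosed_of_chiFilt fun s hs => ?_
    rcases filtFaces_succ hs with ⟨t, rfl⟩ | hs'
    · obtain ⟨g, hg⟩ := T.exists_smul_rep t
      let r : T.T p := ⟨T.rep t, (T.exists_unique p t).choose_spec.1.1⟩
      -- Points of the sets `S` have positive smallest coordinate, so only the representative of the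
      -- orbit of `t` contributes, and it does so through `transport`.
      have h1 : chiFilt hs ⁻¹' (⋃ r : T.T p, (chiHom r.1 (ord p r.1)).toFun '' S r) =
          transport (ord p (T.rep t)) hg ⁻¹' S r := by
        ext y
        have h2 := chiHom_transport (ord p (T.rep t)) hg y
        constructor
        · intro hy
          obtain ⟨⟨r', hr'⟩, z, hz, hzy⟩ := Set.mem_iUnion.mp hy
          have h3 := hSc _ z hz
          have h4 := h2.trans hzy.symm
          have h5 : minCoord (verts (ord p (T.rep t)).1)
              (show cellSub _ _ from transport (ord p (T.rep t)) hg y).1.2 =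
              minCoord (verts (ord p r').1) (show cellSub _ _ from z).1.2 := by
            rw [← cellCoord_chiHom, ← cellCoord_chiHom]
            exact congrArg (fun z : filt A (p + 1) => cellCoord A p z.1.1) h4
          have h6 := (half_pos hδ).trans_le h3
          obtain ⟨h7, h8, h9⟩ := chiHom_injective_on_core T r.2 hr' (ord p (T.rep t)) (ord p r')
            (transport (ord p (T.rep t)) hg y) z (h6.trans_eq h5.symm) h6 h4
          subst h7
          obtain rfl : transport (ord p (T.rep t)) hg y = z :=
            Subtype.ext (Prod.ext (eq_of_heq h8) h9)
          exact hz
        · intro hy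
          exact Set.mem_iUnion.mpr ⟨r, _, hy, h2⟩
      exact h1 ▸ (hS r).preimage (continuous_transport _ hg)
    -- On a simplex of `X_{p-1}` the function `cellCoord` is `0`, whereas it is at least `δ / 2` on
    -- the images of the sets `S`.
    · have h1 : chiFilt hs ⁻¹' (⋃ r : T.T p, (chiHom r.1 (ord p r.1)).toFun '' S r) = ∅ := by
        refine Set.eq_empty_iff_forall_notMem.mpr fun y hy => ?_
        obtain ⟨r', z, hz, hzy⟩ := Set.mem_iUnion.mp hy
        have h6 := (half_pos hδ).trans_le (hSc _ z hz)
        have h7 : cellCoord A p (chiFilt hs y).1.1 = 0 :=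
          cellCoord_eq_zero (chi_mem_filt hs' _ le_rfl y)
        have h8 := cellCoord_chiHom (ord p r'.1) z
        have h9 := congrArg (fun z : filt A (p + 1) => cellCoord A p z.1.1) hzy
        exact h6.ne' (h8.symm.trans (h9.trans h7))
      exact h1 ▸ isClosed_empty

end Decomposition

end GComplex

/-! ### Signs of vertex orderings -/

section OrderSigns

variable {V : Type u} [DecidableEq V] {n : ℕ}

theorem orderSign_eq {v v' : Fin n ↪ V} {τ : Equiv.Perm (Fin n)} (hτ : ∀ i, v i = v' (τ i)) :
    GComplex.orderSign v v' = Equiv.Perm.sign τ := by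
  have h1 : ∃ τ : Equiv.Perm (Fin n), ∀ i, v i = v' (τ i) := ⟨τ, hτ⟩
  rw [GComplex.orderSign, dif_pos h1]
  congr 1
  exact Equiv.ext fun i => v'.injective ((h1.choose_spec i).symm.trans (hτ i))

omit [DecidableEq V] in
theorem exists_perm_of_verts_eq {v v' : Fin n ↪ V} (hv : verts v = verts v') :
    ∃ τ : Equiv.Perm (Fin n), ∀ i, v i = v' (τ i) := by
  have h1 : ∀ i, ∃ j, v' j = v i := fun i => mem_verts.mp (hv ▸ apply_mem_verts v i)
  choose f hf using h1
  have hinj : Function.Injective f := fun i j hij => v.injective (by rw [← hf, ← hf, hij])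
  exact ⟨Equiv.ofBijective f (Finite.injective_iff_bijective.mp hinj), fun i => (hf i).symm⟩

theorem orderSign_self (v : Fin n ↪ V) : GComplex.orderSign v v = 1 := by
  rw [orderSign_eq (τ := 1) fun i => rfl, map_one]

theorem orderSign_mul {v v' v'' : Fin n ↪ V} (h1 : verts v = verts v') (h2 : verts v' = verts v'') :
    GComplex.orderSign v v' * GComplex.orderSign v' v'' = GComplex.orderSign v v'' := by
  obtain ⟨τ, hτ⟩ := exists_perm_of_verts_eq h1
  obtain ⟨σ, hσ⟩ := exists_perm_of_verts_eq h2
  rw [orderSign_eq hτ, orderSign_eq hσ, orderSign_eq (τ := σ * τ) fun i => by rw [hτ, hσ]; rfl,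
    map_mul, mul_comm]

theorem orderSign_symm {v v' : Fin n ↪ V} (h1 : verts v = verts v') :
    GComplex.orderSign v v' = GComplex.orderSign v' v := by
  have h2 := orderSign_mul h1 h1.symm
  rw [orderSign_self] at h2
  rw [eq_inv_of_mul_eq_one_left h2, Int.units_inv_eq_self]

end OrderSigns

namespace GComplex

variable {G V : Type u} [Group G] [MulAction G V] [DecidableEq V] {K : GComplex G V} {A : K.Sub}
  {p : ℕ}

theorem verts_smulOrder {n : ℕ} (g : G) (v : Fin n ↪ V) : verts (smulOrder g v) = g • verts v := by
  ext a
  rw [mem_verts, Finset.mem_smul_finset]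
  constructor
  · rintro ⟨i, rfl⟩
    exact ⟨v i, apply_mem_verts v i, rfl⟩
  · rintro ⟨b, hb, rfl⟩
    obtain ⟨i, rfl⟩ := mem_verts.mp hb
    exact ⟨i, rfl⟩

theorem orderSign_smulOrder {n : ℕ} (g : G) {v v' : Fin n ↪ V} (h1 : verts v = verts v') :
    orderSign (smulOrder g v) (smulOrder g v') = orderSign v v' := by
  obtain ⟨τ, hτ⟩ := exists_perm_of_verts_eq h1
  rw [orderSign_eq hτ, orderSign_eq (τ := τ) fun i => congrArg (g • ·) (hτ i)]

/-- The ordering of `gs` induced by an ordering of `s`. -/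
def smulVertexOrder (g : G) {s : Cells A p} (v : VertexOrder s) : VertexOrder (g • s) :=
  ⟨smulOrder g v.1, by rw [verts_smulOrder, v.2]; rfl⟩

/-- Two group elements carrying `r` to `t` differ by an element stabilizing `r`, which fixes the
vertices of `r`; so the choice made in `refOrder` is immaterial. -/
theorem refOrder_eq (ord : Orders A) (T : OrbitReps A) {r t : Cells A p} (hr : r ∈ T.T p) {g : G}
    (hg : g • r = t) : refOrder ord T t = smulOrder g (ord p r).1 := by
  have h1 : ∀ (r' : Cells A p) (g' : G), r' = r → g' • r' = t →
      smulOrder g' (ord p r').1 = smulOrder g (ord p r).1 := by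
    rintro r' g' rfl hg'
    refine DFunLike.ext _ _ fun i => ?_
    change g' • (ord p r').1 i = g • (ord p r').1 i
    have h2 : (g⁻¹ * g') • r' = r' := by rw [mul_smul, hg', ← hg, inv_smul_smul]
    have h3 := K.smul_vertex r'.1 r'.2 _ (congrArg Cells.vertices h2) ((ord p r').1 i)
      ((ord p r').2.subset (apply_mem_verts _ i))
    rwa [mul_smul, inv_smul_eq_iff] at h3
  exact h1 _ _ ((T.exists_unique p t).unique (T.exists_unique p t).choose_spec.1
    ⟨hr, ⟨g, hg⟩⟩) (T.exists_smul_rep t).choose_spec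

theorem refOrder_rep (ord : Orders A) (T : OrbitReps A) {r : Cells A p} (hr : r ∈ T.T p) :
    refOrder ord T r = (ord p r).1 := by
  rw [refOrder_eq ord T hr (one_smul G r)]
  exact DFunLike.ext _ _ fun i => one_smul G _

theorem exists_rep (T : OrbitReps A) (t : Cells A p) : ∃ r ∈ T.T p, ∃ g : G, g • r = t :=
  ⟨T.rep t, (T.exists_unique p t).choose_spec.1.1, T.exists_smul_rep t⟩

/-- In contrast to the preferred orders, the transported ones are equivariant on the nose. This is
what makes `α` well defined without signs. -/
theorem refOrder_smul (ord : Orders A) (T : OrbitReps A) (g : G) (t : Cells A p) :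
    refOrder ord T (g • t) = smulOrder g (refOrder ord T t) := by
  obtain ⟨r, hr, a, rfl⟩ := exists_rep T t
  rw [refOrder_eq ord T hr rfl, refOrder_eq ord T hr (mul_smul g a r)]
  exact DFunLike.ext _ _ fun i => mul_smul g a _

theorem verts_refOrder (ord : Orders A) (T : OrbitReps A) (t : Cells A p) :
    verts (refOrder ord T t) = t.1 := by
  rw [refOrder, verts_smulOrder, (ord p (T.rep t)).2]
  exact congrArg Cells.vertices (T.exists_smul_rep t).choose_spec

/-- The ordering transported from the representative of the orbit. -/
def refVertexOrder (ord : Orders A) (T : OrbitReps A) (t : Cells A p) : VertexOrder t :=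
  ⟨refOrder ord T t, verts_refOrder ord T t⟩

theorem orderSign_refOrder (ord : Orders A) (T : OrbitReps A)
    (hsign : ∀ (p : ℕ) (g : G) (s : Cells A p), simplexSign ord g s = 1) (t : Cells A p) :
    orderSign (refOrder ord T t) (ord p t).1 = 1 := by
  obtain ⟨r, hr, g, rfl⟩ := exists_rep T t
  rw [refOrder_eq ord T hr rfl]
  exact hsign p g r

variable [TopologicalSpace G] [IsTopologicalGroup G] [LocallyCompactSpace G]

/-- The restriction of a characteristic map to subspaces of a simplex. -/
def chiSub {s : Finset V} (hs : s ∈ K.faces) {H : Subgroup G} (hH : H ≤ MulAction.stabilizer G s)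
    {B C : Set (V → ℝ)} (hBs : B ⊆ closedSimplex s) {F F' : SubMulAction G K.Realization}
    (hF : ∀ (x : V → ℝ) (hx : x ∈ closedSimplex s), x ∈ B → (⟨x, s, hs, hx⟩ : K.Realization) ∈ F)
    (hF' : ∀ (x : V → ℝ) (hx : x ∈ closedSimplex s), x ∈ C →
      (⟨x, s, hs, hx⟩ : K.Realization) ∈ F') : cellPair H B C ⟶ GPair.of F F' where
  toFun y := (⟨chi hs H hH (y.1.1, ⟨y.1.2, hBs y.2⟩), by
    obtain ⟨⟨y, x⟩, hx⟩ := y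
    induction y using Quotient.inductionOn with
    | h a => exact F.smul_mem a (hF x (hBs hx) hx)⟩ : F)
  continuous_toFun := by
    refine Continuous.subtype_mk ?_ _
    refine (continuous_chi hs H hH).comp ?_
    have h1 : Continuous fun y : cellSub H B => (y.1 : (G ⧸ H) × (V → ℝ)) :=
      continuous_subtype_val
    exact (continuous_fst.comp h1).prodMk (Continuous.subtype_mk (continuous_snd.comp h1) _)
  map_smul g y := Subtype.ext (chi_smul hs H hH g (y.1.1, ⟨y.1.2, hBs y.2⟩))
  map_mem y hy := by
    obtain ⟨⟨y, x⟩, hx⟩ := y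
    induction y using Quotient.inductionOn with
    | h a => exact F'.smul_mem a (hF' x (hBs hx) hy)

variable {R : Type v} [Ring R] (h : HomologyTheory.{u, v, w} G R)

/-- The homomorphism `𝔥_q(G ⧸ G_t) → 𝔥_{p+q}(X_p, X_{p-1})` of an ordered simplex `t`. -/
def cellHom {t : Cells A p} (v : VertexOrder t) (q : ℤ) :
    (h.coeff q).obj ⟨MulAction.stabilizer G t⟩ →ₗ[R] (h.H (p + q)).obj (relPair A p) :=
  h.ml (p + q) (chiHom t v) ∘ₗ
    linInv (h.zeta (MulAction.stabilizer G t) v.1 (p + q) q (add_comm q p))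

theorem cellHom_eq {t : Cells A p} (v : VertexOrder t) (q : ℤ)
    {x : (h.coeff q).obj ⟨MulAction.stabilizer G t⟩}
    {y : (h.H (p + q)).obj (simplexPair (MulAction.stabilizer G t) v.1)}
    (hy : h.zeta (MulAction.stabilizer G t) v.1 (p + q) q (add_comm q p) y = x) :
    cellHom h v q x = h.ml (p + q) (chiHom t v) y := by
  rw [← hy]
  exact congrArg _ (linInv_apply (h.zeta_bijective _ _ _ _ _) y)

omit [LocallyCompactSpace G] in
theorem exists_zeta_eq {t : Cells A p} (v : VertexOrder t) (q : ℤ)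
    (x : (h.coeff q).obj ⟨MulAction.stabilizer G t⟩) :
    ∃ y, h.zeta (MulAction.stabilizer G t) v.1 (p + q) q (add_comm q p) y = x :=
  (h.zeta_bijective _ _ _ _ _).2 x

/-- The alternating behaviour of `ζ` passes to its inverse, since a sign is its own inverse. -/
theorem cellHom_orderSign {t : Cells A p} (v v' : VertexOrder t) (q : ℤ)
    (x : (h.coeff q).obj ⟨MulAction.stabilizer G t⟩) :
    cellHom h v q x = orderSign v.1 v'.1 • cellHom h v' q x := by
  obtain ⟨τ, hτ⟩ := exists_perm_of_verts_eq (v.2.trans v'.2.symm)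
  obtain ⟨y, rfl⟩ := exists_zeta_eq h v' q x
  obtain ⟨hB, hA⟩ := incl_hyps (H := MulAction.stabilizer G t) (verts_eq_of_perm hτ)
  have h1 := h.zeta_perm (MulAction.stabilizer G t) τ v'.1 v.1 hτ (p + q) q (add_comm q p) hB hA y
  have h2 : chiHom t v' = GPair.incl hB hA ≫ chiHom t v := rfl
  rw [cellHom_eq h v' q rfl, orderSign_eq hτ, h2, h.ml_comp, ← cellHom_eq h v q rfl, h1, map_zsmul,
    Units.smul_def, smul_smul]
  rw [← Units.val_mul, Int.units_mul_self, Units.val_one, one_smul]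

/-- The map `χ_{gt}` is `χ_t` composed with `μ_g` on the orbit and `g⁻¹` on the simplex, so
`zeta_relabel` applies. The result is precisely compatibility with the relations that define the
coefficient module of a `G`-set. -/
theorem cellHom_smul {t : Cells A p} (v : VertexOrder t) (g : G) (q : ℤ)
    (x : (h.coeff q).obj ⟨MulAction.stabilizer G (g • t)⟩) :
    cellHom h (smulVertexOrder g v) q x = cellHom h v q (((h.coeff q).map (mu g t)).hom x) := by
  obtain ⟨y, rfl⟩ := exists_zeta_eq h (smulVertexOrder g v) q x
  have hvw : ∀ a, a ∈ verts v.1 ↔ MulAction.toPerm g a ∈ verts (smulVertexOrder g v).1 := by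
    intro a
    change _ ↔ g • a ∈ verts (smulOrder g v.1)
    rw [verts_smulOrder, Finset.smul_mem_smul_finset_iff]
  have h1 := h.zeta_relabel (mu g t) (MulAction.toPerm g) (smulVertexOrder g v).1 v.1
    (fun i => rfl) (p + q) q (add_comm q p) (fun x hx => comp_mem_closedSimplex hvw hx)
    (fun x hx => comp_mem_simplexBd hvw hx) y
  rw [cellHom_eq h _ q rfl, cellHom_eq h v q h1, ← h.ml_comp]
  congr 2
  refine GPair.hom_ext fun y => ?_
  obtain ⟨⟨y, x⟩, hx⟩ := y
  induction y using Quotient.inductionOn with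
  | h a =>
    refine Subtype.ext (Subtype.ext (funext fun u => ?_))
    change x (a⁻¹ • u) = x (g • (a * g)⁻¹ • u)
    rw [mul_inv_rev, mul_smul, smul_inv_smul]

theorem cellHom_congr {t : Cells A p} {v v' : VertexOrder t} (hv : v.1 = v'.1) (q : ℤ) :
    cellHom h v q = cellHom h v' q := by
  rw [Subtype.ext hv]

/-! ### The isomorphism `α` -/

section Alpha

variable (ord : Orders A) (T : OrbitReps A) (p) (q : ℤ)

omit [TopologicalSpace G] [IsTopologicalGroup G] [LocallyCompactSpace G] in
theorem gen_smul (M : OrbitCat G ⥤ ModuleCat.{w} R) {S : Type u} [MulAction G S] (g : G) (s : S)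
    (x : M.obj ⟨MulAction.stabilizer G (g • s)⟩) :
    gen M (g • s) x = gen M s ((M.map (mu g s)).hom x) :=
  (Submodule.Quotient.eq _).mpr (Submodule.subset_span ⟨g, s, x, rfl⟩)

open Classical in
/-- The homomorphism `α`. -/
def alphaHom : GSetModule (h.coeff q) (Cells A p) →ₗ[R] (h.H (p + q)).obj (relPair A p) :=
  (orbitRel (h.coeff q) (Cells A p)).liftQ
    (DirectSum.toModule R (Cells A p) _ fun t => cellHom h (refVertexOrder ord T t) q) (by
      refine Submodule.span_le.mpr ?_
      rintro _ ⟨g, s, x, rfl⟩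
      refine LinearMap.mem_ker.mpr ?_
      rw [map_sub, DirectSum.toModule_lof, DirectSum.toModule_lof, ← cellHom_smul, sub_eq_zero]
      exact LinearMap.congr_fun (cellHom_congr h (refOrder_smul ord T g s) q) x)

theorem alphaHom_gen (t : Cells A p) (x : (h.coeff q).obj ⟨MulAction.stabilizer G t⟩) :
    alphaHom p h ord T q (gen (h.coeff q) t x) = cellHom h (refVertexOrder ord T t) q x := by
  classical
  refine (Submodule.liftQ_apply _ _ _).trans ?_
  exact DirectSum.toModule_lof R (M := fun t : Cells A p =>
    (h.coeff q).obj ⟨MulAction.stabilizer G t⟩) t x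

open Classical in
-- The summands of the representatives generate the module by the relations, so `β` is surjective.
-- The composite of `α` with `β` is the decomposition of `𝔥(X_p, X_{p-1})` preceded by the
-- isomorphisms `ζ⁻¹`, hence bijective. Together these force `α` to be bijective.
theorem alphaHom_bijective (hsum : ∀ Q : T.T p → GPair G, Function.Bijective
    (DirectSum.toModule R (T.T p) ((h.H (p + q)).obj (GPair.sigma Q))
      (fun i => h.ml (p + q) (GPair.sigmaIncl Q i)))) :
    Function.Bijective (alphaHom p h ord T q) := by
  let M : T.T p → Type w := fun r => (h.coeff q).obj ⟨MulAction.stabilizer G r.1⟩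
  let β : (⨁ r : T.T p, M r) →ₗ[R] GSetModule (h.coeff q) (Cells A p) :=
    DirectSum.toModule R (T.T p) _ fun r => (orbitRel (h.coeff q) (Cells A p)).mkQ ∘ₗ
      DirectSum.lof R (Cells A p)
        (fun t : Cells A p => (h.coeff q).obj ⟨MulAction.stabilizer G t⟩) r.1
  have hβ : ∀ (r : T.T p) (x : M r), β (DirectSum.lof R _ M r x) = gen (h.coeff q) r.1 x :=
    fun r x => DirectSum.toModule_lof R (M := M) r x
  have h1 : alphaHom p h ord T q ∘ₗ β = DirectSum.toModule R (T.T p) _ fun r =>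
      h.ml (p + q) (chiHom r.1 (ord p r.1)) ∘ₗ
        linInv (h.zeta (MulAction.stabilizer G r.1) (ord p r.1).1 (p + q) q (add_comm q p)) := by
    refine DirectSum.linearMap_ext R fun r => LinearMap.ext fun x => ?_
    rw [LinearMap.comp_apply, LinearMap.comp_apply, hβ, alphaHom_gen, LinearMap.comp_apply,
      DirectSum.toModule_lof]
    exact LinearMap.congr_fun (cellHom_congr h (refOrder_rep ord T r.2) q) x
  have h2 : Function.Bijective (alphaHom p h ord T q ∘ₗ β) := by
    rw [h1, toModule_comp_bijective_iff (fun r : T.T p =>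
      linInv (h.zeta (MulAction.stabilizer G r.1) (ord p r.1).1 (p + q) q (add_comm q p)))
      (fun r => linInv_bijective (h.zeta_bijective _ _ _ _ _))]
    exact sum_chiHom_bijective h ord T (p + q) hsum
  have h3 : Function.Surjective β := by
    intro z
    obtain ⟨z, rfl⟩ := Submodule.mkQ_surjective _ z
    induction z using DirectSum.induction_on with
    | zero => exact ⟨0, by rw [map_zero, map_zero]⟩
    | of t x =>
      obtain ⟨r, hr, g, rfl⟩ := exists_rep T t
      exact ⟨DirectSum.lof R _ M ⟨r, hr⟩ (((h.coeff q).map (mu g r)).hom x),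
        (hβ ⟨r, hr⟩ _).trans (gen_smul (h.coeff q) g r x).symm⟩
    | add z z' hz hz' =>
      obtain ⟨y, hy⟩ := hz
      obtain ⟨y', hy'⟩ := hz'
      exact ⟨y + y', by rw [map_add, map_add, hy, hy']⟩
  rw [LinearMap.coe_comp] at h2
  refine ⟨fun a b hab => ?_, h2.2.of_comp⟩
  obtain ⟨a, rfl⟩ := h3 a
  obtain ⟨b, rfl⟩ := h3 b
  rw [h2.1 hab]

end Alpha

/-! ### The boundary map in terms of `α` -/

section Boundary

variable {t : Cells A (p + 1)} (v : VertexOrder t) (k : Fin (p + 2))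

omit [TopologicalSpace G] [IsTopologicalGroup G] [LocallyCompactSpace G] in
theorem mem_filt_of_mem_closedSimplex {n : ℕ} {s r : Finset V} (hs : s ∈ K.faces) (hrs : r ⊆ s)
    (hr : r.card ≤ n) {x : V → ℝ} (hx : x ∈ closedSimplex s) (hxr : x ∈ closedSimplex r) :
    (⟨x, s, hs, hx⟩ : K.Realization) ∈ filt A n :=
  mem_filt.mpr ⟨r, ⟨(K.isRelLowerSet_faces hs).2 hrs (nonempty_of_mem_closedSimplex hxr),
    Or.inr hr⟩, hxr⟩

omit [TopologicalSpace G] [IsTopologicalGroup G] [LocallyCompactSpace G] in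
theorem mem_filt_of_mem_simplexBd {n : ℕ} {s : Finset V} (hs : s ∈ K.faces) (hn : s.card ≤ n + 1)
    {x : V → ℝ} (hx : x ∈ closedSimplex s) (hxs : x ∈ simplexBd s) :
    (⟨x, s, hs, hx⟩ : K.Realization) ∈ filt A n := by
  obtain ⟨b, hb, hxb⟩ := exists_mem_erase hxs
  refine mem_filt_of_mem_closedSimplex hs (Finset.erase_subset b s) ?_ hx hxb
  rw [Finset.card_erase_of_mem hb]
  omega

omit [TopologicalSpace G] [IsTopologicalGroup G] [LocallyCompactSpace G] in
theorem mem_filt_of_mem_simplexSk {n : ℕ} {s : Finset V} (hs : s ∈ K.faces) (hn : s.card ≤ n + 2)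
    {x : V → ℝ} (hx : x ∈ closedSimplex s) (hxs : x ∈ simplexSk s) :
    (⟨x, s, hs, hx⟩ : K.Realization) ∈ filt A n := by
  obtain ⟨_, a, ha, b, hb, hab, hxa, hxb⟩ := hxs
  have hba : b ∈ s.erase a := Finset.mem_erase.mpr ⟨hab.symm, hb⟩
  refine mem_filt_of_mem_closedSimplex hs
    ((Finset.erase_subset b _).trans (Finset.erase_subset a s)) ?_ hx
    (mem_closedSimplex_of_zeros ((Finset.erase_subset b _).trans (Finset.erase_subset a s)) hx ?_)
  · rw [Finset.card_erase_of_mem hba, Finset.card_erase_of_mem ha]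
    omega
  · intro u hu hu'
    by_cases hub : u = b
    · rw [hub, hxb]
    · by_cases hua : u = a
      · rw [hua, hxa]
      · exact (hu' (Finset.mem_erase.mpr ⟨hub, Finset.mem_erase.mpr ⟨hua, hu⟩⟩)).elim

omit [DecidableEq V] in
theorem card_verts_le {n m : ℕ} (v : Fin n ↪ V) (hnm : n ≤ m) : (verts v).card ≤ m := by
  simpa using hnm

/-- The restriction of the characteristic map to the boundary of a simplex. -/
def chiBd : cellPair (MulAction.stabilizer G t) (simplexBd (verts v.1)) (simplexSk (verts v.1)) ⟶
    relPair A p :=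
  chiSub (verts_mem_faces v) (stabilizer_le_verts v) (fun _ hx => hx.1)
    (fun _ hx hxs => mem_filt_of_mem_simplexBd (verts_mem_faces v) (card_verts_le v.1 le_rfl) hx hxs)
    (fun _ hx hxs => mem_filt_of_mem_simplexSk (verts_mem_faces v) (card_verts_le v.1 le_rfl) hx hxs)

/-- The restriction of the characteristic map to a face of a simplex. -/
def chiFace : simplexPair (MulAction.stabilizer G t) (face v.1 k) ⟶ relPair A p :=
  GPair.incl (cellSub_mono _ (closedSimplex_face_subset v.1 k))
    (cellSub_mono _ (simplexBd_face_subset_sk v.1 k)) ≫ chiBd v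

/-- The summand of the boundary of a cell that belongs to a face. -/
def faceTerm (q : ℤ) (x : (h.coeff q).obj ⟨MulAction.stabilizer G t⟩) :
    (h.H (p + q)).obj (relPair A p) :=
  h.ml (p + q) (chiFace v k)
    (linInv (h.zeta (MulAction.stabilizer G t) (face v.1 k) (p + q) q (add_comm q p)) x)

/-- Naturality along the characteristic map moves the boundary into the simplex, where it splits
into the incidence components; `zeta_face` turns each incidence into `(-1)^k ζ(s_k)⁻¹ ζ(s)`. -/
theorem tripleBd_cellHom (q : ℤ) (x : (h.coeff q).obj ⟨MulAction.stabilizer G t⟩)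
    (hpq : (p : ℤ) + q + 1 = ((p + 1 : ℕ) : ℤ) + q) :
    h.tripleBd (filt A (p + 2)) (filt A (p + 1)) (filt A p) ((p + 1 : ℕ) + q) (p + q) hpq
      (cellHom h v q x) = ∑ k : Fin (p + 2), (-1 : ℤ) ^ (k : ℕ) • faceTerm h v k q x := by
  obtain ⟨y, rfl⟩ := exists_zeta_eq h v q x
  rw [cellHom_eq h v q rfl]
  have h1 := h.tripleBd_natural (C := cellSub (MulAction.stabilizer G t) (simplexSk (verts v.1)))
    (C' := filt A p) (chiHom t v) (chiBd v) (fun _ _ _ => rfl) _ _ hpq y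
  refine h1.trans ?_
  rw [h.tripleBd_simplexSk, map_sum]
  refine Finset.sum_congr rfl fun k _ => ?_
  have h2 := h.zeta_face (MulAction.stabilizer G t) v.1 k ((p + 1 : ℕ) + q) (p + q) q hpq
    (add_comm q p) (add_comm q _) y
  have h3 : linInv (h.zeta (MulAction.stabilizer G t) (face v.1 k) (p + q) q (add_comm q p))
      (h.zeta (MulAction.stabilizer G t) v.1 ((p + 1 : ℕ) + q) q (add_comm q _) y) =
      (-1 : ℤ) ^ (k : ℕ) • h.incidence (MulAction.stabilizer G t) v.1 k _ _ hpq y := by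
    apply (h.zeta_bijective (MulAction.stabilizer G t) (face v.1 k) (p + q) q (add_comm q p)).1
    rw [apply_linInv (h.zeta_bijective _ _ _ _ _), map_zsmul, h2, smul_smul, ← mul_pow,
      neg_one_mul, neg_neg, one_pow, one_smul]
  rw [faceTerm, h3, map_zsmul, smul_smul, ← mul_pow, neg_one_mul, neg_neg, one_pow, one_smul]
  exact (h.ml_comp _ _ _ _).symm

/-- A face in `A` is mapped into `X_{p-1}`, the subspace of the target pair, since every filtration
stage contains `A`. -/
theorem faceTerm_eq_zero (hk : verts (face v.1 k) ∈ A.faces) (q : ℤ)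
    (x : (h.coeff q).obj ⟨MulAction.stabilizer G t⟩) : faceTerm h v k q x = 0 := by
  refine h.ml_eq_zero _ _ (fun y => ?_) _
  obtain ⟨⟨y, x⟩, hx⟩ := y
  induction y using Quotient.inductionOn with
  | h a =>
    refine (filt A p).smul_mem a (x := ⟨x, _, verts_mem_faces v,
      closedSimplex_mono (verts_face_subset v.1 k) hx⟩) ?_
    exact mem_filt.mpr ⟨_, ⟨A.faces_subset hk, Or.inl hk⟩, hx⟩

/-- The face still carries the smaller group `G_t` of the big simplex. Its characteristic map
factors through `G ⧸ G_{t'}`, and this change of subgroup is the source of `κ` in the boundary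
formula. -/
theorem faceTerm_eq {t' : Cells A p} (v' : VertexOrder t') (hv' : v'.1 = face v.1 k)
    (hle : MulAction.stabilizer G t ≤ MulAction.stabilizer G t') (q : ℤ)
    (x : (h.coeff q).obj ⟨MulAction.stabilizer G t⟩) :
    faceTerm h v k q x = cellHom h v' q (((h.coeff q).map (kappa hle)).hom x) := by
  obtain ⟨v', hv''⟩ := v'
  dsimp only at hv'
  subst hv'
  have hb := h.zeta_bijective (MulAction.stabilizer G t) (face v.1 k) (p + q) q (add_comm q p)
  obtain ⟨y, rfl⟩ := hb.2 x
  have h1 := h.zeta_relabel (kappa hle) (Equiv.refl V) (face v.1 k) (face v.1 k) (fun _ => rfl)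
    (p + q) q (add_comm q p) (fun _ hx => hx) (fun _ hx => hx) y
  rw [cellHom_eq h ⟨face v.1 k, hv''⟩ q h1, faceTerm, linInv_apply hb, ← h.ml_comp]
  congr 2
  refine GPair.hom_ext fun y => ?_
  obtain ⟨⟨y, x⟩, hx⟩ := y
  induction y using Quotient.inductionOn with
  | h a =>
    refine Subtype.ext (Subtype.ext (funext fun u => ?_))
    change x (a⁻¹ • u) = x ((a * 1)⁻¹ • u)
    rw [mul_one]

open Classical in
/-- The sign that compares the ordering of a face induced by the ordering `v` with the ordering
transported from the orbit representative of the face. -/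
def faceRefSign (ord : Orders A) (T : OrbitReps A) {s : Cells A (p + 1)} (v : VertexOrder s)
    (k : Fin (p + 2)) : ℤˣ :=
  if hk : verts (face v.1 k) ∈ A.faces then 1
  else orderSign (face v.1 k) (refOrder ord T (faceSimplex v k hk))

/-- The sign compares the order induced on the face with the order used by `α`. It can be computed
before translation by `g`, because the transported orders are equivariant. -/
theorem faceTerm_smul (ord : Orders A) (T : OrbitReps A) {s : Cells A (p + 1)} (v : VertexOrder s)
    (k : Fin (p + 2)) (g : G) (q : ℤ)
    (x : (h.coeff q).obj ⟨MulAction.stabilizer G (g • s)⟩) :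
    faceTerm h (smulVertexOrder g v) k q x = alphaHom p h ord T q
      (faceRefSign ord T v k • faceGen (h.coeff q) v k g x) := by
  have hface : face (smulVertexOrder g v).1 k = smulOrder g (face v.1 k) := rfl
  rw [faceRefSign, faceGen]
  split_ifs with hk
  · rw [smul_zero, map_zero]
    refine faceTerm_eq_zero h _ k ?_ q x
    rw [hface, verts_smulOrder]
    exact A.smul_mem_faces g _ hk
  · let f : VertexOrder (faceSimplex v k hk) := ⟨face v.1 k, rfl⟩
    rw [faceTerm_eq h (smulVertexOrder g v) k (smulVertexOrder g f) rfl
      (stabilizer_le_face v k hk g), Units.smul_def, map_zsmul, alphaHom_gen, ← Units.smul_def,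
      cellHom_orderSign h (smulVertexOrder g f) (refVertexOrder ord T (g • faceSimplex v k hk))]
    congr 1
    change orderSign (smulOrder g f.1) (refOrder ord T (g • faceSimplex v k hk)) = _
    rw [refOrder_smul, orderSign_smulOrder]
    exact f.2.trans (refVertexOrder ord T (faceSimplex v k hk)).2.symm

/-- The hypothesis `hv` is the only condition on the order `v`. It holds for the preferred order of
a representative, and for all preferred orders if these are invariant up to even permutations; so
both boundary formulas follow. -/
theorem tripleBd_alphaHom (ord : Orders A) (T : OrbitReps A) {s : Cells A (p + 1)}
    (v : VertexOrder s) (g : G) (hv : orderSign (refOrder ord T (g • s)) (smulOrder g v.1) = 1)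
    (q : ℤ) (x : (h.coeff q).obj ⟨MulAction.stabilizer G (g • s)⟩)
    (hpq : (p : ℤ) + q + 1 = ((p + 1 : ℕ) : ℤ) + q) :
    h.tripleBd (filt A (p + 2)) (filt A (p + 1)) (filt A p) ((p + 1 : ℕ) + q) (p + q) hpq
      (alphaHom (p + 1) h ord T q (gen (h.coeff q) (g • s) x)) =
    alphaHom p h ord T q (∑ k : Fin (p + 2), (-1 : ℤ) ^ (k : ℕ) •
      (faceRefSign ord T v k • faceGen (h.coeff q) v k g x)) := by
  rw [alphaHom_gen, cellHom_orderSign h _ (smulVertexOrder g v),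
    show orderSign (refVertexOrder ord T (g • s)).1 (smulVertexOrder g v).1 = 1 from hv, one_smul,
    tripleBd_cellHom, map_sum]
  refine Finset.sum_congr rfl fun k _ => ?_
  rw [map_zsmul, faceTerm_smul h ord T]

end Boundary

end GComplex

/-! ### Conclusion -/

namespace GComplex

variable {G V : Type u} [Group G] [MulAction G V] [DecidableEq V] {K : GComplex G V} {A : K.Sub}

theorem OrbitReps.finite (T : OrbitReps A) (p : ℕ)
    (hfin : Finite (MulAction.orbitRel.Quotient G (Cells A p))) : Finite (T.T p) := by
  refine Finite.of_injective
    (fun r : T.T p => (Quotient.mk'' r.1 : MulAction.orbitRel.Quotient G (Cells A p))) ?_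
  intro r r' hrr
  exact Subtype.ext ((T.exists_unique p r.1).unique ⟨r.2, MulAction.mem_orbit_self r.1⟩
    ⟨r'.2, MulAction.orbitRel_apply.mp (Quotient.exact hrr)⟩)

variable [TopologicalSpace G] [IsTopologicalGroup G] [LocallyCompactSpace G] {R : Type v} [Ring R]

omit [IsTopologicalGroup G] [LocallyCompactSpace G] in
open Classical in
theorem sigma_bijective (h : HomologyTheory.{u, v, w} G R)
    (hsum : h.HasDisjointUnions ∨
      ∀ p : ℕ, Finite (MulAction.orbitRel.Quotient G (Cells A p)))
    (T : OrbitReps A) (p : ℕ) (n : ℤ) (Q : T.T p → GPair G) : Function.Bijective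
      (DirectSum.toModule R (T.T p) ((h.H n).obj (GPair.sigma Q))
        (fun i => h.ml n (GPair.sigmaIncl Q i))) := by
  rcases hsum with hsum | hfin
  · convert hsum n _ Q
  · have := T.finite p (hfin p)
    exact h.sigma_bijective_of_finite n Q

/-- The isomorphism `α`. -/
def alphaEquiv (h : HomologyTheory.{u, v, w} G R)
    (hsum : h.HasDisjointUnions ∨
      ∀ p : ℕ, Finite (MulAction.orbitRel.Quotient G (Cells A p)))
    (ord : Orders A) (T : OrbitReps A) (p : ℕ) (q : ℤ) :
    GSetModule (h.coeff q) (Cells A p) ≃ₗ[R] (h.H (p + q)).obj (relPair A p) :=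
  LinearEquiv.ofBijective (alphaHom p h ord T q)
    (alphaHom_bijective p h ord T q (sigma_bijective h hsum T p (p + q)))

theorem alphaHom_gen_smul (h : HomologyTheory.{u, v, w} G R) (ord : Orders A) (T : OrbitReps A)
    {p : ℕ} (q : ℤ) (s : Cells A p) (g : G) (x : (h.coeff q).obj ⟨MulAction.stabilizer G (g • s)⟩)
    (hs : orderSign (refOrder ord T (g • s)) (ord p (g • s)).1 = simplexSign ord g s) :
    alphaHom p h ord T q (gen (h.coeff q) (g • s) x) =
      simplexSign ord g s • ((h.H (p + q)).map (chiHom (g • s) (ord p (g • s)))).hom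
        (linInv (h.zeta (MulAction.stabilizer G (g • s)) (ord p (g • s)).1 (p + q) q
          (add_comm q p)) x) := by
  rw [alphaHom_gen, cellHom_orderSign h _ (ord p (g • s)), ← hs]
  rfl

end GComplex

end EquivHom

end

theorem mainTheorem5 {G V : Type u} [Group G] [TopologicalSpace G] [IsTopologicalGroup G]
    [LocallyCompactSpace G] [T2Space G] [MulAction G V] [DecidableEq V] {R : Type v} [Ring R]
    (h : HomologyTheory.{u, v, w} G R) (K : GComplex G V) (A : K.Sub)
    (hsum : h.HasDisjointUnions ∨
      ∀ p : ℕ, Finite (MulAction.orbitRel.Quotient G (Cells A p)))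
    (ord : Orders A) (T : OrbitReps A) :
    -- the incidence maps and the maps `ζ(H, s)` are (well-defined) isomorphisms
    (∀ (H : Subgroup G) (p : ℕ) (v : Fin (p + 2) ↪ V) (k : Fin (p + 2)) (n m : ℤ)
      (hnm : m + 1 = n),
        Function.Bijective ((h.H m).map (faceIncl H v k)).hom ∧
        Function.Bijective (h.incidence H v k n m hnm)) ∧
    (∀ (H : Subgroup G) (p : ℕ) (v : Fin (p + 1) ↪ V) (n m : ℤ) (hnm : m + p = n),
        Function.Bijective (h.zeta H v n m hnm)) ∧
    -- in negative filtration degrees the chain modules `𝔥ₙ(A, A)` vanish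
    (∀ n : ℤ, Subsingleton ((h.H n).obj (GPair.of (filt A 0) (filt A 0)))) ∧
    ∃ (α : ∀ (p : ℕ) (q : ℤ),
          GSetModule (h.coeff q) (Cells A p) ≃ₗ[R] (h.H (p + q)).obj (relPair A p))
      (d : ∀ (p : ℕ) (q : ℤ),
          GSetModule (h.coeff q) (Cells A (p + 1)) →ₗ[R] GSetModule (h.coeff q) (Cells A p)),
      -- the formula for `α`
      (∀ (p : ℕ) (q : ℤ), ∀ s ∈ T.T p, ∀ (g : G)
        (x : (h.coeff q).obj ⟨MulAction.stabilizer G (g • s)⟩),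
        α p q (gen (h.coeff q) (g • s) x) =
          simplexSign ord g s • ((h.H (p + q)).map (chiHom (g • s) (ord p (g • s)))).hom
            (linInv (h.zeta (MulAction.stabilizer G (g • s)) (ord p (g • s)).1 (p + q) q
              (add_comm q p)) x)) ∧
      -- the formula for the boundary
      (∀ (p : ℕ) (q : ℤ), ∀ s ∈ T.T (p + 1), ∀ (g : G)
        (x : (h.coeff q).obj ⟨MulAction.stabilizer G (g • s)⟩),
        d p q (gen (h.coeff q) (g • s) x) =
          ∑ k : Fin (p + 2), (-1 : ℤ) ^ (k : ℕ) •
            (faceSign ord T s k • faceGen (h.coeff q) (ord (p + 1) s) k g x)) ∧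
      -- under `α` it corresponds to the boundary map of the triple `(X_{p+1}, X_p, X_{p-1})`
      (∀ (p : ℕ) (q : ℤ) (z : GSetModule (h.coeff q) (Cells A (p + 1))),
        h.tripleBd (filt A (p + 2)) (filt A (p + 1)) (filt A p) ((p + 1 : ℕ) + q) (p + q)
          (by push_cast; ring) (α (p + 1) q z) = α p q (d p q z)) ∧
      -- if the preferred orderings are compatible, up to even permutations, with the action, then
      -- the formula for `α` holds for all simplices; if they are compatible with faces as well,
      -- then the signs in the formula for the boundary disappear
      ((∀ (p : ℕ) (g : G) (s : Cells A p), simplexSign ord g s = 1) →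
        (∀ (p : ℕ) (q : ℤ) (s : Cells A p) (g : G)
          (x : (h.coeff q).obj ⟨MulAction.stabilizer G (g • s)⟩),
          α p q (gen (h.coeff q) (g • s) x) =
            simplexSign ord g s • ((h.H (p + q)).map (chiHom (g • s) (ord p (g • s)))).hom
              (linInv (h.zeta (MulAction.stabilizer G (g • s)) (ord p (g • s)).1 (p + q) q
                (add_comm q p)) x)) ∧
        ((∀ (p : ℕ) (s : Cells A (p + 1)) (k : Fin (p + 2))
          (hk : verts (face (ord (p + 1) s).1 k) ∉ A.faces),
          orderSign (face (ord (p + 1) s).1 k)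
            (ord p (faceSimplex (ord (p + 1) s) k hk)).1 = 1) →
          ∀ (p : ℕ) (q : ℤ) (s : Cells A (p + 1)) (g : G)
            (x : (h.coeff q).obj ⟨MulAction.stabilizer G (g • s)⟩),
            d p q (gen (h.coeff q) (g • s) x) =
              ∑ k : Fin (p + 2), (-1 : ℤ) ^ (k : ℕ) •
                faceGen (h.coeff q) (ord (p + 1) s) k g x)) := by
  have htriple : ∀ (p : ℕ) (q : ℤ), (p : ℤ) + q + 1 = ((p + 1 : ℕ) : ℤ) + q := fun p q => by
    push_cast; ring
  let α := alphaEquiv h hsum ord T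
  -- With the boundary transported through `α`, the compatibility with the triple boundary is
  -- automatic, and the content lies in the explicit formula.
  let d : ∀ (p : ℕ) (q : ℤ), GSetModule (h.coeff q) (Cells A (p + 1)) →ₗ[R]
      GSetModule (h.coeff q) (Cells A p) := fun p q =>
    (α p q).symm.toLinearMap ∘ₗ h.tripleBd (filt A (p + 2)) (filt A (p + 1)) (filt A p)
      ((p + 1 : ℕ) + q) (p + q) (htriple p q) ∘ₗ (α (p + 1) q).toLinearMap
  have hd : ∀ (p : ℕ) (q : ℤ) (s : Cells A (p + 1)) (g : G)
      (x : (h.coeff q).obj ⟨MulAction.stabilizer G (g • s)⟩),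
      orderSign (refOrder ord T (g • s)) (smulOrder g (ord (p + 1) s).1) = 1 →
      d p q (gen (h.coeff q) (g • s) x) = ∑ k : Fin (p + 2), (-1 : ℤ) ^ (k : ℕ) •
        (faceRefSign ord T (ord (p + 1) s) k • faceGen (h.coeff q) (ord (p + 1) s) k g x) :=
    fun p q s g x hs => (LinearEquiv.symm_apply_eq _).mpr
      (tripleBd_alphaHom h ord T (ord (p + 1) s) g hs q x (htriple p q))
  refine ⟨fun H p v k n m hnm => ⟨h.faceIncl_bijective H v k m, h.incidence_bijective H v k n m hnm⟩,
    fun H p v n m hnm => h.zeta_bijective H v n m hnm,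
    fun n => h.subsingleton_of_forall_mem n fun x => x.2, α, d, ?_, ?_, ?_, ?_⟩
  · intro p q s hs g x
    exact alphaHom_gen_smul h ord T q s g x (by rw [refOrder_eq ord T hs rfl]; rfl)
  · intro p q s hs g x
    -- For a representative the transported order of `gs` is literally the translate of the
    -- preferred order of `s`. At the preferred order `faceRefSign` unfolds to `faceSign`.
    exact hd p q s g x (by rw [refOrder_eq ord T hs rfl, orderSign_self])
  · intro p q z
    exact ((α p q).apply_symm_apply _).symm
  · intro hsign
    refine ⟨fun p q s g x => alphaHom_gen_smul h ord T q s g x ?_, fun hface p q s g x => ?_⟩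
    · rw [hsign, orderSign_refOrder ord T hsign]
    · rw [hd p q s g x]
      · refine Finset.sum_congr rfl fun k _ => ?_
        congr 1
        by_cases hk : verts (face (ord (p + 1) s).1 k) ∈ A.faces
        · rw [faceRefSign, dif_pos hk, one_smul]
        · let t := faceSimplex (ord (p + 1) s) k hk
          -- The comparison of the induced with the transported order passes through the preferred
          -- order of the face: the first sign is `1` by `hface`, the second by `hsign`.
          rw [faceRefSign, dif_neg hk, ← orderSign_mul (v' := (ord p t).1) (ord p t).2.symm
            ((ord p t).2.trans (verts_refOrder ord T t).symm), hface p s k hk,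
            orderSign_symm ((ord p t).2.trans (verts_refOrder ord T t).symm),
            orderSign_refOrder ord T hsign, one_mul, one_smul]
      · have h1 : verts (ord (p + 1) (g • s)).1 = verts (smulOrder g (ord (p + 1) s).1) :=
          (ord (p + 1) (g • s)).2.trans (smulVertexOrder g (ord (p + 1) s)).2.symm
        -- Here too the preferred order of `gs` is inserted, between the transported order and the
        -- translate of the preferred order of `s`; both signs are `1` by `hsign`.
        rw [← orderSign_mul ((verts_refOrder ord T (g • s)).trans (ord (p + 1) (g • s)).2.symm) h1,
          orderSign_refOrder ord T hsign, one_mul, orderSign_symm h1]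
        exact hsign (p + 1) g s
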